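/- **Setting.** Fix integers $k\ge 1$, $\ell\ge 1$ and $d$, and a $\sigma$-finite Borel measure $\lambda$ on $\mathbb{R}^d$. Let $\mathcal{F}$ be the set of probability densities with respect to $\lambda$, with its $L_1(\lambda)$ distance and Borel $\sigma$-field, $\Delta_k=\{x\in[0,1]^k:\sum_i x_i=1\}$ and $\Delta_k^k$ the set of $k\times k$ transition matrices (rows in $\Delta_k$). For $q>0$ let $\Delta_k^k(q)=\{Q\in\Delta_k^k: Q_{i,j}\ge q\ \forall i,j\}$. For $\theta=(Q,f)\in\Theta=\Delta_k^k\times\mathcal{F}^k$ let $\mu^Q$ be the stationary distribution of $Q$ (unique if all entries of $Q$ are positive; any choice otherwise), let $P^\theta$ be the law of the stationary hidden Markov model $(X_t,Y_t)_{t\ge1}$ with $X_1\sim\mu^Q$, transition matrix $Q$ and $Y_t\mid X_t\sim f_{X_t}\lambda$, and let $$p_n^\theta(y_1,\dots,y_n)=\sum_{x_1,\dots,x_n=1}^k\mu^Q_{x_1}Q_{x_1,x_2}\cdots Q_{x_{n-1},x_n}f_{x_1}(y_1)\cdots f_{x_n}(y_n).$$ Put $D_\ell(\theta,\theta')=\|p_\ell^\theta-p_\ell^{\theta'}\|_{L_1(\lambda^{\otimes\ell})}$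 and $d(f,g)=\max_{1\le i\le k}\|f_i-g_i\|_{L_1(\lambda)}$; let $N(\epsilon,A,d)$ be the minimal number of $d$-balls of radius $\epsilon$ covering $A\subset\mathcal{F}^k$, and $\|\cdot\|$ the maximum norm on matrices. The prior is $\Pi=\Pi_Q\otimes\Pi_f^{(k)}$, with $\Pi_Q$ a probability measure on $\Delta_k^k$ and $\Pi_f^{(k)}$ one on $\mathcal{F}^k$, and the posterior is $$\Pi(A\mid Y_{1:n})=\frac{\int_A p_n^\theta(Y_{1:n})\,\Pi(d\theta)}{\int_\Theta p_n^\theta(Y_{1:n})\,\Pi(d\theta)}.$$ The observations come from $P^{\theta^*}$, where $\theta^*=(Q^*,f^*)$ and $Q^*\in\Delta_k^k(\underline q^*)$ for some $\underline q^*>0$. Below, $\lesssim,\gtrsim$ mean inequality up to a positive multiplicative constant for all large $n$, and the bounds in (A) are required for all large $n$. **Theorem 1.** Let $\epsilon_n\ge\tilde\epsilon_n>0$ be two sequences tending to $0$ with $n\tilde\epsilon_n^2\to\infty$. Let $u_n=1$ for all $n$ if $\tilde\epsilon_n\gtrsim n^{-s}$ for some $s<1/2$, and $u_n=(\log n)^{3/2}$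 otherwise. Let $C_f,C,C',C_Q$ be positive constants with $C_Q+C_f+C_K<C$, where $C_K=4+\log(2k/\underline q^*)+10^4k^2/(\underline q^*)^5$. Assume: (A) There are sets $B_n\subset\mathcal{F}^k$ with $\Pi_f^{(k)}(B_n)\gtrsim\exp(-C_fn\tilde\epsilon_n^2)$ such that for every $f\in B_n$ $$\int f_i^*\log^2\frac{f_j^*}{f_j}\,d\lambda\le\frac{\tilde\epsilon_n^2}{u_n}\quad(1\le i,j\le k),$$ and there are a measurable set $S\subset\mathbb{R}^d$ and probability densities $\tilde f_1,\dots,\tilde f_k\in\mathcal{F}$ with, for all $1\le i,j\le k$, $$\int_S\frac{|f_j^*-f_j|^2}{f_j^*}d\lambda\le\frac{\tilde\epsilon_n^2}{u_n},\quad \int_{S^c}\tilde f_j\,d\lambda\le\tilde\epsilon_n^2,\quad \int_{S^c}f_j^*\,d\lambda\le\frac{\tilde\epsilon_n^2}{u_n},$$ $$\int_S f_i^*\max_{1\le m\le k}\log\frac{\tilde f_m}{f_m}\,d\lambda\le\tilde\epsilon_n^2,\quad \int_S\frac{|f_j^*-\tilde f_j|^2}{\tilde f_j}d\lambda\le\tilde\epsilon_n^2.$$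 (B) There are sets $\mathcal{F}_n\subset\mathcal{F}^k$ with $\Pi_f^{(k)}(\mathcal{F}_n^c)=o(\exp(-Cn\tilde\epsilon_n^2))$ and $N(\epsilon_n/12,\mathcal{F}_n,d)\lesssim\exp(C'n\epsilon_n^2)$. (C) $\Pi_Q(\{Q:\|Q-Q^*\|\le\tilde\epsilon_n/\sqrt{u_n}\})\gtrsim\exp(-C_Qn\tilde\epsilon_n^2)$. (D) $(\underline q_n)$ is a sequence in $(0,1/k]$ with $\Pi_Q\big((\Delta_k^k(\underline q_n))^c\big)=o(\exp(-Cn\tilde\epsilon_n^2))$. Then there is a constant $M>0$ such that $$\Pi\Big(\theta: D_\ell(\theta,\theta^*)\ge M\frac{\epsilon_n}{\underline q_n}\ \Big|\ Y_{1:n}\Big)\longrightarrow0\quad\text{in }P^{\theta^*}\text{-probability as }n\to\infty.$$ -/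

import Mathlib

open MeasureTheory Filter Topology Asymptotics
open scoped ENNReal NNReal

noncomputable section

namespace BayesHMM

/-! ### Parameters: transition matrices and emission densities -/

/-- The set of `k × k` transition matrices: every row lies in the probability simplex. It carries
the supremum distance over the entries and the Borel sigma-algebra. -/
abbrev TransMat (k : ℕ) : Type :=
  {Q : Fin k → Fin k → ℝ // ∀ i, Q i ∈ stdSimplex ℝ (Fin k)}

/-- The transition matrices all of whose entries are at least `q`. -/
def TransMat.bounded (k : ℕ) (q : ℝ) : Set (TransMat k) :=
  {Q | ∀ i j, q ≤ Q.1 i j}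

/-- `μ` is a stationary initial distribution of `Q`. -/
def IsStationary {k : ℕ} (Q : TransMat k) (μ : Fin k → ℝ) : Prop :=
  μ ∈ stdSimplex ℝ (Fin k) ∧ ∀ j, ∑ i, μ i * Q.1 i j = μ j

/-- A stationary distribution of `Q`. It is the only one when all entries of `Q` are positive;
for other `Q` an arbitrary one is picked. -/
def statDist {k : ℕ} (Q : TransMat k) : Fin k → ℝ :=
  Classical.epsilon (IsStationary Q)

variable {Y : Type*} [MeasurableSpace Y]

/-- The set of probability density functions with respect to `lam`, as a subset of `L¹(lam)`. -/
def Density (lam : Measure Y) : Type _ :=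
  {f : Lp ℝ 1 lam // 0 ≤ f ∧ ∫ y, f y ∂lam = 1}

/-- The `L¹` distance on densities. On `Fin k → Density lam` Mathlib then provides the maximum of
the coordinatewise `L¹` distances. -/
instance (lam : Measure Y) : MetricSpace (Density lam) :=
  inferInstanceAs (MetricSpace {f : Lp ℝ 1 lam // 0 ≤ f ∧ ∫ y, f y ∂lam = 1})

/-- The Borel sigma-algebra of the `L¹` distance. -/
instance (lam : Measure Y) : MeasurableSpace (Density lam) := borel _

instance (lam : Measure Y) : BorelSpace (Density lam) := ⟨rfl⟩

/-- A density is used as a function through its representative. -/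
instance (lam : Measure Y) : CoeFun (Density lam) (fun _ => Y → ℝ) := ⟨fun f => f.1⟩

/-- The parameter `θ = (Q, f)`. -/
abbrev Param (k : ℕ) (lam : Measure Y) : Type _ :=
  TransMat k × (Fin k → Density lam)

/-! ### The hidden Markov model -/

/-- `μ_{x_1} Q_{x_1,x_2} ⋯ Q_{x_{n-1},x_n}` (equal to `1` for the empty path). -/
def pathProb {k : ℕ} (μ : Fin k → ℝ) (Q : TransMat k) : (n : ℕ) → (Fin n → Fin k) → ℝ
  | 0, _ => 1
  | m + 1, x => μ (x 0) * ∏ t : Fin m, Q.1 (x t.castSucc) (x t.succ)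

/-- The joint density of `n` consecutive observations, for emission densities `f`. -/
def obsDensity {k : ℕ} (μ : Fin k → ℝ) (Q : TransMat k) (f : Fin k → Y → ℝ) (n : ℕ)
    (y : Fin n → Y) : ℝ :=
  ∑ x : Fin n → Fin k, pathProb μ Q n x * ∏ t, f (x t) (y t)

/-- `(X_t, Y_t)` is a hidden Markov chain on the probability space `(Ω, P)` with initial
distribution `μ` and parameter `θ`; time starts at `t = 0`. -/
structure IsHMM {k : ℕ} {lam : Measure Y} {Ω : Type*} [MeasurableSpace Ω] (P : Measure Ω)
    (X : ℕ → Ω → Fin k) (Z : ℕ → Ω → Y) (μ : Fin k → ℝ) (θ : Param k lam) : Prop where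
  measurable_state : ∀ t, Measurable (X t)
  measurable_obs : ∀ t, Measurable (Z t)
  law : ∀ (n : ℕ) (A : Set ((Fin n → Fin k) × (Fin n → Y))), MeasurableSet A →
    P {ω | (fun t : Fin n => X t ω, fun t : Fin n => Z t ω) ∈ A} =
      ∫⁻ y : Fin n → Y, ∑ x : Fin n → Fin k,
        A.indicator (fun _ => ENNReal.ofReal (pathProb μ θ.1 n x * ∏ t, θ.2 (x t) (y t))) (x, y)
        ∂(Measure.pi fun _ => lam)

/-- The pseudo-distance `D_ℓ`: the `L¹` distance between the densities of `ℓ` consecutive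
observations of the stationary chains. -/
def marginalDist {k : ℕ} {lam : Measure Y} (l : ℕ) (θ θ' : Param k lam) : ℝ :=
  ∫ y : Fin l → Y,
    |obsDensity (statDist θ.1) θ.1 (fun j => ⇑(θ.2 j)) l y
      - obsDensity (statDist θ'.1) θ'.1 (fun j => ⇑(θ'.2 j)) l y| ∂(Measure.pi fun _ => lam)

/-! ### Prior and posterior -/

/-- `g` is a version of the densities that is jointly measurable in the density vector and the
point, as Bayes' formula needs. Densities are `lam`-almost everywhere classes; two such versions
give the same posterior for almost all observations. -/
structure IsJointVersion {k : ℕ} {lam : Measure Y}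
    (g : (Fin k → Density lam) → Fin k → Y → ℝ) : Prop where
  measurable : ∀ j, Measurable (fun p : (Fin k → Density lam) × Y => g p.1 j p.2)
  ae_eq : ∀ f j, g f j =ᵐ[lam] f j

open ProbabilityTheory in
/-- A jointly measurable version exists. -/
theorem exists_isJointVersion {k : ℕ} [MeasurableSpace.CountablyGenerated Y] (lam : Measure Y) [SigmaFinite lam] :
    ∃ g : (Fin k → Density lam) → Fin k → Y → ℝ, IsJointVersion g := by
  classical
  have hlin : ∀ (f : Density lam) (A : Set Y), MeasurableSet A →
      (lam.withDensity fun y => ENNReal.ofReal (f y)) A = ENNReal.ofReal (∫ y in A, f y ∂lam) := by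
    intro f A hA
    rw [withDensity_apply _ hA, ofReal_integral_eq_lintegral_ofReal]
    · exact (L1.integrable_coeFn f.1).integrableOn
    · exact ae_restrict_of_ae ((Lp.coeFn_nonneg f.1).2 f.2.1)
  let κ : Kernel (Density lam) Y :=
    ⟨fun f => lam.withDensity fun y => ENNReal.ofReal (f y), by
      refine Measure.measurable_of_measurable_coe _ fun A hA => ?_
      simp_rw [fun f : Density lam => hlin f A hA]
      have hc : Continuous fun f : Density lam => ∫ y in A, f y ∂lam :=
        (continuous_setIntegral A).comp continuous_subtype_val
      exact hc.measurable.ennreal_ofReal⟩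
  have : IsFiniteKernel κ := ⟨1, by simp, fun f => by
    change (lam.withDensity fun y => ENNReal.ofReal (f y)) Set.univ ≤ 1
    rw [hlin f _ MeasurableSet.univ, setIntegral_univ, f.2.2]; simp⟩
  let η : Kernel (Density lam) Y := Kernel.const _ lam.toFinite
  refine ⟨fun f j y => (Kernel.rnDeriv κ η (f j) y * lam.toFinite.rnDeriv lam y).toReal, ?_, ?_⟩
  · intro j
    have h1 := Kernel.measurable_rnDeriv κ η
    have h2 : Measurable fun p : (Fin k → Density lam) × Y => ((p.1 j, p.2) : Density lam × Y) := by
      fun_prop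
    exact ((h1.comp h2).mul ((Measure.measurable_rnDeriv _ _).comp measurable_snd)).ennreal_toReal
  · intro f j
    have h1 : Kernel.rnDeriv κ η (f j) =ᵐ[lam.toFinite] (κ (f j)).rnDeriv lam.toFinite :=
      Kernel.rnDeriv_eq_rnDeriv_measure
    have h1' := (absolutelyContinuous_toFinite lam).ae_le h1
    have hac : κ (f j) ≪ lam.toFinite :=
      (withDensity_absolutelyContinuous _ _).trans (absolutelyContinuous_toFinite lam)
    have h2 := Measure.rnDeriv_mul_rnDeriv (κ := lam) hac
    have h3 : (κ (f j)).rnDeriv lam =ᵐ[lam] fun y => ENNReal.ofReal (f j y) :=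
      Measure.rnDeriv_withDensity _ (Lp.stronglyMeasurable (f j).1).measurable.ennreal_ofReal
    filter_upwards [h1', h2, h3, (Lp.coeFn_nonneg (f j).1).2 (f j).2.1] with y a b c e
    simp only [Pi.mul_apply] at b
    rw [a, b, c]
    exact ENNReal.toReal_ofReal e

/-- Bayes' formula: the posterior mass of `A` given the observations `y`, for the prior `Pi` and
the stationary model. -/
def posterior {k : ℕ} {lam : Measure Y} (Pi : Measure (Param k lam))
    (g : (Fin k → Density lam) → Fin k → Y → ℝ) {n : ℕ} (y : Fin n → Y)
    (A : Set (Param k lam)) : ℝ≥0∞ :=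
  (∫⁻ θ in A, ENNReal.ofReal (obsDensity (statDist θ.1) θ.1 (g θ.2) n y) ∂Pi) /
    ∫⁻ θ, ENNReal.ofReal (obsDensity (statDist θ.1) θ.1 (g θ.2) n y) ∂Pi

/-! ### The assumptions -/

/-- `log (a / b)` for `a, b ≥ 0`, with values in `[-∞, ∞]`; `log (a / 0) = ∞` and
`log (0 / b) = -∞` for `a, b > 0`, and `log (0 / 0) = 0`. -/
def logRatio (a b : ℝ) : EReal :=
  if a = 0 ∧ b = 0 then 0 else ENNReal.log (ENNReal.ofReal a / ENNReal.ofReal b)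

/-- `∫_S (a - b)² / b`, with values in `[0, ∞]`; here `c / 0 = ∞` for `c > 0` and `0 / 0 = 0`. -/
def chiSq (lam : Measure Y) (S : Set Y) (a b : Y → ℝ) : ℝ≥0∞ :=
  ∫⁻ y in S, ENNReal.ofReal ((a y - b y) ^ 2) / ENNReal.ofReal (b y) ∂lam

/-- The integral of `φ` exists in `[-∞, ∞)` and is at most `c`. -/
def ExtIntegralLE (ν : Measure Y) (φ : Y → EReal) (c : ℝ) : Prop :=
  ∫⁻ y, (φ y).toENNReal ∂ν ≠ ∞ ∧
    ((∫⁻ y, (φ y).toENNReal ∂ν : ℝ≥0∞) : EReal) - ((∫⁻ y, (-φ y).toENNReal ∂ν : ℝ≥0∞) : EReal)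
      ≤ (c : EReal)

/-- The closeness of the emission densities `f` to the true ones `fs`, with `e` in the role of
`ε̃_n` and `u` in the role of `u_n`. -/
def EmissionClose {k : ℕ} {lam : Measure Y} (fs f : Fin k → Density lam) (e u : ℝ) : Prop :=
  (∀ i j, ∫⁻ y, ENNReal.ofReal (fs i y) * (logRatio (fs j y) (f j y)).abs ^ 2 ∂lam
      ≤ ENNReal.ofReal (e ^ 2 / u)) ∧
  ∃ (S : Set Y) (ft : Fin k → Density lam), MeasurableSet S ∧
    (∀ j, chiSq lam S (f j) (fs j) ≤ ENNReal.ofReal (e ^ 2 / u)) ∧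
    (∀ j, ∫ y in Sᶜ, ft j y ∂lam ≤ e ^ 2) ∧
    (∀ j, ∫ y in Sᶜ, fs j y ∂lam ≤ e ^ 2 / u) ∧
    (∀ i, ExtIntegralLE (lam.restrict S)
      (fun y => (fs i y : EReal) * ⨆ j, logRatio (ft j y) (f j y)) (e ^ 2)) ∧
    (∀ j, chiSq lam S (fs j) (ft j) ≤ ENNReal.ofReal (e ^ 2))

open Classical in
/-- `u_n = 1` if `ε̃_n ≳ n^{-s}` for some `s < 1/2`, and `u_n = (log n)^{3/2}` otherwise. -/
def uSeq (et : ℕ → ℝ) (n : ℕ) : ℝ :=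
  if ∃ s : ℝ, s < 1 / 2 ∧ (fun m : ℕ => (m : ℝ) ^ (-s)) =O[atTop] et then 1
  else Real.log n ^ (3 / 2 : ℝ)

/-- Prior mass of Kullback-Leibler type neighbourhoods of the true emission densities. -/
def AssumptionA {k : ℕ} {lam : Measure Y} (Pif : Measure (Fin k → Density lam))
    (fs : Fin k → Density lam) (et : ℕ → ℝ) (Cf : ℝ) : Prop :=
  ∃ B : ℕ → Set (Fin k → Density lam),
    (fun n : ℕ => Real.exp (-Cf * n * et n ^ 2)) =O[atTop] (fun n => Pif.real (B n)) ∧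
    ∀ᶠ n in atTop, ∀ f ∈ B n, EmissionClose fs f (et n) (uSeq et n)

/-- A sieve with small prior complement and controlled entropy. The covering number counts closed
balls with arbitrary centres. -/
def AssumptionB {k : ℕ} {lam : Measure Y} (Pif : Measure (Fin k → Density lam))
    (eps et : ℕ → ℝ) (C C' : ℝ) : Prop :=
  ∃ F : ℕ → Set (Fin k → Density lam),
    (fun n => Pif.real (F n)ᶜ) =o[atTop] (fun n : ℕ => Real.exp (-C * n * et n ^ 2)) ∧
    ∃ K : ℝ, ∀ᶠ n : ℕ in atTop,
      ((Metric.externalCoveringNumber (eps n / 12).toNNReal (F n) : ℕ∞) : ℝ≥0∞)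
        ≤ ENNReal.ofReal (K * Real.exp (C' * n * eps n ^ 2))

/-- The constant `C_K`. -/
def constK (k : ℕ) (qs : ℝ) : ℝ :=
  4 + Real.log (2 * k / qs) + 10 ^ 4 * k ^ 2 / qs ^ 5

/-- Prior mass of neighbourhoods of the true transition matrix, in the supremum norm. -/
def AssumptionC {k : ℕ} (PiQ : Measure (TransMat k)) (Qs : TransMat k) (et : ℕ → ℝ)
    (CQ : ℝ) : Prop :=
  (fun n : ℕ => Real.exp (-CQ * n * et n ^ 2)) =O[atTop]
    (fun n => PiQ.real {Q | ‖Q.1 - Qs.1‖ ≤ et n / √(uSeq et n)})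

/-- Transition matrices with an entry below `q n` have negligible prior mass. -/
def AssumptionD {k : ℕ} (PiQ : Measure (TransMat k)) (et q : ℕ → ℝ) (C : ℝ) : Prop :=
  (∀ n, 0 < q n ∧ q n ≤ 1 / k) ∧
  (fun n => PiQ.real (TransMat.bounded k (q n))ᶜ) =o[atTop]
    (fun n : ℕ => Real.exp (-C * n * et n ^ 2))

end BayesHMM

end

open BayesHMM

namespace BayesHMM

/-! ### Transition matrices and stationary distributions -/

section Stationary

variable {k : ℕ}

/-! The posterior mass of the bad set is a quotient. Its numerator is small in mean on the
acceptance region of a test, and its denominator is rarely much smaller than the true likelihood;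
`IsJointVersion.measure_posterior_ge_le` combines the two by Fubini and Markov's inequality.

Tests. Fix emission densities `c`. For every transition matrix `Q`, the density of `l` observations
under `(Q, c)` is a combination of the same `k ^ l` products of the `c j`. Together with the true
density these span a space of dimension at most `k ^ l + 1` in `L¹`, where a finite net of the
sphere supplies at most `5 ^ (k ^ l + 1)` functions bounded by one, one of which detects half of any
`L¹` norm (`exists_testFunctions`). Hence only the emission densities have to be covered, never the
transition matrices (`exists_testFunctions_marginalDist`). The test compares sums of such a function
over sliding blocks with their true mean. If all entries of `Q` are at least `q`, the chain forgets
its state at rate `1 - q`, and a function with differences bounded by `c` satisfies a Hoeffding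
bound with `c / q` in place of `c` (`integral_exp_stateLaw_le`). A deviation of order `ε / q`
therefore has probability of order `exp (-D n ε²)`, which is the source of the rate `ε_n / q_n`. The
result is `exists_acceptanceRegion`.

Denominator. Both likelihoods are sums over hidden paths, so they are compared path by path. The
weight of a path under `Q*` exceeds a large multiple of its weight under a nearby `Q` only on a set
of small mass, by a second moment bound that multiplies along the chain (`sum_pathProb_gt_le`).
Given a path the observations are independent, so Chebyshev's inequality controls the product of the
emission ratios (`pi_emissionLaw_prod_gt_le`); the mean and variance of one log ratio come from
assumption (A) through `EmissionClose.moments`. Outside the exceptional paths and observations the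
terms compare one by one, whence `withDensity_pathDensity_lt_le`. No expansion of the log-likelihood
of the whole model is needed, and the exponent lost is at most `2 * k / qs + 6 ≤ constK k qs`.

Initial distributions. `statDist` is an arbitrary choice for degenerate `Q`, so its measurability in
`Q` is not available. In the integrals over the prior it is replaced by the constant vector `1`:
from above since its entries are at most one, from below, near `Q*`, since they are at least `qs /
2`.

`measure_posterior_ge_le_of_sieve` collects the bounds at a fixed `n`. The choice `D = C' + C + 1`
then pays for the entropy and for the denominator, and leaves a factor tending to zero. -/

theorem TransMat.nonneg (Q : TransMat k) (i j : Fin k) : 0 ≤ Q.1 i j := (Q.2 i).1 j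

theorem TransMat.sum_eq_one (Q : TransMat k) (i : Fin k) : ∑ j, Q.1 i j = 1 := (Q.2 i).2

theorem TransMat.sum_ofReal (Q : TransMat k) (i : Fin k) :
    ∑ j, ENNReal.ofReal (Q.1 i j) = 1 := by
  rw [← ENNReal.ofReal_sum_of_nonneg fun j _ => Q.nonneg i j, Q.sum_eq_one, ENNReal.ofReal_one]

/-- The constant vector is a right eigenvector for the eigenvalue 1, so a nonzero left eigenvector
`v` exists. The triangle inequality gives `|v| ≤ |v| Q` entrywise; both sides have the same total
because rows sum to one, so equality holds and `|v|` can be normalised. -/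
theorem exists_isStationary [NeZero k] (Q : TransMat k) : ∃ μ, IsStationary Q μ := by
  have hdet : (Matrix.of Q.1 - 1 : Matrix (Fin k) (Fin k) ℝ).det = 0 := by
    refine Matrix.exists_mulVec_eq_zero_iff.1 ⟨fun _ => 1, ?_, ?_⟩
    · intro h
      simpa using congrFun h 0
    · ext i
      rw [Matrix.sub_mulVec, Matrix.one_mulVec]
      simp [Matrix.mulVec, dotProduct, Q.sum_eq_one i]
  obtain ⟨v, hv0, hv⟩ := Matrix.exists_vecMul_eq_zero_iff.2 hdet
  have hst : ∀ j, ∑ i, v i * Q.1 i j = v j := by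
    intro j
    have := congrFun hv j
    rw [Matrix.vecMul_sub, Matrix.vecMul_one] at this
    simp only [Pi.sub_apply, Pi.zero_apply, Matrix.vecMul, dotProduct, Matrix.of_apply] at this
    linarith
  have hle : ∀ j, |v j| ≤ ∑ i, |v i| * Q.1 i j := by
    intro j
    rw [← hst j]
    refine (Finset.abs_sum_le_sum_abs _ _).trans (le_of_eq ?_)
    exact Finset.sum_congr rfl fun i _ => by rw [abs_mul, abs_of_nonneg (Q.nonneg i j)]
  have htot : ∑ j, ∑ i, |v i| * Q.1 i j = ∑ j, |v j| := by
    rw [Finset.sum_comm]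
    exact Finset.sum_congr rfl fun i _ => by rw [← Finset.mul_sum, Q.sum_eq_one, mul_one]
  have heq : ∀ j, ∑ i, |v i| * Q.1 i j = |v j| := by
    intro j
    exact ((Finset.sum_eq_sum_iff_of_le fun j _ => hle j).1 htot.symm j (Finset.mem_univ j)).symm
  have hs : 0 < ∑ j, |v j| := by
    obtain ⟨i, hi⟩ := Function.ne_iff.1 hv0
    exact Finset.sum_pos' (fun j _ => abs_nonneg _) ⟨i, Finset.mem_univ i, abs_pos.2 hi⟩
  refine ⟨fun i => |v i| / ∑ j, |v j|, ⟨fun i => by positivity, ?_⟩, fun j => ?_⟩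
  · rw [← Finset.sum_div, div_self hs.ne']
  · simp_rw [div_mul_eq_mul_div]
    rw [← Finset.sum_div, heq]

theorem statDist_isStationary [NeZero k] (Q : TransMat k) : IsStationary Q (statDist Q) :=
  Classical.epsilon_spec (exists_isStationary Q)

theorem IsStationary.le_apply {Q : TransMat k} {μ : Fin k → ℝ} (h : IsStationary Q μ) {q : ℝ}
    (hq : Q ∈ TransMat.bounded k q) (j : Fin k) : q ≤ μ j := by
  rw [← h.2 j]
  calc q = ∑ i, μ i * q := by rw [← Finset.sum_mul, h.1.2, one_mul]
    _ ≤ _ := Finset.sum_le_sum fun i _ => mul_le_mul_of_nonneg_left (hq i j) (h.1.1 i)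

end Stationary

/-! ### Path densities -/

section PathDensity

variable {k : ℕ} {Y : Type*}

/-- The density of `n` observations with values in `[0, ∞]`, for a not necessarily normalised
initial vector `μ`. -/
noncomputable def pathDensity (μ : Fin k → ℝ) (Q : TransMat k) (f : Fin k → Y → ℝ) (n : ℕ) (y : Fin n → Y) :
    ℝ≥0∞ :=
  ∑ x : Fin n → Fin k, ENNReal.ofReal (pathProb μ Q n x) * ∏ t, ENNReal.ofReal (f (x t) (y t))

theorem pathProb_nonneg {μ : Fin k → ℝ} (hμ : ∀ i, 0 ≤ μ i) (Q : TransMat k) :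
    ∀ (n : ℕ) (x : Fin n → Fin k), 0 ≤ pathProb μ Q n x
  | 0, _ => zero_le_one
  | _ + 1, _ => mul_nonneg (hμ _) (Finset.prod_nonneg fun _ _ => Q.nonneg _ _)

theorem pathProb_cons (μ : Fin k → ℝ) (Q : TransMat k) (n : ℕ) (i : Fin k)
    (x : Fin (n + 1) → Fin k) :
    pathProb μ Q (n + 2) (Fin.cons i x) = μ i * pathProb (Q.1 i) Q (n + 1) x := by
  simp only [pathProb, Fin.cons_zero]
  rw [Fin.prod_univ_succ]
  simp only [Fin.castSucc_zero, Fin.cons_zero, Fin.cons_succ, Fin.castSucc_succ]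

theorem sum_pathProb {μ : Fin k → ℝ} (hμ : ∑ i, μ i = 1) (Q : TransMat k) (n : ℕ) :
    ∑ x, pathProb μ Q n x = 1 := by
  cases n with
  | zero => simp [pathProb]
  | succ n =>
    induction n generalizing μ with
    | zero =>
      rw [← (Fin.consEquiv fun _ => Fin k).sum_comp, Fintype.sum_prod_type]
      simpa [pathProb, Fin.consEquiv] using hμ
    | succ n ih =>
      rw [← (Fin.consEquiv fun _ => Fin k).sum_comp, Fintype.sum_prod_type]
      simp only [Fin.consEquiv, Equiv.coe_fn_mk, pathProb_cons, ← Finset.mul_sum]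
      simp only [ih (Q.sum_eq_one _), mul_one, hμ]

theorem pathProb_mono {μ ν : Fin k → ℝ} (h : ∀ i, μ i ≤ ν i) (Q : TransMat k) (n : ℕ)
    (x : Fin n → Fin k) : pathProb μ Q n x ≤ pathProb ν Q n x := by
  cases n with
  | zero => exact le_rfl
  | succ n =>
    exact mul_le_mul_of_nonneg_right (h _) (Finset.prod_nonneg fun _ _ => Q.nonneg _ _)

theorem pathDensity_mono {μ ν : Fin k → ℝ} (h : ∀ i, μ i ≤ ν i) (Q : TransMat k)
    (f : Fin k → Y → ℝ) (n : ℕ) (y : Fin n → Y) :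
    pathDensity μ Q f n y ≤ pathDensity ν Q f n y := by
  unfold pathDensity
  gcongr
  exact pathProb_mono h Q n _

/-- Together with `pathDensity_mono`, this exchanges an initial distribution for the constant vector
`1`. The empty path has weight 1 whatever the initial vector is, hence `n ≠ 0`. -/
theorem pathDensity_smul_le {μ : Fin k → ℝ} {c : ℝ} (hc : 0 ≤ c) (h : ∀ i, c ≤ μ i)
    (Q : TransMat k) (f : Fin k → Y → ℝ) {n : ℕ} (hn : n ≠ 0) (y : Fin n → Y) :
    ENNReal.ofReal c * pathDensity (fun _ => 1) Q f n y ≤ pathDensity μ Q f n y := by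
  obtain ⟨n, rfl⟩ := Nat.exists_eq_succ_of_ne_zero hn
  unfold pathDensity
  rw [Finset.mul_sum]
  refine Finset.sum_le_sum fun x _ => ?_
  rw [← mul_assoc, ← ENNReal.ofReal_mul hc]
  gcongr
  simp only [pathProb, one_mul]
  exact mul_le_mul_of_nonneg_right (h _) (Finset.prod_nonneg fun _ _ => Q.nonneg _ _)

theorem pathDensity_lt_top (μ : Fin k → ℝ) (Q : TransMat k) (f : Fin k → Y → ℝ) (n : ℕ)
    (y : Fin n → Y) : pathDensity μ Q f n y < ∞ :=
  ENNReal.sum_lt_top.2 fun _ _ =>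
    ENNReal.mul_lt_top ENNReal.ofReal_lt_top (ENNReal.prod_lt_top fun _ _ => ENNReal.ofReal_lt_top)

theorem ofReal_obsDensity {μ : Fin k → ℝ} (hμ : ∀ i, 0 ≤ μ i) (Q : TransMat k)
    {f : Fin k → Y → ℝ} {n : ℕ} {y : Fin n → Y} (hf : ∀ i t, 0 ≤ f i (y t)) :
    ENNReal.ofReal (obsDensity μ Q f n y) = pathDensity μ Q f n y := by
  unfold obsDensity pathDensity
  rw [ENNReal.ofReal_sum_of_nonneg fun x _ =>
    mul_nonneg (pathProb_nonneg hμ Q n x) (Finset.prod_nonneg fun _ _ => hf _ _)]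
  refine Finset.sum_congr rfl fun x _ => ?_
  rw [ENNReal.ofReal_mul (pathProb_nonneg hμ Q n x),
    ENNReal.ofReal_prod_of_nonneg fun _ _ => hf _ _]

theorem obsDensity_nonneg {μ : Fin k → ℝ} (hμ : ∀ i, 0 ≤ μ i) (Q : TransMat k)
    {f : Fin k → Y → ℝ} {n : ℕ} {y : Fin n → Y} (hf : ∀ i t, 0 ≤ f i (y t)) :
    0 ≤ obsDensity μ Q f n y :=
  Finset.sum_nonneg fun x _ =>
    mul_nonneg (pathProb_nonneg hμ Q n x) (Finset.prod_nonneg fun _ _ => hf _ _)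

variable [MeasurableSpace Y]

theorem measurable_pathDensity {μ : Fin k → ℝ} {Q : TransMat k} {f : Fin k → Y → ℝ}
    (hf : ∀ i, Measurable (f i)) (n : ℕ) : Measurable (pathDensity μ Q f n) := by
  unfold pathDensity
  refine Finset.measurable_fun_sum _ fun x _ => Measurable.const_mul ?_ _
  exact Finset.measurable_fun_prod _ fun t _ =>
    ((hf (x t)).comp (measurable_pi_apply t)).ennreal_ofReal

theorem pathDensity_ae_congr {lam : Measure Y} [SigmaFinite lam] {μ : Fin k → ℝ} {Q : TransMat k}
    {f f' : Fin k → Y → ℝ} (h : ∀ i, f i =ᵐ[lam] f' i) (n : ℕ) :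
    pathDensity μ Q f n =ᵐ[Measure.pi fun _ => lam] pathDensity μ Q f' n := by
  have h1 : ∀ᵐ y ∂(Measure.pi fun _ : Fin n => lam), ∀ (t : Fin n) (i : Fin k),
      f i (y t) = f' i (y t) := by
    refine ae_all_iff.2 fun t => ae_all_iff.2 fun i => ?_
    exact (Measure.tendsto_eval_ae_ae (μ := fun _ : Fin n => lam) (i := t)).eventually (h i)
  filter_upwards [h1] with y hy
  simp only [pathDensity, hy]

end PathDensity

/-! ### The law of the observations -/

section StateLaw

variable {k : ℕ} {Y : Type*} [MeasurableSpace Y]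

theorem measurable_cons {n : ℕ} :
    Measurable fun p : Y × (Fin n → Y) => (Fin.cons p.1 p.2 : Fin (n + 1) → Y) := by
  refine measurable_pi_iff.2 fun i => ?_
  refine Fin.cases ?_ (fun j => ?_) i
  · simpa using measurable_fst
  · exact (measurable_pi_apply j).comp measurable_snd

/-- The law of a first observation followed by independent later ones. -/
noncomputable def consLaw {n : ℕ} (ρ : Measure Y) (ν : Measure (Fin n → Y)) : Measure (Fin (n + 1) → Y) :=
  (ρ.prod ν).map fun p => Fin.cons p.1 p.2

instance {n : ℕ} (ρ : Measure Y) (ν : Measure (Fin n → Y)) [IsProbabilityMeasure ρ]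
    [IsProbabilityMeasure ν] : IsProbabilityMeasure (consLaw ρ ν) :=
  Measure.isProbabilityMeasure_map measurable_cons.aemeasurable

theorem pi_cons {n : ℕ} (ρ : Measure Y) [SigmaFinite ρ] (m : Fin n → Measure Y)
    [∀ t, SigmaFinite (m t)] :
    Measure.pi (Fin.cons ρ m : Fin (n + 1) → Measure Y) = consLaw ρ (Measure.pi m) := by
  have : ∀ t, SigmaFinite ((Fin.cons ρ m : Fin (n + 1) → Measure Y) t) := by
    intro t
    refine Fin.cases ?_ (fun j => ?_) t
    · simpa
    · simp only [Fin.cons_succ]; infer_instance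
  refine Measure.pi_eq fun s hs => ?_
  rw [consLaw, Measure.map_apply measurable_cons (MeasurableSet.univ_pi hs)]
  have : (fun p : Y × (Fin n → Y) => (Fin.cons p.1 p.2 : Fin (n + 1) → Y)) ⁻¹' Set.univ.pi s
      = s 0 ×ˢ Set.univ.pi fun j => s j.succ := by
    ext p
    simp [Fin.forall_fin_succ]
  rw [this, Measure.prod_prod, Measure.pi_pi, Fin.prod_univ_succ]
  simp

/-- The law of `n` observations started from state `i`, for emission laws `F`. -/
noncomputable def stateLaw (F : Fin k → Measure Y) (Q : TransMat k) : (n : ℕ) → Fin k → Measure (Fin n → Y)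
  | 0, _ => Measure.dirac fun t => t.elim0
  | n + 1, i => ∑ z, ENNReal.ofReal (Q.1 i z) • consLaw (F i) (stateLaw F Q n z)

theorem isProbabilityMeasure_sum_smul {ι α : Type*} [Fintype ι] [MeasurableSpace α]
    (w : ι → ℝ≥0∞) (hw : ∑ i, w i = 1) (ν : ι → Measure α) [∀ i, IsProbabilityMeasure (ν i)] :
    IsProbabilityMeasure (∑ i, w i • ν i) :=
  ⟨by simp [Measure.finsetSum_apply, hw]⟩

instance isProbabilityMeasure_stateLaw (F : Fin k → Measure Y) [∀ i, IsProbabilityMeasure (F i)]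
    (Q : TransMat k) (n : ℕ) (i : Fin k) : IsProbabilityMeasure (stateLaw F Q n i) := by
  induction n generalizing i with
  | zero => unfold stateLaw; infer_instance
  | succ n ih => exact isProbabilityMeasure_sum_smul _ (Q.sum_ofReal i) _

/-- The law of `n` observations for the initial vector `μ`. -/
noncomputable def mixLaw (F : Fin k → Measure Y) (Q : TransMat k) (μ : Fin k → ℝ) (n : ℕ) :
    Measure (Fin n → Y) :=
  ∑ i, ENNReal.ofReal (μ i) • stateLaw F Q n i

theorem isProbabilityMeasure_mixLaw (F : Fin k → Measure Y) [∀ i, IsProbabilityMeasure (F i)]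
    (Q : TransMat k) {μ : Fin k → ℝ} (hμ : μ ∈ stdSimplex ℝ (Fin k)) (n : ℕ) :
    IsProbabilityMeasure (mixLaw F Q μ n) :=
  isProbabilityMeasure_sum_smul _
    (by rw [← ENNReal.ofReal_sum_of_nonneg fun j _ => hμ.1 j, hμ.2, ENNReal.ofReal_one]) _

theorem consLaw_apply {n : ℕ} (ρ : Measure Y) (ν : Measure (Fin n → Y)) [SFinite ν]
    {A : Set (Fin (n + 1) → Y)} (hA : MeasurableSet A) :
    consLaw ρ ν A = ∫⁻ y, ν {z | Fin.cons y z ∈ A} ∂ρ := by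
  rw [consLaw, Measure.map_apply measurable_cons hA, Measure.prod_apply (measurable_cons hA)]
  rfl

theorem sum_smul_consLaw {ι : Type*} [Fintype ι] {n : ℕ} (ρ : Measure Y)
    (w : ι → ℝ≥0∞) (ν : ι → Measure (Fin n → Y)) [∀ i, IsProbabilityMeasure (ν i)]
    [SFinite (∑ i, w i • ν i)] :
    consLaw ρ (∑ i, w i • ν i) = ∑ i, w i • consLaw ρ (ν i) := by
  ext A hA
  have hm : ∀ i, Measurable fun y => ν i {z | (Fin.cons y z : Fin (n + 1) → Y) ∈ A} := fun i =>
    measurable_measure_prodMk_left (measurable_cons hA)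
  simp only [consLaw_apply _ _ hA, Measure.finsetSum_apply, Measure.smul_apply, smul_eq_mul]
  rw [lintegral_finsetSum _ fun i _ => (hm i).const_mul _]
  exact Finset.sum_congr rfl fun i _ => lintegral_const_mul _ (hm i)

theorem stateLaw_succ (F : Fin k → Measure Y) [∀ i, IsProbabilityMeasure (F i)] (Q : TransMat k)
    (n : ℕ) (i : Fin k) : stateLaw F Q (n + 1) i = consLaw (F i) (mixLaw F Q (Q.1 i) n) := by
  have := isProbabilityMeasure_mixLaw F Q (Q.2 i) n
  unfold mixLaw at this ⊢
  rw [sum_smul_consLaw]; rfl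

theorem pi_fin_zero (m : Fin 0 → Measure Y) :
    Measure.pi m = Measure.dirac fun t => t.elim0 := by
  rw [Measure.pi_of_empty m]
  congr 1

/-- Links the two descriptions of the model: the recursion on the first observation, used for
concentration, and the mixture over hidden paths of product laws, used for likelihoods. -/
theorem mixLaw_eq_sum_path (F : Fin k → Measure Y) [∀ i, IsProbabilityMeasure (F i)]
    (Q : TransMat k) {μ : Fin k → ℝ} (hμ : ∀ i, 0 ≤ μ i) (n : ℕ) :
    mixLaw F Q μ (n + 1) = ∑ x : Fin (n + 1) → Fin k,
      ENNReal.ofReal (pathProb μ Q (n + 1) x) • Measure.pi fun t => F (x t) := by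
  induction n generalizing μ with
  | zero =>
    rw [← (Fin.consEquiv fun _ => Fin k).sum_comp, Fintype.sum_prod_type]
    refine Finset.sum_congr rfl fun i _ => ?_
    rw [Fintype.sum_unique]
    have h0 : mixLaw F Q (Q.1 i) 0 = Measure.pi fun t : Fin 0 => F (t.elim0) := by
      rw [pi_fin_zero]
      simp only [mixLaw, stateLaw]
      rw [← Finset.sum_smul, Q.sum_ofReal, one_smul]
    rw [stateLaw_succ, h0, ← pi_cons]
    congr 1
    · simp [pathProb, Fin.consEquiv]
    · congr 1
      ext1 t
      fin_cases t
      rfl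
  | succ n ih =>
    rw [← (Fin.consEquiv fun _ => Fin k).sum_comp, Fintype.sum_prod_type]
    refine Finset.sum_congr rfl fun i _ => ?_
    have hp := isProbabilityMeasure_mixLaw F Q (Q.2 i) (n + 1)
    rw [stateLaw_succ]
    rw [ih (Q.nonneg i)] at hp ⊢
    rw [sum_smul_consLaw, Finset.smul_sum]
    refine Finset.sum_congr rfl fun x _ => ?_
    simp only [Fin.consEquiv, Equiv.coe_fn_mk]
    rw [pathProb_cons, ENNReal.ofReal_mul (hμ i), mul_smul, ← pi_cons]
    congr 3
    ext1 t
    refine Fin.cases ?_ (fun j => ?_) t <;> simp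

/-! ### Densities of the observation laws with respect to the product measure. -/

theorem withDensity_finset_sum {α ι : Type*} [MeasurableSpace α] (ν : Measure α) (s : Finset ι)
    {f : ι → α → ℝ≥0∞} (hf : ∀ i ∈ s, Measurable (f i)) :
    ν.withDensity (fun a => ∑ i ∈ s, f i a) = ∑ i ∈ s, ν.withDensity (f i) := by
  ext A hA
  simp only [Measure.finsetSum_apply, withDensity_apply _ hA]
  exact lintegral_finsetSum _ hf

theorem pi_withDensity (lam : Measure Y) [SigmaFinite lam] {n : ℕ} {f : Fin n → Y → ℝ≥0∞}
    (hf : ∀ t, Measurable (f t)) (hfin : ∀ t, ∫⁻ y, f t y ∂lam ≠ ∞) :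
    Measure.pi (fun t => lam.withDensity (f t)) =
      (Measure.pi fun _ => lam).withDensity fun y => ∏ t, f t (y t) := by
  have hfm : ∀ t, IsFiniteMeasure (lam.withDensity (f t)) := fun t =>
    isFiniteMeasure_withDensity (hfin t)
  induction n with
  | zero =>
    simp only [Finset.univ_eq_empty, Finset.prod_empty]
    rw [pi_fin_zero, pi_fin_zero]
    exact withDensity_one.symm
  | succ n ih =>
    have h1 : (fun t => lam.withDensity (f t)) =
        (Fin.cons (lam.withDensity (f 0)) fun j : Fin n => lam.withDensity (f j.succ) :
          Fin (n + 1) → Measure Y) := by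
      ext1 t; refine Fin.cases ?_ (fun j => ?_) t <;> simp
    have h2 : (fun _ => lam : Fin (n + 1) → Measure Y) = Fin.cons lam fun _ => lam := by
      ext1 t; refine Fin.cases ?_ (fun j => ?_) t <;> simp
    have hm : Measurable fun y : Fin n → Y => ∏ t, f t.succ (y t) :=
      Finset.measurable_fun_prod _ fun t _ => (hf _).comp (measurable_pi_apply t)
    have hm' : Measurable fun y : Fin (n + 1) → Y => ∏ t, f t (y t) :=
      Finset.measurable_fun_prod _ fun t _ => (hf _).comp (measurable_pi_apply t)
    rw [h1, pi_cons, ih (fun t => hf _) (fun t => hfin _) (fun t => hfm _), h2, pi_cons, consLaw,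
      prod_withDensity (hf 0) hm, consLaw]
    ext A hA
    rw [Measure.map_apply measurable_cons hA, withDensity_apply _ (measurable_cons hA),
      withDensity_apply _ hA, ← lintegral_indicator (measurable_cons hA),
      ← lintegral_indicator hA, lintegral_map (hm'.indicator hA) measurable_cons]
    refine lintegral_congr fun p => ?_
    simp only [Set.indicator, Fin.prod_univ_succ, Fin.cons_zero, Fin.cons_succ]
    rfl

theorem mixLaw_eq_withDensity (lam : Measure Y) [SigmaFinite lam] {f : Fin k → Y → ℝ}
    (hf : ∀ i, Measurable (f i))
    [∀ i, IsProbabilityMeasure (lam.withDensity fun y => ENNReal.ofReal (f i y))]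
    (Q : TransMat k) {μ : Fin k → ℝ} (hμ : ∀ i, 0 ≤ μ i) {n : ℕ} (hn : n ≠ 0) :
    mixLaw (fun i => lam.withDensity fun y => ENNReal.ofReal (f i y)) Q μ n =
      (Measure.pi fun _ => lam).withDensity (pathDensity μ Q f n) := by
  obtain ⟨n, rfl⟩ := Nat.exists_eq_succ_of_ne_zero hn
  have hfin : ∀ i, ∫⁻ y, ENNReal.ofReal (f i y) ∂lam ≠ ∞ := by
    intro i
    rw [← setLIntegral_univ, ← withDensity_apply _ MeasurableSet.univ]
    exact measure_ne_top _ _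
  unfold pathDensity
  have hm : ∀ x : Fin (n + 1) → Fin k, Measurable fun y : Fin (n + 1) → Y =>
      ∏ t, ENNReal.ofReal (f (x t) (y t)) := fun x =>
    Finset.measurable_fun_prod _ fun t _ =>
      ((hf (x t)).comp (measurable_pi_apply t)).ennreal_ofReal
  rw [mixLaw_eq_sum_path _ _ hμ, withDensity_finset_sum _ _ fun x _ => (hm x).const_mul _]
  refine Finset.sum_congr rfl fun x _ => ?_
  rw [pi_withDensity lam (fun t => (hf (x t)).ennreal_ofReal) fun t => hfin _]
  exact (withDensity_smul _ (hm x)).symm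

/-! ### Marginals -/

theorem map_mixLaw (F : Fin k → Measure Y) (Q : TransMat k) (μ : Fin k → ℝ) (n : ℕ) {α : Type*}
    [MeasurableSpace α] {φ : (Fin n → Y) → α} (hφ : Measurable φ) :
    (mixLaw F Q μ n).map φ = ∑ i, ENNReal.ofReal (μ i) • (stateLaw F Q n i).map φ := by
  ext A hA
  simp [mixLaw, Measure.map_apply hφ hA, Measure.finsetSum_apply]

/-- Discarding the first observation moves the initial vector one step, from `μ` to `μ Q`, which is
`μ` again by stationarity. -/
theorem map_tail_mixLaw (F : Fin k → Measure Y) [∀ i, IsProbabilityMeasure (F i)] {Q : TransMat k}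
    {μ : Fin k → ℝ} (hμ : IsStationary Q μ) (n : ℕ) :
    (mixLaw F Q μ (n + 1)).map Fin.tail = mixLaw F Q μ n := by
  have hm : Measurable (Fin.tail : (Fin (n + 1) → Y) → Fin n → Y) :=
    measurable_pi_iff.2 fun i => measurable_pi_apply _
  have h1 : ∀ i, (stateLaw F Q (n + 1) i).map Fin.tail = mixLaw F Q (Q.1 i) n := by
    intro i
    have := isProbabilityMeasure_mixLaw F Q (Q.2 i) n
    rw [stateLaw_succ, consLaw, Measure.map_map hm measurable_cons]
    change Measure.map Prod.snd _ = _
    rw [Measure.map_snd_prod]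
    simp
  rw [map_mixLaw _ _ _ _ hm]
  simp only [h1, mixLaw, Finset.smul_sum]
  rw [Finset.sum_comm]
  refine Finset.sum_congr rfl fun j _ => ?_
  simp only [smul_smul]
  rw [← Finset.sum_smul, ← hμ.2 j,
    ENNReal.ofReal_sum_of_nonneg fun i _ => mul_nonneg (hμ.1.1 i) (Q.nonneg i j)]
  congr 1
  exact Finset.sum_congr rfl fun i _ => (ENNReal.ofReal_mul (hμ.1.1 i)).symm

theorem map_castLE_stateLaw (F : Fin k → Measure Y) [∀ i, IsProbabilityMeasure (F i)]
    (Q : TransMat k) {m n : ℕ} (h : m ≤ n) (i : Fin k) :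
    (stateLaw F Q n i).map (fun y t => y (Fin.castLE h t)) = stateLaw F Q m i := by
  induction m generalizing n i with
  | zero =>
    have : (fun (y : Fin n → Y) (t : Fin 0) => y (Fin.castLE h t)) = fun _ => fun t => t.elim0 := by
      ext y t; exact t.elim0
    rw [this, Measure.map_const]
    simp [stateLaw]
  | succ m ih =>
    obtain ⟨n, rfl⟩ : ∃ n', n = n' + 1 := ⟨n - 1, by omega⟩
    have hmn : m ≤ n := by omega
    have hm : Measurable fun (y : Fin n → Y) (t : Fin m) => y (Fin.castLE hmn t) :=
      measurable_pi_iff.2 fun i => measurable_pi_apply _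
    have hm' : Measurable fun (y : Fin (n + 1) → Y) (t : Fin (m + 1)) => y (Fin.castLE h t) :=
      measurable_pi_iff.2 fun i => measurable_pi_apply _
    have hp := isProbabilityMeasure_mixLaw F Q (Q.2 i) n
    have h1 : (mixLaw F Q (Q.1 i) n).map (fun y t => y (Fin.castLE hmn t)) =
        mixLaw F Q (Q.1 i) m := by
      rw [map_mixLaw _ _ _ _ hm]
      simp only [ih hmn]
      rfl
    rw [stateLaw_succ, stateLaw_succ, consLaw, consLaw, ← h1, Measure.map_map hm' measurable_cons]
    have h2 : (F i).prod ((mixLaw F Q (Q.1 i) n).map fun y t => y (Fin.castLE hmn t)) =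
        ((F i).prod (mixLaw F Q (Q.1 i) n)).map
          (Prod.map id fun y t => y (Fin.castLE hmn t)) := by
      rw [← Measure.map_prod_map _ _ measurable_id hm, Measure.map_id]
    rw [h2, Measure.map_map measurable_cons (measurable_id.prodMap hm)]
    congr 1
    ext p t
    refine Fin.cases ?_ (fun j => ?_) t
    · rfl
    · rfl

/-- The `t`-th block of `l` consecutive observations. -/
def window {n l : ℕ} (t : ℕ) (h : t + l ≤ n) (y : Fin n → Y) : Fin l → Y :=
  fun s => y ⟨t + s, by omega⟩

theorem measurable_window {n l : ℕ} (t : ℕ) (h : t + l ≤ n) :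
    Measurable (window t h : (Fin n → Y) → Fin l → Y) :=
  measurable_pi_iff.2 fun _ => measurable_pi_apply _

theorem map_window_mixLaw (F : Fin k → Measure Y) [∀ i, IsProbabilityMeasure (F i)]
    {Q : TransMat k} {μ : Fin k → ℝ} (hμ : IsStationary Q μ) {n l t : ℕ} (h : t + l ≤ n) :
    (mixLaw F Q μ n).map (window t h) = mixLaw F Q μ l := by
  induction t generalizing n with
  | zero =>
    have h' : l ≤ n := by omega
    have : (window 0 h : (Fin n → Y) → Fin l → Y) = fun y t => y (Fin.castLE h' t) := by
      ext y t
      simp only [window]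
      congr 1
      ext
      simp
    rw [this, map_mixLaw _ _ _ _ (measurable_pi_iff.2 fun _ => measurable_pi_apply _)]
    simp only [map_castLE_stateLaw]
    rfl
  | succ t ih =>
    obtain ⟨n, rfl⟩ : ∃ n', n = n' + 1 := ⟨n - 1, by omega⟩
    have h' : t + l ≤ n := by omega
    have hm : Measurable (Fin.tail : (Fin (n + 1) → Y) → Fin n → Y) :=
      measurable_pi_iff.2 fun i => measurable_pi_apply _
    rw [← ih h', ← map_tail_mixLaw F hμ n, Measure.map_map (measurable_window _ _) hm]
    congr 1
    ext y s
    simp only [window, Function.comp_apply, Fin.tail, Fin.succ_mk]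
    congr 2
    omega

end StateLaw

/-! ### Concentration for functions with bounded differences -/

section Concentration

variable {k : ℕ} {Y : Type*}

/-- Doeblin's contraction: row `i` gives mass at least `q` to a minimiser of `V`, so its average
exceeds `min V` by at most `(1 - q) * o`, while the average over row `j` is at least `min V`. -/
theorem TransMat.sum_mul_le_of_bounded {Q : TransMat k} {q : ℝ} (hQ : Q ∈ TransMat.bounded k q)
    {V : Fin k → ℝ} {o : ℝ} (hV : ∀ z w, V z ≤ V w + o) (i j : Fin k) :
    ∑ z, Q.1 i z * V z ≤ ∑ z, Q.1 j z * V z + (1 - q) * o := by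
  have : Nonempty (Fin k) := ⟨i⟩
  obtain ⟨w, hw⟩ := Finite.exists_min V
  have ho : 0 ≤ o := by linarith [hV w w]
  have h1 : V w ≤ ∑ z, Q.1 j z * V z := by
    calc V w = ∑ z, Q.1 j z * V w := by rw [← Finset.sum_mul, Q.sum_eq_one, one_mul]
      _ ≤ _ := Finset.sum_le_sum fun z _ => mul_le_mul_of_nonneg_left (hw z) (Q.nonneg _ _)
  have h2 : ∀ z, Q.1 i z * V z ≤ Q.1 i z * (V w + o) - if z = w then q * o else 0 := by
    intro z
    split_ifs with h
    · subst h
      have := mul_le_mul_of_nonneg_right (hQ i z) ho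
      linarith
    · have := mul_le_mul_of_nonneg_left (hV z w) (Q.nonneg i z)
      linarith
  have h3 := Finset.sum_le_sum fun z (_ : z ∈ Finset.univ) => h2 z
  rw [Finset.sum_sub_distrib, ← Finset.sum_mul, Q.sum_eq_one] at h3
  simp only [Finset.sum_ite_eq', Finset.mem_univ, if_true] at h3
  linarith

/-- Changing one coordinate changes `G` by at most `c`. -/
def BoundedDiff {n : ℕ} (c : ℝ) (G : (Fin n → Y) → ℝ) : Prop :=
  ∀ y t a, |G (Function.update y t a) - G y| ≤ c

theorem BoundedDiff.cons {n : ℕ} {c : ℝ} {G : (Fin (n + 1) → Y) → ℝ} (h : BoundedDiff c G)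
    (a : Y) : BoundedDiff c fun y => G (Fin.cons a y) := by
  intro y t b
  simpa only [Fin.cons_update] using h (Fin.cons a y) t.succ b

theorem BoundedDiff.cons_le {n : ℕ} {c : ℝ} {G : (Fin (n + 1) → Y) → ℝ} (h : BoundedDiff c G)
    (a b : Y) (y : Fin n → Y) : G (Fin.cons a y) ≤ G (Fin.cons b y) + c := by
  have := (abs_le.1 (h (Fin.cons b y) 0 a)).2
  rw [Fin.update_cons_zero] at this
  linarith

/-- The sum of `h` over the blocks of `l` consecutive observations. -/
noncomputable def windowSum {l : ℕ} (h : (Fin l → Y) → ℝ) (n : ℕ) (y : Fin n → Y) : ℝ :=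
  ∑ t : Fin (n - l), h (window t (by omega) y)

theorem windowSum_neg {l : ℕ} (h : (Fin l → Y) → ℝ) (n : ℕ) (y : Fin n → Y) :
    windowSum (fun y => -h y) n y = -windowSum h n y := by
  simp [windowSum]

theorem abs_windowSum_le {l : ℕ} {h : (Fin l → Y) → ℝ} (hh : ∀ y, |h y| ≤ 1) (n : ℕ)
    (y : Fin n → Y) : |windowSum h n y| ≤ (n - l : ℕ) := by
  refine (Finset.abs_sum_le_sum_abs _ _).trans ((Finset.sum_le_sum fun t _ => hh _).trans ?_)
  simp

/-- A coordinate belongs to at most `l` blocks, and each of these terms moves by at most 2. -/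
theorem boundedDiff_windowSum {l : ℕ} {h : (Fin l → Y) → ℝ} (hh : ∀ y, |h y| ≤ 1) (n : ℕ) :
    BoundedDiff (2 * l) (windowSum h n) := by
  intro y s a
  rw [windowSum, windowSum, ← Finset.sum_sub_distrib]
  set T : Finset (Fin (n - l)) := {t | t.1 ≤ s.1 ∧ s.1 < t.1 + l} with hT
  have h1 : ∀ t : Fin (n - l), |h (window t.1 (by omega) (Function.update y s a)) -
      h (window t.1 (by omega) y)| ≤ if t ∈ T then 2 else 0 := by
    intro t
    split_ifs with ht
    · have h1 := abs_le.1 (hh (window t.1 (by omega) (Function.update y s a)))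
      have h2 := abs_le.1 (hh (window t.1 (by omega) y))
      exact abs_le.2 ⟨by linarith, by linarith⟩
    · have : window t.1 (by omega) (Function.update y s a) = (window t.1 (by omega) y : Fin l → Y) := by
        ext u
        refine Function.update_of_ne ?_ _ _
        rintro rfl
        exact ht (by simp [hT])
      rw [this]
      simp
  have hcard : T.card ≤ l := by
    calc T.card = (T.map Fin.valEmbedding).card := (Finset.card_map _).symm
      _ ≤ (Finset.Icc (s.1 + 1 - l) s.1).card := by
        refine Finset.card_le_card fun t ht => ?_
        simp only [Finset.mem_map, hT, Finset.mem_filter, Finset.mem_univ, true_and,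
          Fin.valEmbedding_apply] at ht
        obtain ⟨u, hu, rfl⟩ := ht
        rw [Finset.mem_Icc]
        omega
      _ ≤ l := by rw [Nat.card_Icc]; omega
  calc _ ≤ ∑ t : Fin (n - l), if t ∈ T then (2 : ℝ) else 0 :=
        (Finset.abs_sum_le_sum_abs _ _).trans (Finset.sum_le_sum fun t _ => h1 t)
    _ = T.card * 2 := by simp
    _ ≤ l * 2 := by gcongr
    _ = 2 * l := mul_comm _ _

variable [MeasurableSpace Y]

/-! ### Means, exponential moments and tails under the laws started from a state. -/

theorem measurable_cons_left {n : ℕ} (a : Y) :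
    Measurable fun y : Fin n → Y => (Fin.cons a y : Fin (n + 1) → Y) :=
  measurable_cons.comp (measurable_const.prodMk measurable_id)

theorem integrable_of_abs_le {α : Type*} [MeasurableSpace α] {ν : Measure α} [IsFiniteMeasure ν]
    {G : α → ℝ} (hG : Measurable G) {B : ℝ} (hB : ∀ y, |G y| ≤ B) : Integrable G ν :=
  Integrable.of_bound hG.aestronglyMeasurable B (ae_of_all _ hB)

theorem abs_integral_le_of_abs_le {α : Type*} [MeasurableSpace α] {ν : Measure α}
    [IsProbabilityMeasure ν] {G : α → ℝ} {B : ℝ} (hB : ∀ y, |G y| ≤ B) : |∫ y, G y ∂ν| ≤ B := by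
  simpa using norm_integral_le_of_norm_le_const (μ := ν) (f := G) (ae_of_all _ hB)

theorem integral_stateLaw_succ (F : Fin k → Measure Y) [∀ i, IsProbabilityMeasure (F i)]
    (Q : TransMat k) (n : ℕ) (i : Fin k) {G : (Fin (n + 1) → Y) → ℝ} (hG : Measurable G) {B : ℝ}
    (hB : ∀ y, |G y| ≤ B) :
    ∫ y, G y ∂(stateLaw F Q (n + 1) i) =
      ∑ z, Q.1 i z * ∫ a, ∫ y, G (Fin.cons a y) ∂(stateLaw F Q n z) ∂(F i) := by
  have hI : ∀ z, Integrable G (consLaw (F i) (stateLaw F Q n z)) := fun z =>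
    integrable_of_abs_le hG hB
  rw [stateLaw, integral_finsetSum_measure fun z _ => (hI z).smul_measure ENNReal.ofReal_ne_top]
  refine Finset.sum_congr rfl fun z _ => ?_
  rw [integral_smul_measure, ENNReal.toReal_ofReal (Q.nonneg _ _), smul_eq_mul, consLaw,
    integral_map measurable_cons.aemeasurable hG.aestronglyMeasurable, integral_prod]
  exact integrable_of_abs_le (hG.comp measurable_cons) fun _ => hB _

theorem measurable_integral_cons (F : Fin k → Measure Y) [∀ i, IsProbabilityMeasure (F i)]
    (Q : TransMat k) (n : ℕ) (z : Fin k) {G : (Fin (n + 1) → Y) → ℝ} (hG : Measurable G) :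
    Measurable fun a => ∫ y, G (Fin.cons a y) ∂(stateLaw F Q n z) :=
  ((hG.comp measurable_cons).stronglyMeasurable.integral_prod_right'
    (ν := stateLaw F Q n z)).measurable

theorem integral_cons_le (F : Fin k → Measure Y) [∀ i, IsProbabilityMeasure (F i)]
    (Q : TransMat k) (n : ℕ) (z : Fin k) {G : (Fin (n + 1) → Y) → ℝ} (hG : Measurable G) {B : ℝ}
    (hB : ∀ y, |G y| ≤ B) {c : ℝ} (hc : BoundedDiff c G) (a b : Y) :
    ∫ y, G (Fin.cons a y) ∂(stateLaw F Q n z) ≤ ∫ y, G (Fin.cons b y) ∂(stateLaw F Q n z) + c := by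
  have hI : ∀ a, Integrable (fun y => G (Fin.cons a y)) (stateLaw F Q n z) := fun a =>
    integrable_of_abs_le (hG.comp (measurable_cons_left a)) fun _ => hB _
  calc _ ≤ ∫ y, (G (Fin.cons b y) + c) ∂(stateLaw F Q n z) :=
        integral_mono (hI a) ((hI b).add (integrable_const c)) fun y => hc.cons_le a b y
    _ = _ := by rw [integral_add (hI b) (integrable_const c)]; simp

/-- The hidden starting state is forgotten. Freezing the first observation costs `c` on each side,
and passing to the next state contracts the remaining discrepancy by `1 - q`; the bound `2 * c / q`
is the fixed point of `x ↦ (1 - q) * x + 2 * c`. -/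
theorem integral_stateLaw_le {F : Fin k → Measure Y} [∀ i, IsProbabilityMeasure (F i)]
    {Q : TransMat k} {q : ℝ} (hq : 0 < q) (hQ : Q ∈ TransMat.bounded k q) {n : ℕ}
    {G : (Fin n → Y) → ℝ} (hG : Measurable G) {B : ℝ} (hB : ∀ y, |G y| ≤ B) {c : ℝ} (h0 : 0 ≤ c)
    (hc : BoundedDiff c G) (i j : Fin k) :
    ∫ y, G y ∂(stateLaw F Q n i) ≤ ∫ y, G y ∂(stateLaw F Q n j) + 2 * c / q := by
  induction n generalizing i j with
  | zero =>
    have : 0 ≤ 2 * c / q := by positivity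
    simp only [stateLaw]
    linarith
  | succ n ih =>
    obtain ⟨b⟩ : Nonempty Y := nonempty_of_isProbabilityMeasure (F i)
    set V : Fin k → ℝ := fun z => ∫ y, G (Fin.cons b y) ∂(stateLaw F Q n z) with hVdef
    have hV : ∀ z w, V z ≤ V w + 2 * c / q := fun z w =>
      ih (hG.comp (measurable_cons_left b)) (fun _ => hB _) (hc.cons b) z w
    have hI : ∀ i z, Integrable (fun a => ∫ y, G (Fin.cons a y) ∂(stateLaw F Q n z)) (F i) :=
      fun i z => integrable_of_abs_le (measurable_integral_cons F Q n z hG) fun a =>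
        abs_integral_le_of_abs_le fun _ => hB _
    have hup : ∀ i z, ∫ a, ∫ y, G (Fin.cons a y) ∂(stateLaw F Q n z) ∂(F i) ≤ V z + c := by
      intro i z
      calc _ ≤ ∫ _, (V z + c) ∂(F i) :=
            integral_mono (hI i z) (integrable_const _) fun a =>
              integral_cons_le F Q n z hG hB hc a b
        _ = _ := by simp
    have hlo : ∀ i z, V z - c ≤ ∫ a, ∫ y, G (Fin.cons a y) ∂(stateLaw F Q n z) ∂(F i) := by
      intro i z
      calc V z - c = ∫ _, (V z - c) ∂(F i) := by simp
        _ ≤ _ := integral_mono (integrable_const _) (hI i z) fun a => by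
              have := integral_cons_le F Q n z hG hB hc b a
              simp only [hVdef]
              linarith
    rw [integral_stateLaw_succ F Q n i hG hB, integral_stateLaw_succ F Q n j hG hB]
    have h1 : ∑ z, Q.1 i z * ∫ a, ∫ y, G (Fin.cons a y) ∂(stateLaw F Q n z) ∂(F i)
        ≤ ∑ z, Q.1 i z * V z + c := by
      calc _ ≤ ∑ z, Q.1 i z * (V z + c) := Finset.sum_le_sum fun z _ =>
            mul_le_mul_of_nonneg_left (hup i z) (Q.nonneg _ _)
        _ = _ := by
          simp only [mul_add, Finset.sum_add_distrib]
          rw [← Finset.sum_mul, Q.sum_eq_one, one_mul]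
    have h2 : ∑ z, Q.1 j z * V z - c
        ≤ ∑ z, Q.1 j z * ∫ a, ∫ y, G (Fin.cons a y) ∂(stateLaw F Q n z) ∂(F j) := by
      calc _ = ∑ z, Q.1 j z * (V z - c) := by
            simp only [mul_sub, Finset.sum_sub_distrib]
            rw [← Finset.sum_mul, Q.sum_eq_one, one_mul]
        _ ≤ _ := Finset.sum_le_sum fun z _ =>
            mul_le_mul_of_nonneg_left (hlo j z) (Q.nonneg _ _)
    have h3 := TransMat.sum_mul_le_of_bounded hQ hV i j
    have h4 : (1 - q) * (2 * c / q) = 2 * c / q - 2 * c := by field_simp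
    linarith

/-- A martingale argument written as a recursion. Conditionally on the first observation and the
next hidden state, the induction hypothesis bounds the exponential moment through the conditional
mean `W`; Hoeffding's lemma then handles the fluctuation of `W`. -/
theorem integral_exp_stateLaw_le {F : Fin k → Measure Y} [∀ i, IsProbabilityMeasure (F i)]
    {Q : TransMat k} {q : ℝ} (hq : 0 < q) (hq1 : q ≤ 1) (hQ : Q ∈ TransMat.bounded k q) {n : ℕ}
    {G : (Fin n → Y) → ℝ} (hG : Measurable G) {B : ℝ} (hB : ∀ y, |G y| ≤ B) {c : ℝ} (h0 : 0 ≤ c)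
    (hc : BoundedDiff c G) (i : Fin k) :
    ∫ y, Real.exp (G y) ∂(stateLaw F Q n i)
      ≤ Real.exp (∫ y, G y ∂(stateLaw F Q n i) + 2 * n * (c / q) ^ 2) := by
  induction n generalizing i with
  | zero =>
    simp only [stateLaw]
    rw [integral_dirac' _ _ hG.exp.stronglyMeasurable,
      integral_dirac' _ _ hG.stronglyMeasurable]
    simp
  | succ n ih =>
    obtain ⟨b⟩ : Nonempty Y := nonempty_of_isProbabilityMeasure (F i)
    have : Nonempty (Fin k) := ⟨i⟩
    set W : Y × Fin k → ℝ := fun p => ∫ y, G (Fin.cons p.1 y) ∂(stateLaw F Q n p.2) with hWdef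
    set D : Measure (Fin k) := ∑ z, ENNReal.ofReal (Q.1 i z) • Measure.dirac z with hD
    have hDp : IsProbabilityMeasure D := isProbabilityMeasure_sum_smul _ (Q.sum_ofReal i) _
    set ρ := (F i).prod D with hρ
    have hWm : Measurable W := measurable_from_prod_countable_left fun z =>
      measurable_integral_cons F Q n z hG
    have hWB : ∀ p, |W p| ≤ B := fun p => abs_integral_le_of_abs_le fun _ => hB _
    have hint : ∀ φ : Y × Fin k → ℝ, Measurable φ → ∀ R : ℝ, (∀ p, |φ p| ≤ R) →
        ∫ p, φ p ∂ρ = ∑ z, Q.1 i z * ∫ a, φ (a, z) ∂(F i) := by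
      intro φ hφ R hR
      have hz : ∀ z, Integrable (fun a => φ (a, z)) (F i) := fun z =>
        integrable_of_abs_le (hφ.comp (measurable_id.prodMk measurable_const)) fun _ => hR _
      rw [hρ, integral_prod _ (integrable_of_abs_le hφ hR)]
      have h1 : ∀ a, ∫ z, φ (a, z) ∂D = ∑ z, Q.1 i z * φ (a, z) := by
        intro a
        rw [hD, integral_finsetSum_measure fun z _ =>
          (Integrable.of_finite).smul_measure ENNReal.ofReal_ne_top]
        refine Finset.sum_congr rfl fun z _ => ?_
        rw [integral_smul_measure, integral_dirac, ENNReal.toReal_ofReal (Q.nonneg _ _),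
          smul_eq_mul]
      simp_rw [h1]
      rw [integral_finsetSum _ fun z _ => (hz z).const_mul _]
      exact Finset.sum_congr rfl fun z _ => integral_const_mul _ _
    obtain ⟨w, hw⟩ := Finite.exists_min fun z => W (b, z)
    -- Replacing the observation by `b` costs `c` in either direction, and changing the state costs
    -- at most `2 * c / q`; since `q ≤ 1`, the total width `2 * c + 2 * c / q` is at most `4 * c /
    -- q`.
    have hrange : ∀ p, W p ∈ Set.Icc (W (b, w) - c) (W (b, w) - c + 4 * c / q) := by
      rintro ⟨a, z⟩
      have h1 := integral_cons_le F Q n z hG hB hc a b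
      have h2 := integral_cons_le F Q n z hG hB hc b a
      have h3 := integral_stateLaw_le (F := F) hq hQ (hG.comp (measurable_cons_left b))
        (fun _ => hB _) h0 (hc.cons b) z w
      have h4 := hw z
      have h5 : 2 * c ≤ 2 * c / q := by
        rw [le_div_iff₀ hq]; nlinarith
      have h6 : 4 * c / q = 2 * c / q + 2 * c / q := by ring
      simp only [Function.comp_apply] at h3
      simp only [hWdef, Set.mem_Icc] at h4 ⊢
      constructor <;> linarith
    -- The variance proxy is the square of half the width, `(2 * c / q) ^ 2`; half of it is the
    -- increment `2 * (c / q) ^ 2`.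
    have hsub := ProbabilityTheory.hasSubgaussianMGF_of_mem_Icc (μ := ρ) hWm.aemeasurable
      (ae_of_all _ hrange)
    have hmgf := hsub.mgf_le 1
    have hmean : ∫ p, W p ∂ρ = ∫ y, G y ∂(stateLaw F Q (n + 1) i) := by
      rw [hint W hWm B hWB, integral_stateLaw_succ F Q n i hG hB]
    have hexpB : ∀ p, |Real.exp (W p)| ≤ Real.exp B := fun p => by
      rw [abs_of_pos (Real.exp_pos _)]
      exact Real.exp_le_exp.2 (abs_le.1 (hWB p)).2
    have hstep : ∫ p, Real.exp (W p) ∂ρ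
        ≤ Real.exp (∫ y, G y ∂(stateLaw F Q (n + 1) i) + 2 * (c / q) ^ 2) := by
      have h1 : ∫ p, Real.exp (W p) ∂ρ = Real.exp (∫ p, W p ∂ρ) *
          ProbabilityTheory.mgf (fun ω => W ω - ∫ p, W p ∂ρ) ρ 1 := by
        rw [ProbabilityTheory.mgf, ← integral_const_mul]
        refine integral_congr_ae (ae_of_all _ fun p => ?_)
        simp only [one_mul]
        rw [← Real.exp_add]
        congr 1
        ring
      rw [h1, hmean, Real.exp_add]
      refine mul_le_mul_of_nonneg_left ?_ (Real.exp_pos _).le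
      rw [hmean] at hmgf
      refine hmgf.trans (le_of_eq ?_)
      congr 1
      push_cast
      rw [add_sub_cancel_left, Real.norm_eq_abs, div_pow, sq_abs]
      field_simp
      ring
    have hexpG : Measurable fun y => Real.exp (G y) := hG.exp
    have hexpGB : ∀ y, |Real.exp (G y)| ≤ Real.exp B := fun y => by
      rw [abs_of_pos (Real.exp_pos _)]
      exact Real.exp_le_exp.2 (abs_le.1 (hB y)).2
    rw [integral_stateLaw_succ F Q n i hexpG hexpGB]
    calc _ ≤ ∑ z, Q.1 i z * ∫ a, Real.exp (W (a, z)) * Real.exp (2 * n * (c / q) ^ 2) ∂(F i) := by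
          refine Finset.sum_le_sum fun z _ => mul_le_mul_of_nonneg_left ?_ (Q.nonneg _ _)
          refine integral_mono ?_ ?_ fun a => ?_
          · exact integrable_of_abs_le (measurable_integral_cons F Q n z hexpG) fun a =>
              abs_integral_le_of_abs_le fun _ => hexpGB _
          · exact (integrable_of_abs_le ((Real.measurable_exp.comp hWm).comp
              (measurable_id.prodMk measurable_const)) fun _ => hexpB _).mul_const _
          · simp only
            rw [← Real.exp_add]
            exact ih (hG.comp (measurable_cons_left a)) (fun _ => hB _) (hc.cons a) z
      _ = (∫ p, Real.exp (W p) ∂ρ) * Real.exp (2 * n * (c / q) ^ 2) := by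
          rw [hint _ hWm.exp _ hexpB, Finset.sum_mul]
          refine Finset.sum_congr rfl fun z _ => ?_
          rw [integral_mul_const, ← mul_assoc]
      _ ≤ _ := by
          refine (mul_le_mul_of_nonneg_right hstep (Real.exp_pos _).le).trans (le_of_eq ?_)
          rw [← Real.exp_add]
          congr 1
          push_cast
          ring

theorem integral_mixLaw (F : Fin k → Measure Y) [∀ i, IsProbabilityMeasure (F i)] (Q : TransMat k)
    {μ : Fin k → ℝ} (hμ : ∀ i, 0 ≤ μ i) {n : ℕ} {G : (Fin n → Y) → ℝ}
    (hG : Measurable G) {B : ℝ} (hB : ∀ y, |G y| ≤ B) :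
    ∫ y, G y ∂(mixLaw F Q μ n) = ∑ i, μ i * ∫ y, G y ∂(stateLaw F Q n i) := by
  rw [mixLaw, integral_finsetSum_measure fun z _ =>
    (integrable_of_abs_le hG hB).smul_measure ENNReal.ofReal_ne_top]
  refine Finset.sum_congr rfl fun z _ => ?_
  rw [integral_smul_measure, ENNReal.toReal_ofReal (hμ z), smul_eq_mul]

theorem measurable_windowSum {l : ℕ} {h : (Fin l → Y) → ℝ} (hh : Measurable h) (n : ℕ) :
    Measurable (windowSum h n) :=
  Finset.measurable_fun_sum _ fun _ _ => hh.comp (measurable_window _ _)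

theorem integral_windowSum_mixLaw (F : Fin k → Measure Y) [∀ i, IsProbabilityMeasure (F i)]
    {Q : TransMat k} {μ : Fin k → ℝ} (hμ : IsStationary Q μ) {l : ℕ} {h : (Fin l → Y) → ℝ}
    (hm : Measurable h) (hh : ∀ y, |h y| ≤ 1) (n : ℕ) :
    ∫ y, windowSum h n y ∂(mixLaw F Q μ n) = (n - l : ℕ) * ∫ y, h y ∂(mixLaw F Q μ l) := by
  have := isProbabilityMeasure_mixLaw F Q hμ.1 n
  unfold windowSum
  have hI : ∀ t : Fin (n - l), Integrable (fun y => h (window t.1 (by omega) y))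
      (mixLaw F Q μ n) := fun t =>
    integrable_of_abs_le (hm.comp (measurable_window _ _)) fun _ => hh _
  rw [integral_finsetSum _ fun t _ => hI t]
  have h1 : ∀ t : Fin (n - l), ∫ y, h (window t.1 (by omega) y) ∂(mixLaw F Q μ n) =
      ∫ y, h y ∂(mixLaw F Q μ l) := by
    intro t
    rw [← map_window_mixLaw F hμ (show t.1 + l ≤ n by omega),
      integral_map (measurable_window _ _).aemeasurable hm.aestronglyMeasurable]
  simp [h1]

/-- Chernoff's bound at tilt `r`, applied to a function with differences at most `2 * l * r`. The
term `4 * l * r / q` is the price of starting from a fixed state, while the centring is at the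
stationary mean. -/
theorem stateLaw_windowSum_ge_le {F : Fin k → Measure Y} [∀ i, IsProbabilityMeasure (F i)]
    {Q : TransMat k} {q : ℝ} (hq : 0 < q) (hq1 : q ≤ 1) (hQ : Q ∈ TransMat.bounded k q)
    {μ : Fin k → ℝ} (hμ : IsStationary Q μ) {l : ℕ} {h : (Fin l → Y) → ℝ}
    (hm : Measurable h) (hh : ∀ y, |h y| ≤ 1) (n : ℕ) (i : Fin k) {r : ℝ} (hr : 0 ≤ r) (s : ℝ) :
    (stateLaw F Q n i).real
        {y | (n - l : ℕ) * (∫ y, h y ∂(mixLaw F Q μ l) + s) ≤ windowSum h n y}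
      ≤ Real.exp (-r * ((n - l : ℕ) * s) + 4 * l * r / q + 8 * n * (l * r / q) ^ 2) := by
  set m := ∫ y, h y ∂(mixLaw F Q μ l) with hmdef
  set N : ℝ := ((n - l : ℕ) : ℝ) with hN
  set G : (Fin n → Y) → ℝ := fun y => r * windowSum h n y with hG
  have hGm : Measurable G := (measurable_windowSum hm n).const_mul r
  have hGB : ∀ y, |G y| ≤ r * N := fun y => by
    rw [hG, abs_mul, abs_of_nonneg hr]
    exact mul_le_mul_of_nonneg_left (abs_windowSum_le hh n y) hr
  have hGd : BoundedDiff (2 * l * r) G := fun y t a => by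
    simp only [hG]
    rw [← mul_sub, abs_mul, abs_of_nonneg hr, mul_comm]
    exact mul_le_mul_of_nonneg_right (boundedDiff_windowSum hh n y t a) hr
  have h0 : 0 ≤ 2 * l * r := by positivity
  have hmean : ∫ y, G y ∂(stateLaw F Q n i) ≤ r * (N * m) + 2 * (2 * l * r) / q := by
    have h1 : ∑ j, μ j * ∫ y, G y ∂(stateLaw F Q n j) = r * (N * m) := by
      rw [← integral_mixLaw F Q hμ.1.1 hGm hGB, hG, integral_const_mul,
        integral_windowSum_mixLaw F hμ hm hh]
    rw [← h1]
    calc ∫ y, G y ∂(stateLaw F Q n i) = ∑ j, μ j * ∫ y, G y ∂(stateLaw F Q n i) := by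
          rw [← Finset.sum_mul, hμ.1.2, one_mul]
      _ ≤ ∑ j, μ j * (∫ y, G y ∂(stateLaw F Q n j) + 2 * (2 * l * r) / q) :=
          Finset.sum_le_sum fun j _ => mul_le_mul_of_nonneg_left
            (integral_stateLaw_le hq hQ hGm hGB h0 hGd i j) (hμ.1.1 j)
      _ = _ := by
          simp only [mul_add, Finset.sum_add_distrib]
          rw [← Finset.sum_mul, hμ.1.2, one_mul]
  have hexp := integral_exp_stateLaw_le (F := F) hq hq1 hQ hGm hGB h0 hGd i
  have hch := ProbabilityTheory.measure_ge_le_exp_mul_mgf (μ := stateLaw F Q n i)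
    (X := windowSum h n) (N * (m + s)) hr (integrable_of_abs_le hGm.exp (B := Real.exp (r * N))
      fun y => by
        rw [abs_of_pos (Real.exp_pos _)]
        exact Real.exp_le_exp.2 (abs_le.1 (hGB y)).2)
  refine hch.trans ?_
  calc _ ≤ Real.exp (-r * (N * (m + s))) *
        Real.exp (r * (N * m) + 2 * (2 * l * r) / q + 2 * n * (2 * l * r / q) ^ 2) := by
        refine mul_le_mul_of_nonneg_left (hexp.trans (Real.exp_le_exp.2 ?_)) (Real.exp_pos _).le
        linarith
    _ = _ := by
        rw [← Real.exp_add]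
        congr 1
        ring

end Concentration

/-! ### Finitely many test functions for a finite-dimensional space of integrable functions -/

section TestFunctions

/-- A 1-separated subset of the sphere of radius 2 has at most `5 ^ finrank` points; one of largest
cardinality cannot be enlarged and is therefore a net. -/
theorem exists_finset_net (E : Type*) [NormedAddCommGroup E] [NormedSpace ℝ E]
    [FiniteDimensional ℝ E] :
    ∃ s : Finset E, s.card ≤ 5 ^ Module.finrank ℝ E ∧ (∀ c ∈ s, ‖c‖ = 2) ∧
      ∀ v, ‖v‖ = 2 → ∃ c ∈ s, ‖v - c‖ < 1 := by
  classical
  set S : Finset E → Prop := fun s => (∀ c ∈ s, ‖c‖ = 2) ∧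
    ∀ c ∈ s, ∀ d ∈ s, c ≠ d → 1 ≤ ‖c - d‖ with hS
  have hcard : ∀ s, S s → s.card ≤ 5 ^ Module.finrank ℝ E := fun s hs =>
    Besicovitch.card_le_of_separated s (fun c hc => (hs.1 c hc).le) hs.2
  set P : ℕ → Prop := fun m => ∃ s, S s ∧ s.card = m with hP
  have hP0 : P 0 := ⟨∅, ⟨by simp, by simp⟩, rfl⟩
  obtain ⟨s, hs, hsc⟩ := Nat.findGreatest_spec (P := P) (n := 5 ^ Module.finrank ℝ E)
    (Nat.zero_le _) hP0
  refine ⟨s, hcard s hs, hs.1, fun v hv => ?_⟩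
  by_contra! hne
  have hvs : v ∉ s := fun h => by
    have := hne v h
    simp at this
    linarith
  have hins : S (insert v s) := by
    refine ⟨fun c hc => ?_, fun c hc d hd hcd => ?_⟩
    · rcases Finset.mem_insert.1 hc with rfl | hc
      · exact hv
      · exact hs.1 c hc
    · rcases Finset.mem_insert.1 hc with h1 | h1 <;> rcases Finset.mem_insert.1 hd with h2 | h2
      · exact absurd (h1.trans h2.symm) hcd
      · rw [h1]; exact hne d h2
      · rw [h2, norm_sub_rev]; exact hne c h1
      · exact hs.2 c h1 d h2 hcd
  have h1 : P (s.card + 1) := ⟨insert v s, hins, Finset.card_insert_of_notMem hvs⟩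
  have h2 := Nat.le_findGreatest (P := P)
    ((Finset.card_insert_of_notMem hvs).symm.le.trans (hcard _ hins)) h1
  omega

/-- The tests are the signs of the points `c` of a net of the sphere of radius 2 in the span of the
`g i`. For `v` of norm 2 within distance 1 of `c`, `∫ sign c * v ≥ ‖c‖ - ‖v - c‖ ≥ 1`, half the norm
of `v`; the general case follows by scaling. -/
theorem exists_testFunctions {α ι : Type*} [MeasurableSpace α] [Fintype ι] (ν : Measure α)
    {g : ι → α → ℝ} (hg : ∀ i, Integrable (g i) ν) :
    ∃ H : Finset (α → ℝ), H.card ≤ 5 ^ Fintype.card ι ∧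
      (∀ h ∈ H, Measurable h ∧ ∀ a, |h a| ≤ 1) ∧
      ∀ w : ι → ℝ, 0 < ∫ a, |∑ i, w i * g i a| ∂ν →
        ∃ h ∈ H, (∫ a, |∑ i, w i * g i a| ∂ν) / 2 ≤ ∫ a, h a * ∑ i, w i * g i a ∂ν := by
  classical
  set G : ι → Lp ℝ 1 ν := fun i => (hg i).toL1 (g i) with hG
  set V := Submodule.span ℝ (Set.range G) with hV
  have : FiniteDimensional ℝ V := FiniteDimensional.span_of_finite ℝ (Set.finite_range G)
  obtain ⟨s, hs, hs2, hnet⟩ := exists_finset_net V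
  have hsgn : Measurable (SignType.cast ∘ SignType.sign : ℝ → ℝ) := by
    have : (SignType.cast ∘ SignType.sign : ℝ → ℝ) =
        fun x => if 0 < x then 1 else if x < 0 then -1 else 0 := by
      ext x
      simp only [Function.comp_apply, sign_apply]
      split_ifs <;> simp
    rw [this]
    exact Measurable.ite measurableSet_Ioi measurable_const
      (Measurable.ite measurableSet_Iio measurable_const measurable_const)
  set φ : V → α → ℝ := fun c a => (SignType.sign ((c : Lp ℝ 1 ν) a) : ℝ) with hφ
  have hφm : ∀ c, Measurable (φ c) := fun c =>
    hsgn.comp (Lp.stronglyMeasurable (c : Lp ℝ 1 ν)).measurable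
  have hφ1 : ∀ c a, |φ c a| ≤ 1 := fun c a => by
    simp only [hφ, sign_apply]
    split_ifs <;> simp
  refine ⟨s.image φ, ?_, ?_, ?_⟩
  · calc _ ≤ s.card := Finset.card_image_le
      _ ≤ 5 ^ Module.finrank ℝ V := hs
      _ ≤ _ := Nat.pow_le_pow_right (by norm_num) (finrank_range_le_card G)
  · intro h hh
    obtain ⟨c, _, rfl⟩ := Finset.mem_image.1 hh
    exact ⟨hφm c, hφ1 c⟩
  · intro w hw
    have hI : Integrable (fun a => ∑ i, w i * g i a) ν :=
      integrable_finsetSum _ fun i _ => (hg i).const_mul _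
    set v : Lp ℝ 1 ν := ∑ i, w i • G i with hv
    have hvV : v ∈ V := Submodule.sum_mem _ fun i _ =>
      Submodule.smul_mem _ _ (Submodule.subset_span ⟨i, rfl⟩)
    have hvae : (v : α → ℝ) =ᵐ[ν] fun a => ∑ i, w i * g i a := by
      have h1 : v = hI.toL1 _ := by
        rw [hv]
        apply Lp.ext
        refine (Lp.coeFn_finsetSum _ _).trans ?_
        have h2 : ∀ᵐ a ∂ν, ∀ i, (w i • G i : Lp ℝ 1 ν) a = w i * g i a := by
          refine ae_all_iff.2 fun i => ?_
          filter_upwards [Lp.coeFn_smul (w i) (G i), (hg i).coeFn_toL1] with a h3 h4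
          rw [h3, Pi.smul_apply, smul_eq_mul, h4]
        filter_upwards [h2, hI.coeFn_toL1] with a h3 h4
        rw [h4, Finset.sum_apply]
        exact Finset.sum_congr rfl fun i _ => h3 i
      rw [h1]
      exact hI.coeFn_toL1
    set T := ∫ a, |∑ i, w i * g i a| ∂ν with hT
    have hnorm : ‖v‖ = T := by
      rw [L1.norm_eq_integral_norm]
      exact integral_congr_ae (hvae.mono fun a ha => by simp only [Real.norm_eq_abs, ha])
    set v' : V := (2 / T) • ⟨v, hvV⟩ with hv'
    obtain ⟨c, hc, hcv⟩ := hnet v' (by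
      rw [hv', norm_smul, Submodule.coe_norm]
      simp only [hnorm, Real.norm_eq_abs, abs_of_pos (div_pos two_pos hw)]
      field_simp)
    refine ⟨φ c, Finset.mem_image_of_mem _ hc, ?_⟩
    have hcI := L1.integrable_coeFn (c : Lp ℝ 1 ν)
    have hvI := L1.integrable_coeFn (v' : Lp ℝ 1 ν)
    have hmul : ∀ {u : α → ℝ}, Integrable u ν → Integrable (fun a => φ c a * u a) ν := fun hu =>
      hu.bdd_mul (c := 1) (hφm c).aestronglyMeasurable (ae_of_all _ fun a => hφ1 c a)
    have h1 : ∫ a, φ c a * (c : Lp ℝ 1 ν) a ∂ν = 2 := by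
      rw [← hs2 c hc, Submodule.coe_norm, L1.norm_eq_integral_norm]
      refine integral_congr_ae (ae_of_all _ fun a => ?_)
      simp only [hφ, Real.norm_eq_abs]
      exact sign_mul_self _
    have h2 : ∫ a, φ c a * (c : Lp ℝ 1 ν) a ∂ν - ∫ a, φ c a * (v' : Lp ℝ 1 ν) a ∂ν ≤ 1 := by
      rw [← integral_sub (hmul hcI) (hmul hvI)]
      refine le_trans ?_ hcv.le
      rw [Submodule.coe_norm, L1.norm_eq_integral_norm]
      refine integral_mono_ae ((hmul hcI).sub (hmul hvI)) (L1.integrable_coeFn _).norm ?_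
      filter_upwards [Lp.coeFn_sub (v' : Lp ℝ 1 ν) (c : Lp ℝ 1 ν)] with a ha
      rw [Submodule.coe_sub, ha, Pi.sub_apply, Real.norm_eq_abs, ← mul_sub, abs_sub_comm]
      refine (le_abs_self _).trans ?_
      rw [abs_mul]
      exact mul_le_of_le_one_left (abs_nonneg _) (hφ1 c a)
    have h3 : ∫ a, φ c a * (v' : Lp ℝ 1 ν) a ∂ν = 2 / T * ∫ a, φ c a * ∑ i, w i * g i a ∂ν := by
      rw [← integral_const_mul]
      refine integral_congr_ae ?_
      filter_upwards [hvae, Lp.coeFn_smul (2 / T) v] with a ha hb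
      have : (v' : Lp ℝ 1 ν) = (2 / T) • v := rfl
      rw [this, hb, Pi.smul_apply, smul_eq_mul, ha]
      ring
    have h4 : 1 ≤ 2 / T * ∫ a, φ c a * ∑ i, w i * g i a ∂ν := by linarith
    rw [div_mul_eq_mul_div, one_le_div hw] at h4
    linarith

end TestFunctions

/-! ### `L¹` comparison of the densities of the observations -/

section Comparison

variable {k : ℕ} {Y : Type*} [MeasurableSpace Y] {lam : Measure Y}

theorem Density.measurable (f : Density lam) : Measurable (f : Y → ℝ) :=
  (Lp.stronglyMeasurable f.1).measurable

theorem Density.integrable (f : Density lam) : Integrable (f : Y → ℝ) lam :=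
  L1.integrable_coeFn f.1

theorem Density.ae_nonneg (f : Density lam) : ∀ᵐ y ∂lam, 0 ≤ f y :=
  (Lp.coeFn_nonneg f.1).2 f.2.1

theorem Density.lintegral_ofReal (f : Density lam) : ∫⁻ y, ENNReal.ofReal (f y) ∂lam = 1 := by
  rw [← ofReal_integral_eq_lintegral_ofReal f.integrable f.ae_nonneg, f.2.2, ENNReal.ofReal_one]

theorem Density.lintegral_enorm (f : Density lam) : ∫⁻ y, ‖f y‖ₑ ∂lam = 1 := by
  exact (lintegral_congr_ae (f.ae_nonneg.mono fun y hy => Real.enorm_of_nonneg hy)).trans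
    f.lintegral_ofReal

theorem Density.lintegral_enorm_sub (f g : Density lam) :
    ∫⁻ y, ‖f y - g y‖ₑ ∂lam = ENNReal.ofReal (dist f g) := by
  have h : dist f g = ‖f.1 - g.1‖ := dist_eq_norm f.1 g.1
  rw [h, L1.norm_def, ENNReal.ofReal_toReal]
  · exact lintegral_congr_ae ((Lp.coeFn_sub f.1 g.1).mono fun y hy =>
      (congrArg enorm hy).symm)
  · exact (L1.integrable_coeFn (f.1 - g.1)).2.ne

/-- The emission laws. -/
noncomputable def emissionLaw (f : Fin k → Density lam) (i : Fin k) : Measure Y :=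
  lam.withDensity fun y => ENNReal.ofReal (f i y)

instance (f : Fin k → Density lam) (i : Fin k) : IsProbabilityMeasure (emissionLaw f i) :=
  ⟨by rw [emissionLaw, withDensity_apply _ MeasurableSet.univ, setLIntegral_univ,
    (f i).lintegral_ofReal]⟩

theorem measurable_obsDensity (μ : Fin k → ℝ) (Q : TransMat k) (f : Fin k → Density lam) (n : ℕ) :
    Measurable (obsDensity μ Q (fun j => ⇑(f j)) n) :=
  Finset.measurable_fun_sum _ fun x _ => Measurable.const_mul
    (Finset.measurable_fun_prod _ fun t _ => (f (x t)).measurable.comp (measurable_pi_apply t)) _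

variable [SigmaFinite lam]

theorem ae_pi_forall {n : ℕ} {p : Y → Prop} (h : ∀ᵐ y ∂lam, p y) :
    ∀ᵐ y ∂(Measure.pi fun _ : Fin n => lam), ∀ t, p (y t) :=
  ae_all_iff.2 fun t =>
    (Measure.tendsto_eval_ae_ae (μ := fun _ : Fin n => lam) (i := t)).eventually h

theorem ae_pi_density_nonneg (f : Fin k → Density lam) (n : ℕ) :
    ∀ᵐ y ∂(Measure.pi fun _ : Fin n => lam), ∀ i t, 0 ≤ f i (y t) := by
  filter_upwards [ae_pi_forall (n := n) (ae_all_iff.2 fun i => (f i).ae_nonneg)] with y hy i t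
  exact hy t i

theorem lintegral_pi_succ {n : ℕ} {G : (Fin (n + 1) → Y) → ℝ≥0∞} (hG : Measurable G) :
    ∫⁻ y, G y ∂(Measure.pi fun _ => lam) =
      ∫⁻ p, G (Fin.cons p.1 p.2) ∂(lam.prod (Measure.pi fun _ : Fin n => lam)) := by
  have h2 : (fun _ => lam : Fin (n + 1) → Measure Y) = Fin.cons lam fun _ => lam := by
    ext1 t; refine Fin.cases ?_ (fun j => ?_) t <;> simp
  rw [h2, pi_cons, consLaw, lintegral_map hG measurable_cons]

theorem lintegral_enorm_prod_density {n : ℕ} (f : Fin n → Density lam) :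
    ∫⁻ y, ‖∏ t, f t (y t)‖ₑ ∂(Measure.pi fun _ => lam) = 1 := by
  induction n with
  | zero => rw [pi_fin_zero, lintegral_dirac' _ (by fun_prop)]; simp
  | succ n ih =>
    have hm : ∀ {m : ℕ} (f : Fin m → Density lam), Measurable fun y : Fin m → Y => ∏ t, f t (y t) :=
      fun f => Finset.measurable_fun_prod _ fun t _ => (f t).measurable.comp (measurable_pi_apply t)
    rw [lintegral_pi_succ (hm f).enorm]
    simp only [Fin.prod_univ_succ, Fin.cons_zero, Fin.cons_succ, enorm_mul]
    rw [lintegral_prod_mul (f 0).measurable.enorm.aemeasurable (hm _).enorm.aemeasurable,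
      (f 0).lintegral_enorm, ih fun t => f t.succ, one_mul]

/-- Telescoping: the factors are exchanged one at a time, and all the others integrate to one. -/
theorem lintegral_enorm_prod_density_sub_le {n : ℕ} (f g : Fin n → Density lam) {δ : ℝ≥0∞}
    (h : ∀ t, ENNReal.ofReal (dist (f t) (g t)) ≤ δ) :
    ∫⁻ y, ‖∏ t, f t (y t) - ∏ t, g t (y t)‖ₑ ∂(Measure.pi fun _ => lam) ≤ n * δ := by
  induction n with
  | zero => simp
  | succ n ih =>
    have hm : ∀ {m : ℕ} (f : Fin m → Density lam), Measurable fun y : Fin m → Y => ∏ t, f t (y t) :=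
      fun f => Finset.measurable_fun_prod _ fun t _ => (f t).measurable.comp (measurable_pi_apply t)
    have hd : Measurable fun y : Fin (n + 1) → Y => ‖∏ t, f t (y t) - ∏ t, g t (y t)‖ₑ :=
      ((hm f).sub (hm g)).enorm
    rw [lintegral_pi_succ hd]
    simp only [Fin.prod_univ_succ, Fin.cons_zero, Fin.cons_succ]
    calc
      _ ≤ ∫⁻ p : Y × (Fin n → Y), (‖f 0 p.1 - g 0 p.1‖ₑ * ‖∏ t, f (Fin.succ t) (p.2 t)‖ₑ +
          ‖g 0 p.1‖ₑ * ‖∏ t, f (Fin.succ t) (p.2 t) - ∏ t, g (Fin.succ t) (p.2 t)‖ₑ)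
          ∂(lam.prod (Measure.pi fun _ : Fin n => lam)) := by
          refine lintegral_mono fun p => ?_
          rw [← enorm_mul, ← enorm_mul]
          refine le_trans (le_of_eq ?_) (enorm_add_le _ _)
          congr 1
          ring
      _ ≤ δ * 1 + 1 * (n * δ) := by
          have h1 : Measurable fun y => ‖f 0 y - g 0 y‖ₑ :=
            ((f 0).measurable.sub (g 0).measurable).enorm
          have h2 : Measurable fun y : Fin n → Y => ‖∏ t, f (Fin.succ t) (y t)‖ₑ :=
            (hm fun t => f (Fin.succ t)).enorm
          have h3 : Measurable fun y : Fin n → Y =>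
              ‖∏ t, f (Fin.succ t) (y t) - ∏ t, g (Fin.succ t) (y t)‖ₑ :=
            ((hm fun t => f (Fin.succ t)).sub (hm fun t => g (Fin.succ t))).enorm
          have key : ∀ {a b : Y → ℝ≥0∞} {c d : (Fin n → Y) → ℝ≥0∞}, Measurable a → Measurable b →
              Measurable c → Measurable d → ∫⁻ p : Y × (Fin n → Y), (a p.1 * c p.2 + b p.1 * d p.2)
                ∂(lam.prod (Measure.pi fun _ : Fin n => lam)) =
              (∫⁻ y, a y ∂lam) * (∫⁻ y, c y ∂(Measure.pi fun _ : Fin n => lam)) +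
                (∫⁻ y, b y ∂lam) * (∫⁻ y, d y ∂(Measure.pi fun _ : Fin n => lam)) := by
            intro a b c d ha hb hc hd
            rw [lintegral_add_left (by fun_prop), lintegral_prod_mul ha.aemeasurable hc.aemeasurable,
              lintegral_prod_mul hb.aemeasurable hd.aemeasurable]
          refine (key h1 (g 0).measurable.enorm h2 h3).le.trans ?_
          refine add_le_add (mul_le_mul' ?_ (lintegral_enorm_prod_density fun t => f t.succ).le)
            (mul_le_mul' (g 0).lintegral_enorm.le (ih _ _ fun t => h _))
          exact ((f 0).lintegral_enorm_sub (g 0)).le.trans (h 0)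
      _ = _ := by push_cast; ring

theorem integrable_prod_density {n : ℕ} (f : Fin n → Density lam) :
    Integrable (fun y : Fin n → Y => ∏ t, f t (y t)) (Measure.pi fun _ => lam) :=
  Integrable.fintype_prod_dep fun t => (f t).integrable

theorem integrable_obsDensity (μ : Fin k → ℝ) (Q : TransMat k) (f : Fin k → Density lam) (n : ℕ) :
    Integrable (obsDensity μ Q (fun j => ⇑(f j)) n) (Measure.pi fun _ => lam) :=
  integrable_finsetSum _ fun x _ => (integrable_prod_density fun t => f (x t)).const_mul _

theorem integral_abs_obsDensity_sub_le {μ : Fin k → ℝ} (hμ : μ ∈ stdSimplex ℝ (Fin k))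
    (Q : TransMat k) (f c : Fin k → Density lam) (n : ℕ) :
    ∫ y, |obsDensity μ Q (fun j => ⇑(f j)) n y - obsDensity μ Q (fun j => ⇑(c j)) n y|
      ∂(Measure.pi fun _ => lam) ≤ n * dist f c := by
  have hprod : ∀ x : Fin n → Fin k, ∫ y : Fin n → Y, |∏ t, f (x t) (y t) - ∏ t, c (x t) (y t)|
      ∂(Measure.pi fun _ => lam) ≤ n * dist f c := by
    intro x
    have h1 := lintegral_enorm_prod_density_sub_le (fun t => f (x t)) (fun t => c (x t))
      (δ := ENNReal.ofReal (dist f c)) fun t => ENNReal.ofReal_le_ofReal (dist_le_pi_dist f c _)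
    have h2 := integral_norm_eq_lintegral_enorm ((integrable_prod_density fun t => f (x t)).sub
      (integrable_prod_density fun t => c (x t))).aestronglyMeasurable
    refine h2.le.trans ((ENNReal.toReal_mono (by finiteness) h1).trans (le_of_eq ?_))
    rw [ENNReal.toReal_mul, ENNReal.toReal_natCast, ENNReal.toReal_ofReal dist_nonneg]
  have hI : ∀ x : Fin n → Fin k, Integrable (fun y : Fin n → Y =>
      pathProb μ Q n x * |∏ t, f (x t) (y t) - ∏ t, c (x t) (y t)|) (Measure.pi fun _ => lam) :=
    fun x => (((integrable_prod_density fun t => f (x t)).sub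
      (integrable_prod_density fun t => c (x t))).abs).const_mul _
  calc _ ≤ ∫ y, ∑ x, pathProb μ Q n x * |∏ t, f (x t) (y t) - ∏ t, c (x t) (y t)|
        ∂(Measure.pi fun _ => lam) := by
        refine integral_mono ((integrable_obsDensity μ Q f n).sub
          (integrable_obsDensity μ Q c n)).abs (integrable_finsetSum _ fun x _ => hI x) fun y => ?_
        simp only [obsDensity, ← Finset.sum_sub_distrib, ← mul_sub]
        refine (Finset.abs_sum_le_sum_abs _ _).trans (le_of_eq ?_)
        exact Finset.sum_congr rfl fun x _ => by
          rw [abs_mul, abs_of_nonneg (pathProb_nonneg hμ.1 Q n x)]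
    _ = ∑ x, pathProb μ Q n x * ∫ y : Fin n → Y, |∏ t, f (x t) (y t) - ∏ t, c (x t) (y t)|
        ∂(Measure.pi fun _ => lam) := by
        rw [integral_finsetSum _ fun x _ => hI x]
        exact Finset.sum_congr rfl fun x _ => integral_const_mul _ _
    _ ≤ ∑ x, pathProb μ Q n x * (n * dist f c) := Finset.sum_le_sum fun x _ =>
        mul_le_mul_of_nonneg_left (hprod x) (pathProb_nonneg hμ.1 Q n x)
    _ = n * dist f c := by rw [← Finset.sum_mul, sum_pathProb hμ.2, one_mul]

theorem ofReal_obsDensity_ae {μ : Fin k → ℝ} (hμ : ∀ i, 0 ≤ μ i) (Q : TransMat k)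
    (f : Fin k → Density lam) (n : ℕ) :
    (fun y => ENNReal.ofReal (obsDensity μ Q (fun j => ⇑(f j)) n y))
      =ᵐ[Measure.pi fun _ => lam] pathDensity μ Q (fun j => ⇑(f j)) n := by
  filter_upwards [ae_pi_density_nonneg f n] with y hy
  exact ofReal_obsDensity hμ Q hy

theorem mixLaw_emissionLaw {μ : Fin k → ℝ} (hμ : ∀ i, 0 ≤ μ i) (Q : TransMat k)
    (f : Fin k → Density lam) {n : ℕ} (hn : n ≠ 0) :
    mixLaw (emissionLaw f) Q μ n =
      (Measure.pi fun _ => lam).withDensity (pathDensity μ Q (fun j => ⇑(f j)) n) :=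
  have : ∀ i, IsProbabilityMeasure (lam.withDensity fun y => ENNReal.ofReal (f i y)) := fun i =>
    inferInstanceAs (IsProbabilityMeasure (emissionLaw f i))
  mixLaw_eq_withDensity lam (fun i => (f i).measurable) Q hμ hn

theorem integral_mixLaw_emissionLaw {μ : Fin k → ℝ} (hμ : ∀ i, 0 ≤ μ i) (Q : TransMat k)
    (f : Fin k → Density lam) {n : ℕ} (hn : n ≠ 0) (h : (Fin n → Y) → ℝ) :
    ∫ y, h y ∂(mixLaw (emissionLaw f) Q μ n) =
      ∫ y, h y * obsDensity μ Q (fun j => ⇑(f j)) n y ∂(Measure.pi fun _ => lam) := by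
  rw [mixLaw_emissionLaw hμ Q f hn, ← withDensity_congr_ae (ofReal_obsDensity_ae hμ Q f n),
    integral_withDensity_eq_integral_toReal_smul
      (measurable_obsDensity μ Q f n).ennreal_ofReal (ae_of_all _ fun _ => ENNReal.ofReal_lt_top)]
  refine integral_congr_ae ?_
  filter_upwards [ae_pi_density_nonneg f n] with y hy
  rw [ENNReal.toReal_ofReal (obsDensity_nonneg hμ Q hy), smul_eq_mul, mul_comm]

/-- For densities `f` close to `c`, finitely many tests depending only on `c` detect the
`marginalDist` between `(Q, f)` and a fixed parameter, whatever the transition matrix `Q`. -/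
theorem exists_testFunctions_marginalDist [NeZero k] (θs : Param k lam) (c : Fin k → Density lam)
    {l : ℕ} (hl : l ≠ 0) :
    ∃ H : Finset ((Fin l → Y) → ℝ), H.card ≤ 5 ^ (k ^ l + 1) ∧
      (∀ h ∈ H, Measurable h ∧ ∀ y, |h y| ≤ 1) ∧
      ∀ θ : Param k lam, 6 * l * dist θ.2 c ≤ marginalDist l θ θs → 0 < marginalDist l θ θs →
        ∃ h ∈ H, marginalDist l θ θs / 4 ≤
          ∫ y, h y ∂(mixLaw (emissionLaw θ.2) θ.1 (statDist θ.1) l) -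
            ∫ y, h y ∂(mixLaw (emissionLaw θs.2) θs.1 (statDist θs.1) l) := by
  set ps := obsDensity (statDist θs.1) θs.1 (fun j => ⇑(θs.2 j)) l with hps
  -- The transition matrix enters only through the coefficients of these fixed functions; `none`
  -- stands for the true density, taken with coefficient `-1`.
  set g : Option (Fin l → Fin k) → (Fin l → Y) → ℝ := fun o =>
    o.elim ps fun x y => ∏ t, c (x t) (y t) with hg
  have hgI : ∀ o, Integrable (g o) (Measure.pi fun _ => lam)
    | none => integrable_obsDensity _ _ _ _
    | some x => integrable_prod_density fun t => c (x t)
  obtain ⟨H, hcard, hH, htest⟩ := exists_testFunctions _ hgI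
  refine ⟨H, by simpa using hcard, hH, fun θ hθ hpos => ?_⟩
  have hμ := (statDist_isStationary θ.1).1
  have hμs := (statDist_isStationary θs.1).1
  set p := obsDensity (statDist θ.1) θ.1 (fun j => ⇑(θ.2 j)) l with hp
  set pc := obsDensity (statDist θ.1) θ.1 (fun j => ⇑(c j)) l with hpc
  set r := marginalDist l θ θs with hr
  have hpI : Integrable p (Measure.pi fun _ => lam) := integrable_obsDensity _ _ _ _
  have hpcI : Integrable pc (Measure.pi fun _ => lam) := integrable_obsDensity _ _ _ _
  have hpsI : Integrable ps (Measure.pi fun _ => lam) := integrable_obsDensity _ _ _ _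
  set w : Option (Fin l → Fin k) → ℝ := fun o => o.elim (-1) fun x => pathProb (statDist θ.1) θ.1 l x
  have hw : ∀ y, ∑ o, w o * g o y = pc y - ps y := by
    intro y
    rw [Fintype.sum_option]
    simp only [w, hg, Option.elim, hpc, obsDensity]
    ring
  have hdist : ∫ y, |p y - pc y| ∂(Measure.pi fun _ => lam) ≤ l * dist θ.2 c :=
    integral_abs_obsDensity_sub_le hμ θ.1 θ.2 c l
  have hI1 : Integrable (fun y => |p y - pc y|) (Measure.pi fun _ => lam) := (hpI.sub hpcI).abs
  have hI2 : Integrable (fun y => |pc y - ps y|) (Measure.pi fun _ => lam) := (hpcI.sub hpsI).abs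
  have hlow : r - l * dist θ.2 c ≤ ∫ y, |pc y - ps y| ∂(Measure.pi fun _ => lam) := by
    have : r ≤ ∫ y, |p y - pc y| ∂(Measure.pi fun _ => lam) +
        ∫ y, |pc y - ps y| ∂(Measure.pi fun _ => lam) := by
      rw [← integral_add hI1 hI2]
      exact integral_mono (hpI.sub hpsI).abs (hI1.add hI2)
        fun y => abs_sub_le _ _ _
    linarith
  have hd0 : 0 ≤ l * dist θ.2 c := by positivity
  -- Replacing `θ.2` by `c` moves the density by at most `r / 6` in `L¹`. Thus `h` detects at least
  -- `(5 / 6) * r / 2` for `c`, and `5 * r / 12 - r / 6 = r / 4` for `θ`.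
  obtain ⟨h, hhH, hh⟩ := htest w (by simp only [hw]; linarith)
  simp only [hw] at hh
  refine ⟨h, hhH, ?_⟩
  obtain ⟨hm, h1⟩ := hH h hhH
  have hmul : ∀ {u : (Fin l → Y) → ℝ}, Integrable u (Measure.pi fun _ => lam) →
      Integrable (fun a => h a * u a) (Measure.pi fun _ => lam) := fun hu =>
    hu.bdd_mul (c := 1) hm.aestronglyMeasurable (ae_of_all _ fun a => h1 a)
  rw [integral_mixLaw_emissionLaw hμ.1 _ _ hl, integral_mixLaw_emissionLaw hμs.1 _ _ hl,
    ← integral_sub (hmul hpI) (hmul hpsI)]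
  have h2 : ∫ y, h y * (pc y - ps y) ∂(Measure.pi fun _ => lam) ≤
      ∫ y, (h y * p y - h y * ps y) ∂(Measure.pi fun _ => lam) +
        ∫ y, |p y - pc y| ∂(Measure.pi fun _ => lam) := by
    have hI3 : Integrable (fun y => h y * p y - h y * ps y) (Measure.pi fun _ => lam) :=
      (hmul hpI).sub (hmul hpsI)
    rw [← integral_add hI3 hI1]
    refine integral_mono (hmul (hpcI.sub hpsI)) (hI3.add hI1) fun y => ?_
    have h3 : h y * (pc y - p y) ≤ |p y - pc y| := by
      rw [abs_sub_comm]
      refine (le_abs_self _).trans ?_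
      rw [abs_mul]
      exact mul_le_of_le_one_left (abs_nonneg _) (h1 y)
    linarith
  change _ ≤ ∫ y, (h y * p y - h y * ps y) ∂(Measure.pi fun _ => lam)
  linarith

end Comparison

/-! ### Kullback-Leibler bounds for the emission densities -/

section Emission

variable {Y : Type*} [MeasurableSpace Y] {lam : Measure Y}

theorem logRatio_of_pos {a b : ℝ} (ha : 0 < a) (hb : 0 < b) :
    logRatio a b = (Real.log (a / b) : ℝ) := by
  rw [logRatio, if_neg fun h => ha.ne' h.1, ← ENNReal.ofReal_div_of_pos hb,
    ENNReal.log_ofReal_of_pos (div_pos ha hb)]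

theorem logRatio_zero_right {a : ℝ} (ha : 0 < a) : logRatio a 0 = ⊤ := by
  rw [logRatio, if_neg fun h => ha.ne' h.1, ENNReal.ofReal_zero,
    ENNReal.div_zero (ENNReal.ofReal_pos.2 ha).ne', ENNReal.log_top]

theorem ae_notMem_of_top_le_of_lintegral_ne_top {S : Set Y} (hS : MeasurableSet S)
    {φ : Y → ℝ≥0∞} (h : ∀ᵐ y ∂lam, y ∈ S → φ y = ∞) (hφ : ∫⁻ y, φ y ∂lam ≠ ∞) :
    ∀ᵐ y ∂lam, y ∉ S := by
  have h1 : ∫⁻ y, S.indicator (fun _ => ∞) y ∂lam ≤ ∫⁻ y, φ y ∂lam := by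
    refine lintegral_mono_ae (h.mono fun y hy => ?_)
    by_cases hyS : y ∈ S
    · simp [hyS, hy hyS]
    · simp [hyS]
  rw [lintegral_indicator_const hS] at h1
  refine measure_eq_zero_iff_ae_notMem.1 ?_
  by_contra h2
  rw [ENNReal.top_mul h2] at h1
  exact hφ (top_le_iff.1 h1)

/-- Where `a > 0 = b` the extended integrand is infinite, so that set is null; elsewhere the
extended logarithm may be replaced by the real one. -/
theorem lintegral_mul_log_sq_le {a b : Y → ℝ} (ha : Measurable a) (hb : Measurable b)
    (ha0 : ∀ᵐ y ∂lam, 0 ≤ a y) (hb0 : ∀ᵐ y ∂lam, 0 ≤ b y) {v : ℝ≥0∞} (hv : v ≠ ∞)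
    (h : ∫⁻ y, ENNReal.ofReal (a y) * (logRatio (a y) (b y)).abs ^ 2 ∂lam ≤ v) :
    (∀ᵐ y ∂lam, 0 < a y → 0 < b y) ∧
      ∫⁻ y, ENNReal.ofReal (a y * Real.log (a y / b y) ^ 2) ∂lam ≤ v := by
  have hpos : ∀ᵐ y ∂lam, 0 < a y → 0 < b y := by
    have h1 := ae_notMem_of_top_le_of_lintegral_ne_top (lam := lam) (S := {y | 0 < a y ∧ b y = 0})
      ((measurableSet_lt measurable_const ha).inter (hb (measurableSet_singleton 0)))
      (ae_of_all _ fun y hy => by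
        rw [hy.2, logRatio_zero_right hy.1, EReal.abs_top]
        exact ENNReal.mul_top (ENNReal.ofReal_pos.2 hy.1).ne') (ne_top_of_le_ne_top hv h)
    filter_upwards [h1, hb0] with y h2 h3 h4
    exact lt_of_le_of_ne h3 fun h5 => h2 ⟨h4, h5.symm⟩
  refine ⟨hpos, le_trans (lintegral_mono_ae ?_) h⟩
  filter_upwards [hpos, ha0] with y h1 h2
  rcases h2.eq_or_lt with h3 | h3
  · simp [← h3]
  · rw [logRatio_of_pos h3 (h1 h3), EReal.abs_def, ← ENNReal.ofReal_pow (abs_nonneg _), sq_abs,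
      ENNReal.ofReal_mul h2]

theorem integrable_of_lintegral_ofReal_ne_top {g : Y → ℝ} (hg : AEStronglyMeasurable g lam)
    (h1 : ∫⁻ y, ENNReal.ofReal (g y) ∂lam ≠ ∞) (h2 : ∫⁻ y, ENNReal.ofReal (-g y) ∂lam ≠ ∞) :
    Integrable g lam := by
  refine ⟨hg, ?_⟩
  rw [HasFiniteIntegral]
  calc ∫⁻ y, ‖g y‖ₑ ∂lam = ∫⁻ y, (ENNReal.ofReal (g y) + ENNReal.ofReal (-g y)) ∂lam := by
        refine lintegral_congr fun y => ?_
        rcases le_total 0 (g y) with h | h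
        · rw [Real.enorm_of_nonneg h, ENNReal.ofReal_of_nonpos (neg_nonpos.2 h), add_zero]
        · rw [← enorm_neg, Real.enorm_of_nonneg (neg_nonneg.2 h), ENNReal.ofReal_of_nonpos h,
            zero_add]
    _ = _ := lintegral_add_left' hg.aemeasurable.ennreal_ofReal _
    _ < ∞ := ENNReal.add_lt_top.2 ⟨h1.lt_top, h2.lt_top⟩

/-- Passing to a smaller `g` decreases the positive part and increases the negative part. Finiteness
of the negative part of `g` excludes the value `-∞`, so that the extended difference is one of real
numbers. -/
theorem ExtIntegralLE.integral_le {φ : Y → EReal} {v : ℝ} (h : ExtIntegralLE lam φ v) {g : Y → ℝ}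
    (hg : AEStronglyMeasurable g lam) (hle : ∀ᵐ y ∂lam, (g y : EReal) ≤ φ y)
    (hneg : ∫⁻ y, ENNReal.ofReal (-g y) ∂lam ≠ ∞) : Integrable g lam ∧ ∫ y, g y ∂lam ≤ v := by
  obtain ⟨hP, hle'⟩ := h
  have h1 : ∫⁻ y, ENNReal.ofReal (g y) ∂lam ≤ ∫⁻ y, (φ y).toENNReal ∂lam :=
    lintegral_mono_ae (hle.mono fun y hy => by
      simpa using EReal.toENNReal_le_toENNReal hy)
  have h2 : ∫⁻ y, (-φ y).toENNReal ∂lam ≤ ∫⁻ y, ENNReal.ofReal (-g y) ∂lam :=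
    lintegral_mono_ae (hle.mono fun y hy => by
      have := EReal.toENNReal_le_toENNReal (EReal.neg_le_neg_iff.2 hy)
      rwa [← EReal.coe_neg, EReal.real_coe_toENNReal] at this)
  have hI := integrable_of_lintegral_ofReal_ne_top hg (ne_top_of_le_ne_top hP h1) hneg
  refine ⟨hI, ?_⟩
  have hN := ne_top_of_le_ne_top hneg h2
  rw [integral_eq_lintegral_pos_part_sub_lintegral_neg_part hI]
  rw [← EReal.coe_ennreal_toReal hP, ← EReal.coe_ennreal_toReal hN, ← EReal.coe_sub,
    EReal.coe_le_coe_iff] at hle'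
  have h3 := ENNReal.toReal_mono hP h1
  have h4 := ENNReal.toReal_mono hneg h2
  linarith

theorem chiSq_integrableOn {a c : Y → ℝ} (ha : Measurable a) (hc : Measurable c)
    (hc0 : ∀ᵐ y ∂lam, 0 ≤ c y) {S : Set Y} {v : ℝ} (hv : 0 ≤ v) (h : chiSq lam S a c ≤ ENNReal.ofReal v) :
    (∀ᵐ y ∂(lam.restrict S), 0 < a y → 0 < c y) ∧
      IntegrableOn (fun y => (a y - c y) ^ 2 / c y) S lam ∧
      ∫ y in S, (a y - c y) ^ 2 / c y ∂lam ≤ v := by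
  have hpos : ∀ᵐ y ∂(lam.restrict S), 0 < a y → 0 < c y := by
    have h1 := ae_notMem_of_top_le_of_lintegral_ne_top (lam := lam.restrict S)
      (S := {y | 0 < a y ∧ c y = 0})
      ((measurableSet_lt measurable_const ha).inter (hc (measurableSet_singleton 0)))
      (ae_of_all _ fun y hy => by
        rw [hy.2, ENNReal.ofReal_zero, sub_zero]
        exact ENNReal.div_zero (ENNReal.ofReal_pos.2 (pow_pos hy.1 2)).ne')
      (ne_top_of_le_ne_top ENNReal.ofReal_ne_top h)
    filter_upwards [h1, ae_restrict_of_ae hc0] with y h2 h3 h4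
    exact lt_of_le_of_ne h3 fun h5 => h2 ⟨h4, h5.symm⟩
  have hm : Measurable fun y => (a y - c y) ^ 2 / c y := ((ha.sub hc).pow_const 2).div hc
  have h1 : ∫⁻ y in S, ENNReal.ofReal ((a y - c y) ^ 2 / c y) ∂lam ≤ ENNReal.ofReal v := by
    refine le_trans (lintegral_mono_ae ?_) h
    filter_upwards [ae_restrict_of_ae hc0] with y h3
    rcases h3.eq_or_lt with h4 | h4
    · simp [← h4]
    · rw [ENNReal.ofReal_div_of_pos h4]
  have h0 : 0 ≤ᵐ[lam.restrict S] fun y => (a y - c y) ^ 2 / c y := by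
    filter_upwards [ae_restrict_of_ae hc0] with y h3
    exact div_nonneg (sq_nonneg _) h3
  have hI : IntegrableOn (fun y => (a y - c y) ^ 2 / c y) S lam :=
    ⟨hm.aestronglyMeasurable, (hasFiniteIntegral_iff_ofReal h0).2
      (h1.trans_lt ENNReal.ofReal_lt_top)⟩
  refine ⟨hpos, hI, ?_⟩
  rw [integral_eq_lintegral_of_nonneg_ae h0 hm.aestronglyMeasurable]
  exact ENNReal.toReal_le_of_le_ofReal hv h1

/-- Off `S`, `|log| ≤ (1 + log²) / 2` gives at most `v`. On `S`, split `log (a / b) = log (a / c) +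
log (c / b)`. The second part is at most `v` by assumption. For the first, `a * log (a / c) ≤ (a -
c)² / c + (a - c)`: the chi-square term costs `v`, and as `a` and `c` have equal total mass, the
linear term integrates to at most the mass of `c` off `S`, again `v`. -/
theorem integral_mul_log_div_le {a b c : Y → ℝ} (ha : Measurable a) (hb : Measurable b)
    (hc : Measurable c) (haI : Integrable a lam) (hcI : Integrable c lam)
    (ha0 : ∀ᵐ y ∂lam, 0 ≤ a y) (hc0 : ∀ᵐ y ∂lam, 0 ≤ c y)
    (hac : ∫ y, a y ∂lam = ∫ y, c y ∂lam) (hpos : ∀ᵐ y ∂lam, 0 < a y → 0 < b y) {v : ℝ}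
    (hv : 0 ≤ v)
    (hsq : ∫⁻ y, ENNReal.ofReal (a y * Real.log (a y / b y) ^ 2) ∂lam ≤ ENNReal.ofReal v)
    {S : Set Y} (hS : MeasurableSet S) (haS : ∫ y in Sᶜ, a y ∂lam ≤ v)
    (hcS : ∫ y in Sᶜ, c y ∂lam ≤ v) {φ : Y → EReal} (hφ : ExtIntegralLE (lam.restrict S) φ v)
    (hle : ∀ y, 0 ≤ a y → (a y : EReal) * logRatio (c y) (b y) ≤ φ y)
    (hchi : chiSq lam S a c ≤ ENNReal.ofReal v) :
    Integrable (fun y => a y * Real.log (a y / b y)) lam ∧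
      ∫ y, a y * Real.log (a y / b y) ∂lam ≤ 4 * v := by
  have hsqm : Measurable fun y => a y * Real.log (a y / b y) ^ 2 :=
    ha.mul ((ha.div hb).log.pow_const 2)
  have hsq0 : 0 ≤ᵐ[lam] fun y => a y * Real.log (a y / b y) ^ 2 :=
    ha0.mono fun y hy => mul_nonneg hy (sq_nonneg _)
  have hsqI : Integrable (fun y => a y * Real.log (a y / b y) ^ 2) lam :=
    ⟨hsqm.aestronglyMeasurable, (hasFiniteIntegral_iff_ofReal hsq0).2
      (hsq.trans_lt ENNReal.ofReal_lt_top)⟩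
  have hsqv : ∫ y, a y * Real.log (a y / b y) ^ 2 ∂lam ≤ v := by
    rw [integral_eq_lintegral_of_nonneg_ae hsq0 hsqm.aestronglyMeasurable]
    exact ENNReal.toReal_le_of_le_ofReal hv hsq
  set g : Y → ℝ := fun y => a y * Real.log (a y / b y) with hg
  have hgm : Measurable g := ha.mul (ha.div hb).log
  have hgle : ∀ᵐ y ∂lam, |g y| ≤ (a y + a y * Real.log (a y / b y) ^ 2) / 2 := by
    filter_upwards [ha0] with y hy
    rw [hg, abs_mul, abs_of_nonneg hy]
    have h1 := sq_nonneg (|Real.log (a y / b y)| - 1)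
    rw [sub_sq, sq_abs] at h1
    nlinarith
  have hI2 : Integrable (fun y => (a y + a y * Real.log (a y / b y) ^ 2) / 2) lam :=
    (haI.add hsqI).div_const 2
  have hgI : Integrable g lam := hI2.mono' hgm.aestronglyMeasurable hgle
  refine ⟨hgI, ?_⟩
  have hcompl : ∫ y in Sᶜ, g y ∂lam ≤ v := by
    calc ∫ y in Sᶜ, g y ∂lam
        ≤ ∫ y in Sᶜ, (a y + a y * Real.log (a y / b y) ^ 2) / 2 ∂lam :=
          integral_mono_ae hgI.integrableOn hI2.integrableOn
            (ae_restrict_of_ae (hgle.mono fun y hy => (le_abs_self _).trans hy))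
      _ = (∫ y in Sᶜ, a y ∂lam + ∫ y in Sᶜ, a y * Real.log (a y / b y) ^ 2 ∂lam) / 2 := by
          rw [integral_div, integral_add haI.integrableOn hsqI.integrableOn]
      _ ≤ (v + v) / 2 := by
          have := (setIntegral_le_integral hsqI hsq0 (s := Sᶜ)).trans hsqv
          linarith
      _ = v := by ring
  obtain ⟨hpos', hchiI, hchiv⟩ := chiSq_integrableOn ha hc hc0 hv hchi
  set R : Y → ℝ := fun y => (a y - c y) ^ 2 / c y + (a y - c y) with hR
  have hacI : IntegrableOn (fun y => a y - c y) S lam := (haI.sub hcI).integrableOn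
  have hRI : IntegrableOn R S lam := hchiI.add hacI
  have hRv : ∫ y in S, R y ∂lam ≤ 2 * v := by
    rw [hR, integral_add hchiI hacI, integral_sub haI.integrableOn hcI.integrableOn]
    have h1 := integral_add_compl hS haI
    have h2 := integral_add_compl hS hcI
    have h3 : 0 ≤ ∫ y in Sᶜ, a y ∂lam := integral_nonneg_of_ae (ae_restrict_of_ae ha0)
    linarith
  set B : Y → ℝ := fun y => a y * Real.log (c y / b y) with hB
  have hBm : Measurable B := ha.mul (hc.div hb).log
  have hgRB : ∀ᵐ y ∂(lam.restrict S), g y ≤ R y + B y := by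
    filter_upwards [hpos', ae_restrict_of_ae hpos, ae_restrict_of_ae ha0,
      ae_restrict_of_ae hc0] with y h1 h2 h3 h4
    rcases h3.eq_or_lt with h5 | h5
    · simp only [hg, hR, hB, ← h5, zero_mul, zero_sub, even_two.neg_pow, add_zero]
      rcases h4.eq_or_lt with h6 | h6
      · simp [← h6]
      · rw [sq, mul_div_assoc, div_self h6.ne']; simp
    · have hc' := h1 h5
      have hb' := h2 h5
      have h6 : Real.log (a y / b y) = Real.log (a y / c y) + Real.log (c y / b y) := by
        rw [← Real.log_mul (div_pos h5 hc').ne' (div_pos hc' hb').ne']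
        congr 1
        field_simp
      have h7 := Real.log_le_sub_one_of_pos (div_pos h5 hc')
      have h8 : R y = a y * (a y / c y - 1) := by
        simp only [hR]
        field_simp
        ring
      rw [h8]
      simp only [hg, hB, h6]
      nlinarith
  have hBφ : ∀ᵐ y ∂(lam.restrict S), (B y : EReal) ≤ φ y := by
    filter_upwards [hpos', ae_restrict_of_ae hpos, ae_restrict_of_ae ha0] with y h1 h2 h3
    refine le_trans (le_of_eq ?_) (hle y h3)
    rcases h3.eq_or_lt with h5 | h5
    · simp [hB, ← h5]
    · rw [logRatio_of_pos (h1 h5) (h2 h5), ← EReal.coe_mul]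
  -- `B` is bounded below by the integrable function `g - R`, which makes its negative part
  -- integrable before anything is known about its positive part.
  have hBneg : ∫⁻ y in S, ENNReal.ofReal (-B y) ∂lam ≠ ∞ := by
    have h1 : IntegrableOn (fun y => R y - g y) S lam := hRI.sub hgI.integrableOn
    refine ne_top_of_le_ne_top h1.2.ne (lintegral_mono_ae (hgRB.mono fun y hy => ?_))
    rw [Real.enorm_eq_ofReal_abs]
    refine ENNReal.ofReal_le_ofReal (le_trans ?_ (le_abs_self _))
    linarith
  obtain ⟨hBI, hBv⟩ := hφ.integral_le hBm.aestronglyMeasurable hBφ hBneg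
  have hSv : ∫ y in S, g y ∂lam ≤ 2 * v + v := by
    calc _ ≤ ∫ y in S, (R y + B y) ∂lam :=
          integral_mono_ae hgI.integrableOn (hRI.add hBI) hgRB
      _ = ∫ y in S, R y ∂lam + ∫ y in S, B y ∂lam := integral_add hRI hBI
      _ ≤ _ := add_le_add hRv hBv
  rw [← integral_add_compl hS hgI]
  linarith

theorem integral_emissionLaw {k : ℕ} (fs : Fin k → Density lam) (i : Fin k) (g : Y → ℝ) :
    ∫ y, g y ∂(emissionLaw fs i) = ∫ y, fs i y * g y ∂lam := by
  rw [emissionLaw, integral_withDensity_eq_integral_toReal_smul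
    (fs i).measurable.ennreal_ofReal (ae_of_all _ fun _ => ENNReal.ofReal_lt_top)]
  refine integral_congr_ae ((fs i).ae_nonneg.mono fun y hy => ?_)
  simp only [smul_eq_mul]
  rw [ENNReal.toReal_ofReal hy]

theorem EmissionClose.moments {k : ℕ} {fs f : Fin k → Density lam} {e u : ℝ} (hu : 1 ≤ u)
    (h : EmissionClose fs f e u) (i : Fin k) :
    (∀ᵐ y ∂lam, 0 < fs i y → 0 < f i y) ∧
      MemLp (fun y => Real.log (fs i y / f i y)) 2 (emissionLaw fs i) ∧
      ∫ y, Real.log (fs i y / f i y) ∂(emissionLaw fs i) ≤ 4 * e ^ 2 ∧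
      ProbabilityTheory.variance (fun y => Real.log (fs i y / f i y)) (emissionLaw fs i)
        ≤ e ^ 2 := by
  obtain ⟨hsq, S, ft, hS, -, hftS, hfsS, hext, hchi⟩ := h
  have hue : e ^ 2 / u ≤ e ^ 2 := div_le_self (sq_nonneg e) hu
  obtain ⟨hpos, hsq'⟩ := lintegral_mul_log_sq_le (fs i).measurable (f i).measurable
    (fs i).ae_nonneg (f i).ae_nonneg ENNReal.ofReal_ne_top (hsq i i)
  replace hsq' := hsq'.trans (ENNReal.ofReal_le_ofReal hue)
  have hmean := integral_mul_log_div_le (fs i).measurable (f i).measurable (ft i).measurable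
    (fs i).integrable (ft i).integrable (fs i).ae_nonneg (ft i).ae_nonneg
    ((fs i).2.2.trans (ft i).2.2.symm) hpos (sq_nonneg e) hsq' hS ((hfsS i).trans hue) (hftS i)
    (hext i) (fun y hy => mul_le_mul_of_nonneg_left
      (le_iSup (fun j => logRatio (ft j y) (f j y)) i) (EReal.coe_nonneg.2 hy)) (hchi i)
  have hLm : Measurable fun y => Real.log (fs i y / f i y) :=
    ((fs i).measurable.div (f i).measurable).log
  have hLsq : ∫⁻ y, ENNReal.ofReal (Real.log (fs i y / f i y) ^ 2) ∂(emissionLaw fs i)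
      ≤ ENNReal.ofReal (e ^ 2) := by
    rw [emissionLaw, lintegral_withDensity_eq_lintegral_mul _ (fs i).measurable.ennreal_ofReal
      (hLm.pow_const 2).ennreal_ofReal]
    refine (lintegral_congr_ae ((fs i).ae_nonneg.mono fun y hy => ?_)).trans_le hsq'
    exact (ENNReal.ofReal_mul hy).symm
  have hmem : MemLp (fun y => Real.log (fs i y / f i y)) 2 (emissionLaw fs i) := by
    rw [memLp_two_iff_integrable_sq hLm.aestronglyMeasurable]
    exact ⟨(hLm.pow_const 2).aestronglyMeasurable,
      (hasFiniteIntegral_iff_ofReal (ae_of_all _ fun y => sq_nonneg _)).2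
        (hLsq.trans_lt ENNReal.ofReal_lt_top)⟩
  refine ⟨hpos, hmem, ?_, ?_⟩
  · rw [integral_emissionLaw]
    exact hmean.2
  · refine (ProbabilityTheory.variance_le_expectation_sq hLm.aestronglyMeasurable).trans ?_
    change ∫ y, Real.log (fs i y / f i y) ^ 2 ∂(emissionLaw fs i) ≤ _
    rw [integral_eq_lintegral_of_nonneg_ae (ae_of_all _ fun y => sq_nonneg _)
      (hLm.pow_const 2).aestronglyMeasurable]
    exact ENNReal.toReal_le_of_le_ofReal (sq_nonneg _) hLsq

end Emission

/-! ### Likelihood ratios along a path of hidden states -/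

section LikelihoodRatio

variable {k : ℕ} {Y : Type*} [MeasurableSpace Y] {lam : Measure Y}

/-- Along a fixed path the log ratio is a sum of independent terms, with mean at most `n * m` and
variance at most `n * v`; this is Chebyshev's inequality. -/
theorem pi_emissionLaw_prod_gt_le {fs f : Fin k → Density lam} {m v : ℝ}
    (hpos : ∀ i, ∀ᵐ y ∂lam, 0 < fs i y → 0 < f i y)
    (hmem : ∀ i, MemLp (fun y => Real.log (fs i y / f i y)) 2 (emissionLaw fs i))
    (hmean : ∀ i, ∫ y, Real.log (fs i y / f i y) ∂(emissionLaw fs i) ≤ m)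
    (hvar : ∀ i, ProbabilityTheory.variance (fun y => Real.log (fs i y / f i y))
      (emissionLaw fs i) ≤ v) {n : ℕ} (x : Fin n → Fin k) {s : ℝ} (hs : 0 < s) :
    Measure.pi (fun t => emissionLaw fs (x t))
        {y | Real.exp (n * m + s) * ∏ t, f (x t) (y t) < ∏ t, fs (x t) (y t)}
      ≤ ENNReal.ofReal (n * v / s ^ 2) := by
  set ν := Measure.pi fun t => emissionLaw fs (x t) with hν
  set L : (Fin n → Y) → ℝ := ∑ t, fun y => Real.log (fs (x t) (y t) / f (x t) (y t)) with hL
  have hLt : ∀ t, MemLp (fun y : Fin n → Y => Real.log (fs (x t) (y t) / f (x t) (y t))) 2 ν :=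
    fun t => (hmem (x t)).comp_measurePreserving
      (measurePreserving_eval (fun t => emissionLaw fs (x t)) t)
  have hLmem : MemLp L 2 ν := memLp_finsetSum' _ fun t _ => hLt t
  have hLvar : ProbabilityTheory.variance L ν ≤ n * v := by
    rw [hL, ProbabilityTheory.variance_sum_pi fun t => hmem (x t)]
    exact (Finset.sum_le_sum fun t _ => hvar (x t)).trans (by simp)
  have hLmean : ∫ y, L y ∂ν ≤ n * m := by
    have h1 : ∫ y, L y ∂ν = ∑ t, ∫ y, Real.log (fs (x t) y / f (x t) y) ∂(emissionLaw fs (x t)) := by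
      simp only [hL, Finset.sum_apply]
      rw [integral_finsetSum _ fun t _ => (hLt t).integrable one_le_two]
      refine Finset.sum_congr rfl fun t _ => ?_
      rw [← (measurePreserving_eval (fun t => emissionLaw fs (x t)) t).map_eq,
        integral_map (measurable_pi_apply t).aemeasurable]
      exact ((fs (x t)).measurable.div (f (x t)).measurable).log.aestronglyMeasurable
    rw [h1]
    exact (Finset.sum_le_sum fun t _ => hmean (x t)).trans (by simp)
  have hae : ∀ᵐ y ∂ν, ∀ t, 0 < fs (x t) (y t) ∧ 0 < f (x t) (y t) := by
    refine ae_all_iff.2 fun t => ?_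
    refine (Measure.tendsto_eval_ae_ae (μ := fun t => emissionLaw fs (x t)) (i := t)).eventually
      (p := fun z => 0 < fs (x t) z ∧ 0 < f (x t) z) ?_
    rw [emissionLaw, ae_withDensity_iff (fs (x t)).measurable.ennreal_ofReal]
    filter_upwards [hpos (x t)] with z hz h0
    have := ENNReal.ofReal_pos.1 (pos_iff_ne_zero.2 h0)
    exact ⟨this, hz this⟩
  refine le_trans (measure_mono_ae ?_)
    ((ProbabilityTheory.meas_ge_le_variance_div_sq hLmem hs).trans
      (ENNReal.ofReal_le_ofReal (by gcongr)))
  filter_upwards [hae] with y hy hlt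
  have hlt' : Real.exp (n * m + s) * ∏ t, f (x t) (y t) < ∏ t, fs (x t) (y t) := hlt
  have h1 : 0 < ∏ t, f (x t) (y t) := Finset.prod_pos fun t _ => (hy t).2
  have h2 : L y = Real.log ((∏ t, fs (x t) (y t)) / ∏ t, f (x t) (y t)) := by
    rw [← Finset.prod_div_distrib, Real.log_prod fun t _ => (div_pos (hy t).1 (hy t).2).ne', hL,
      Finset.sum_apply]
  have h3 : n * m + s < L y := by
    rw [h2, Real.lt_log_iff_exp_lt (div_pos (Finset.prod_pos fun t _ => (hy t).1) h1),
      lt_div_iff₀ h1]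
    exact hlt'
  change s ≤ |L y - ∫ y, L y ∂ν|
  exact le_trans (by linarith) (le_abs_self _)

/-- The second moment of the likelihood ratio of two Markov paths factorises: each transition
multiplies it by at most `c`. -/
theorem sum_pathProb_sq_div_le {Qs Q : TransMat k} (hQ : ∀ i j, 0 < Q.1 i j) {c : ℝ}
    (hc : ∀ i, ∑ j, Qs.1 i j ^ 2 / Q.1 i j ≤ c) {μ ν : Fin k → ℝ} (hν : ∀ i, 0 < ν i) (n : ℕ) :
    ∑ x, pathProb μ Qs (n + 1) x ^ 2 / pathProb ν Q (n + 1) x ≤ (∑ i, μ i ^ 2 / ν i) * c ^ n := by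
  induction n generalizing μ ν with
  | zero =>
    rw [← (Fin.consEquiv fun _ => Fin k).sum_comp, Fintype.sum_prod_type]
    simp [pathProb, Fin.consEquiv]
  | succ n ih =>
    rw [← (Fin.consEquiv fun _ => Fin k).sum_comp, Fintype.sum_prod_type, Finset.sum_mul]
    refine Finset.sum_le_sum fun i _ => ?_
    simp only [Fin.consEquiv, Equiv.coe_fn_mk, pathProb_cons, mul_pow, mul_div_mul_comm,
      ← Finset.mul_sum]
    refine mul_le_mul_of_nonneg_left ?_ (div_nonneg (sq_nonneg _) (hν i).le)
    have hc0 : 0 ≤ c := le_trans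
      (Finset.sum_nonneg fun j _ => div_nonneg (sq_nonneg _) (hQ i j).le) (hc i)
    refine (ih (hQ i)).trans ?_
    rw [pow_succ']
    exact mul_le_mul_of_nonneg_right (hc i) (by positivity)

theorem pathProb_pos {μ : Fin k → ℝ} (hμ : ∀ i, 0 < μ i) {Q : TransMat k}
    (hQ : ∀ i j, 0 < Q.1 i j) : ∀ (n : ℕ) (x : Fin n → Fin k), 0 < pathProb μ Q n x
  | 0, _ => zero_lt_one
  | _ + 1, _ => mul_pos (hμ _) (Finset.prod_pos fun _ _ => hQ _ _)

/-- The mass of the paths along which the transition likelihood ratio is large. -/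
theorem sum_pathProb_gt_le {Qs Q : TransMat k} (hQ : ∀ i j, 0 < Q.1 i j) {c : ℝ}
    (hc : ∀ i, ∑ j, Qs.1 i j ^ 2 / Q.1 i j ≤ c) {μ : Fin k → ℝ} (hμ : μ ∈ stdSimplex ℝ (Fin k))
    {n : ℕ} (hn : n ≠ 0) {r : ℝ} (hr : 0 < r) (hc1 : 1 ≤ c) :
    ∑ x : Fin n → Fin k, (if r * pathProb (fun _ => 1) Q n x < pathProb μ Qs n x then
      pathProb μ Qs n x else 0) ≤ c ^ n / r := by
  obtain ⟨n, rfl⟩ := Nat.exists_eq_succ_of_ne_zero hn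
  have h1 : ∑ i, μ i ^ 2 / 1 ≤ 1 := by
    refine (Finset.sum_le_sum fun i _ => ?_).trans hμ.2.le
    have h2 : μ i ≤ 1 := hμ.2 ▸ Finset.single_le_sum (fun j _ => hμ.1 j) (Finset.mem_univ i)
    have := hμ.1 i
    nlinarith
  have h2 := sum_pathProb_sq_div_le (μ := μ) hQ hc (ν := fun _ => 1) (fun _ => one_pos) n
  have h3 : (∑ i, μ i ^ 2 / 1) * c ^ n ≤ c ^ (n + 1) := by
    rw [pow_succ]
    have h4 : 0 ≤ c ^ n := by positivity
    calc _ ≤ 1 * c ^ n := mul_le_mul_of_nonneg_right h1 h4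
      _ ≤ _ := by rw [mul_comm]; exact mul_le_mul_of_nonneg_left hc1 h4
  rw [le_div_iff₀ hr]
  refine le_trans ?_ (h2.trans h3)
  rw [Finset.sum_mul]
  refine Finset.sum_le_sum fun x _ => ?_
  have hp := pathProb_pos (μ := fun _ => (1 : ℝ)) (fun _ => one_pos) hQ (n + 1) x
  have hp' := pathProb_nonneg hμ.1 Qs (n + 1) x
  split_ifs with h
  · rw [le_div_iff₀ hp]
    change r * _ < _ at h
    nlinarith
  · rw [zero_mul]; positivity

variable [SigmaFinite lam]

theorem pi_emissionLaw (f : Fin k → Density lam) {n : ℕ} (x : Fin n → Fin k) :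
    Measure.pi (fun t => emissionLaw f (x t)) =
      (Measure.pi fun _ => lam).withDensity fun y => ∏ t, ENNReal.ofReal (f (x t) (y t)) :=
  pi_withDensity lam (fun t => (f (x t)).measurable.ennreal_ofReal) fun t => by
    rw [(f (x t)).lintegral_ofReal]; exact ENNReal.one_ne_top

/-- Under the true parameter, the likelihood of a nearby parameter is rarely much smaller than the
true likelihood. -/
theorem withDensity_pathDensity_lt_le {fs f : Fin k → Density lam} {m v : ℝ}
    (hpos : ∀ i, ∀ᵐ y ∂lam, 0 < fs i y → 0 < f i y)
    (hmem : ∀ i, MemLp (fun y => Real.log (fs i y / f i y)) 2 (emissionLaw fs i))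
    (hmean : ∀ i, ∫ y, Real.log (fs i y / f i y) ∂(emissionLaw fs i) ≤ m)
    (hvar : ∀ i, ProbabilityTheory.variance (fun y => Real.log (fs i y / f i y))
      (emissionLaw fs i) ≤ v)
    {Qs Q : TransMat k} (hQ : ∀ i j, 0 < Q.1 i j) {c : ℝ} (hc1 : 1 ≤ c)
    (hc : ∀ i, ∑ j, Qs.1 i j ^ 2 / Q.1 i j ≤ c) {μ : Fin k → ℝ} (hμ : μ ∈ stdSimplex ℝ (Fin k))
    {n : ℕ} (hn : n ≠ 0) {r s : ℝ} (hr : 0 < r) (hs : 0 < s) :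
    (Measure.pi fun _ => lam).withDensity (pathDensity μ Qs (fun j => ⇑(fs j)) n)
        {y | ENNReal.ofReal (2 * (r * Real.exp (n * m + s))) *
          pathDensity (fun _ => 1) Q (fun j => ⇑(f j)) n y <
            pathDensity μ Qs (fun j => ⇑(fs j)) n y}
      ≤ 2 * (ENNReal.ofReal (c ^ n / r) + ENNReal.ofReal (n * v / s ^ 2)) := by
  classical
  set E := Real.exp (n * m + s) with hE
  set ps := pathDensity μ Qs (fun j => ⇑(fs j)) n with hps
  set p := pathDensity (fun _ => 1) Q (fun j => ⇑(f j)) n with hp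
  have hpsm : Measurable ps := measurable_pathDensity (fun i => (fs i).measurable) n
  have hpm : Measurable p := measurable_pathDensity (fun i => (f i).measurable) n
  set A := {y | ENNReal.ofReal (2 * (r * E)) * p y < ps y} with hA
  have hAm : MeasurableSet A := measurableSet_lt (hpm.const_mul _) hpsm
  have hprodm : ∀ (g : Fin k → Density lam) (x : Fin n → Fin k),
      Measurable fun y : Fin n → Y => ∏ t, g (x t) (y t) := fun g x =>
    Finset.measurable_fun_prod _ fun t _ => (g (x t)).measurable.comp (measurable_pi_apply t)
  have hprodm' : ∀ x : Fin n → Fin k,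
      Measurable fun y : Fin n → Y => ∏ t, ENNReal.ofReal (fs (x t) (y t)) := fun x =>
    Finset.measurable_fun_prod _ fun t _ =>
      ((fs (x t)).measurable.comp (measurable_pi_apply t)).ennreal_ofReal
  set T : (Fin n → Fin k) → Set (Fin n → Y) := fun x =>
    {y | E * ∏ t, f (x t) (y t) < ∏ t, fs (x t) (y t)} with hT
  have hTm : ∀ x, MeasurableSet (T x) := fun x =>
    measurableSet_lt ((hprodm f x).const_mul E) (hprodm fs x)
  set w : (Fin n → Fin k) → ℝ := fun x =>
    if r * pathProb (fun _ => 1) Q n x < pathProb μ Qs n x then pathProb μ Qs n x else 0 with hw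
  set b1 : (Fin n → Y) → ℝ≥0∞ := fun y =>
    ∑ x, ENNReal.ofReal (w x) * ∏ t, ENNReal.ofReal (fs (x t) (y t)) with hb1
  set b2 : (Fin n → Y) → ℝ≥0∞ := fun y => ∑ x, ENNReal.ofReal (pathProb μ Qs n x) *
    (T x).indicator (fun y => ∏ t, ENNReal.ofReal (fs (x t) (y t))) y with hb2
  -- `b1` collects the paths whose transition ratio is large, `b2` the remaining cause, a large
  -- product of emission ratios; any path free of both is dominated termwise by `r * E` times its
  -- contribution to `p`.
  have hsplit : ∀ᵐ y ∂(Measure.pi fun _ : Fin n => lam),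
      ps y ≤ b1 y + b2 y + ENNReal.ofReal (r * E) * p y := by
    filter_upwards [ae_pi_density_nonneg fs n, ae_pi_density_nonneg f n] with y h1 h2
    simp only [hps, hp, hb1, hb2, pathDensity]
    rw [Finset.mul_sum, ← Finset.sum_add_distrib, ← Finset.sum_add_distrib]
    refine Finset.sum_le_sum fun x _ => ?_
    by_cases hx : r * pathProb (fun _ => 1) Q n x < pathProb μ Qs n x
    · simp only [hw, if_pos hx]
      rw [add_assoc]
      exact le_self_add
    by_cases hy : y ∈ T x
    · rw [Set.indicator_of_mem hy]
      exact le_trans le_add_self le_self_add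
    · refine le_trans ?_ le_add_self
      have h3 : ∏ t, fs (x t) (y t) ≤ E * ∏ t, f (x t) (y t) := not_lt.1 hy
      have h4 := not_lt.1 hx
      have h5 := pathProb_nonneg hμ.1 Qs n x
      have h6 := (pathProb_pos (μ := fun _ => (1 : ℝ)) (fun _ => one_pos) hQ n x).le
      have h7 : 0 ≤ ∏ t, fs (x t) (y t) := Finset.prod_nonneg fun t _ => h1 _ _
      rw [← ENNReal.ofReal_prod_of_nonneg fun t _ => h1 _ _,
        ← ENNReal.ofReal_prod_of_nonneg fun t _ => h2 _ _, ← ENNReal.ofReal_mul h5,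
        ← ENNReal.ofReal_mul h6, ← ENNReal.ofReal_mul (by positivity)]
      refine ENNReal.ofReal_le_ofReal ?_
      calc _ ≤ (r * pathProb (fun _ => 1) Q n x) * (E * ∏ t, f (x t) (y t)) :=
            mul_le_mul h4 h3 h7 (by positivity)
        _ = _ := by ring
  -- On `A` the last term of the splitting is at most half of `ps`, so the first two make up the
  -- other half. This is what the factor 2 in the definition of `A` is for.
  have hA2 : ∀ᵐ y ∂(Measure.pi fun _ : Fin n => lam), y ∈ A → ps y ≤ 2 * (b1 y + b2 y) := by
    filter_upwards [hsplit] with y h1 h2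
    have hfin : ps y ≠ ∞ := (pathDensity_lt_top _ _ _ _ _).ne
    have h3 : 2 * (ENNReal.ofReal (r * E) * p y) ≤ ps y := by
      have h4 : ENNReal.ofReal (2 * (r * E)) * p y < ps y := h2
      rw [ENNReal.ofReal_mul zero_le_two, mul_assoc] at h4
      simpa using h4.le
    have h5 : 2 * ps y ≤ 2 * (b1 y + b2 y) + ps y := by
      calc 2 * ps y ≤ 2 * (b1 y + b2 y + ENNReal.ofReal (r * E) * p y) := by gcongr
        _ = 2 * (b1 y + b2 y) + 2 * (ENNReal.ofReal (r * E) * p y) := by rw [mul_add]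
        _ ≤ _ := by gcongr
    rw [two_mul (ps y)] at h5
    exact (ENNReal.add_le_add_iff_right hfin).1 h5
  have hone : ∀ x : Fin n → Fin k, ∫⁻ y : Fin n → Y, ∏ t, ENNReal.ofReal (fs (x t) (y t))
      ∂(Measure.pi fun _ => lam) = 1 := by
    intro x
    have := measure_univ (μ := Measure.pi fun t => emissionLaw fs (x t))
    rwa [pi_emissionLaw, withDensity_apply _ MeasurableSet.univ, setLIntegral_univ] at this
  have hI1 : ∫⁻ y, b1 y ∂(Measure.pi fun _ => lam) ≤ ENNReal.ofReal (c ^ n / r) := by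
    rw [hb1, lintegral_finsetSum _ fun x _ => (hprodm' x).const_mul _]
    have : ∀ x : Fin n → Fin k, ∫⁻ y : Fin n → Y, ENNReal.ofReal (w x) *
        ∏ t, ENNReal.ofReal (fs (x t) (y t)) ∂(Measure.pi fun _ => lam) = ENNReal.ofReal (w x) := by
      intro x
      rw [lintegral_const_mul _ (hprodm' x), hone, mul_one]
    simp only [this]
    rw [← ENNReal.ofReal_sum_of_nonneg fun x _ => ?_]
    · exact ENNReal.ofReal_le_ofReal (sum_pathProb_gt_le hQ hc hμ hn hr hc1)
    · simp only [hw]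
      split_ifs
      · exact pathProb_nonneg hμ.1 Qs n x
      · exact le_rfl
  have hI2 : ∫⁻ y, b2 y ∂(Measure.pi fun _ => lam) ≤ ENNReal.ofReal (n * v / s ^ 2) := by
    rw [hb2, lintegral_finsetSum _ fun x _ => ((hprodm' x).indicator (hTm x)).const_mul _]
    calc _ ≤ ∑ x, ENNReal.ofReal (pathProb μ Qs n x) * ENNReal.ofReal (n * v / s ^ 2) := by
          refine Finset.sum_le_sum fun x _ => ?_
          rw [lintegral_const_mul _ ((hprodm' x).indicator (hTm x)), lintegral_indicator (hTm x),
            ← withDensity_apply _ (hTm x), ← pi_emissionLaw]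
          gcongr
          exact pi_emissionLaw_prod_gt_le hpos hmem hmean hvar x hs
      _ = _ := by
          rw [← Finset.sum_mul,
            ← ENNReal.ofReal_sum_of_nonneg fun x _ => pathProb_nonneg hμ.1 Qs n x,
            sum_pathProb hμ.2, ENNReal.ofReal_one, one_mul]
  have hb1m : Measurable b1 := Finset.measurable_fun_sum _ fun x _ => (hprodm' x).const_mul _
  rw [withDensity_apply _ hAm]
  calc ∫⁻ y in A, ps y ∂(Measure.pi fun _ => lam)
      ≤ ∫⁻ y in A, 2 * (b1 y + b2 y) ∂(Measure.pi fun _ => lam) := by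
        refine setLIntegral_mono_ae' hAm ?_
        exact hA2
    _ ≤ ∫⁻ y, 2 * (b1 y + b2 y) ∂(Measure.pi fun _ => lam) := setLIntegral_le_lintegral _ _
    _ = 2 * (∫⁻ y, b1 y ∂(Measure.pi fun _ => lam) + ∫⁻ y, b2 y ∂(Measure.pi fun _ => lam)) := by
        rw [lintegral_const_mul' _ _ (by simp), lintegral_add_left hb1m]
    _ ≤ _ := by gcongr

end LikelihoodRatio

/-! ### The posterior mass of a set -/

section Posterior

variable {k : ℕ} {Y : Type*} [MeasurableSpace Y] {lam : Measure Y}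
  {g : (Fin k → Density lam) → Fin k → Y → ℝ}

theorem measurable_pathProb (n : ℕ) (x : Fin n → Fin k) :
    Measurable fun Q : TransMat k => pathProb (fun _ => 1) Q n x := by
  have he : ∀ i j, Measurable fun Q : TransMat k => Q.1 i j := fun i j =>
    (measurable_pi_apply j).comp ((measurable_pi_apply i).comp measurable_subtype_coe)
  cases n with
  | zero => exact measurable_const
  | succ n => exact (Finset.measurable_fun_prod _ fun t _ => he _ _).const_mul _

theorem IsJointVersion.measurable_pathDensity (hg : IsJointVersion g) (n : ℕ) :
    Measurable fun p : Param k lam × (Fin n → Y) =>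
      pathDensity (fun _ => 1) p.1.1 (g p.1.2) n p.2 := by
  unfold pathDensity
  refine Finset.measurable_fun_sum _ fun x _ => ?_
  refine Measurable.mul ?_ (Finset.measurable_fun_prod _ fun t _ => ?_)
  · exact ((measurable_pathProb n x).comp (measurable_fst.comp measurable_fst)).ennreal_ofReal
  · have : Measurable fun p : Param k lam × (Fin n → Y) => (p.1.2, p.2 t) :=
      (measurable_snd.comp measurable_fst).prodMk ((measurable_pi_apply t).comp measurable_snd)
    exact ((hg.measurable (x t)).comp this).ennreal_ofReal

variable [SigmaFinite lam]

theorem IsJointVersion.pathDensity_ae_eq (hg : IsJointVersion g) (μ : Fin k → ℝ)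
    (θ : Param k lam) (n : ℕ) :
    pathDensity μ θ.1 (g θ.2) n =ᵐ[Measure.pi fun _ => lam]
      pathDensity μ θ.1 (fun j => ⇑(θ.2 j)) n :=
  pathDensity_ae_congr (fun j => hg.ae_eq θ.2 j) n

theorem IsJointVersion.ae_ae_nonneg (hg : IsJointVersion g) (Pi : Measure (Param k lam))
    [SFinite Pi] (n : ℕ) :
    ∀ᵐ y ∂(Measure.pi fun _ : Fin n => lam), ∀ᵐ θ ∂Pi, ∀ j t, 0 ≤ g θ.2 j (y t) := by
  rw [← Measure.ae_ae_comm]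
  · refine ae_of_all _ fun θ => ?_
    have h : ∀ j, ∀ᵐ y ∂lam, 0 ≤ g θ.2 j y := fun j => by
      filter_upwards [hg.ae_eq θ.2 j, (θ.2 j).ae_nonneg] with y h1 h2
      rw [h1]
      exact h2
    filter_upwards [ae_pi_forall (n := n) (ae_all_iff.2 h)] with y hy j t
    exact hy t j
  · simp only [Set.ofPred_forall]
    refine MeasurableSet.iInter fun j => MeasurableSet.iInter fun t => ?_
    have : Measurable fun p : Param k lam × (Fin n → Y) => (p.1.2, p.2 t) :=
      (measurable_snd.comp measurable_fst).prodMk ((measurable_pi_apply t).comp measurable_snd)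
    exact measurableSet_le measurable_const ((hg.measurable j).comp this)

theorem IsJointVersion.setLIntegral_pathDensity (hg : IsJointVersion g) (θ : Param k lam) {n : ℕ}
    (hn : n ≠ 0) {T : Set (Fin n → Y)} (hT : MeasurableSet T) :
    ∫⁻ y in T, pathDensity (fun _ => 1) θ.1 (g θ.2) n y ∂(Measure.pi fun _ => lam) =
      mixLaw (emissionLaw θ.2) θ.1 (fun _ => 1) n T := by
  rw [mixLaw_emissionLaw (fun _ => zero_le_one) _ _ hn, withDensity_apply _ hT]
  exact setLIntegral_congr_fun_ae hT
    ((hg.pathDensity_ae_eq _ θ n).mono fun y hy _ => hy)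

theorem mixLaw_one_le (F : Fin k → Measure Y) [∀ i, IsProbabilityMeasure (F i)] (Q : TransMat k)
    (n : ℕ) (T : Set (Fin n → Y)) : mixLaw F Q (fun _ => 1) n T ≤ k := by
  simp only [mixLaw, Measure.finsetSum_apply, Measure.smul_apply, smul_eq_mul, ENNReal.ofReal_one,
    one_mul]
  exact (Finset.sum_le_sum fun i _ => prob_le_one).trans (by simp)

/-- The numerator of the posterior is dominated by a function with small integral over an
acceptance region `T`. -/
theorem IsJointVersion.exists_numerator_bound [NeZero k] (hg : IsJointVersion g)
    (Pi : Measure (Param k lam)) [IsProbabilityMeasure Pi] {n : ℕ} (hn : n ≠ 0)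
    {T : Set (Fin n → Y)} (hT : MeasurableSet T) {A R : Set (Param k lam)} {β : ℝ≥0∞}
    (hA : ∀ θ ∈ A, θ ∈ R ∨ mixLaw (emissionLaw θ.2) θ.1 (fun _ => 1) n T ≤ β) :
    ∃ N : (Fin n → Y) → ℝ≥0∞, Measurable N ∧
      (∀ᵐ y ∂(Measure.pi fun _ => lam),
        ∫⁻ θ in A, ENNReal.ofReal (obsDensity (statDist θ.1) θ.1 (g θ.2) n y) ∂Pi ≤ N y) ∧
      ∫⁻ y in T, N y ∂(Measure.pi fun _ => lam) ≤ β + k * Pi R := by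
  have hm := hg.measurable_pathDensity n
  -- `A` and `R` need not be measurable. They are covered by a measurable set defined through the
  -- test error and by a measurable hull, so that Tonelli's theorem applies.
  set A' := {θ : Param k lam |
    ∫⁻ y in T, pathDensity (fun _ => 1) θ.1 (g θ.2) n y ∂(Measure.pi fun _ => lam) ≤ β} with hA'
  set R' := toMeasurable Pi R with hR'
  have hA'm : MeasurableSet A' := measurableSet_le
    (hm.lintegral_prod_right' (ν := (Measure.pi fun _ => lam).restrict T)) measurable_const
  refine ⟨fun y => ∫⁻ θ in A' ∪ R', pathDensity (fun _ => 1) θ.1 (g θ.2) n y ∂Pi,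
    hm.lintegral_prod_left' (μ := Pi.restrict (A' ∪ R')), ?_, ?_⟩
  · filter_upwards [hg.ae_ae_nonneg Pi n] with y hy
    calc _ ≤ ∫⁻ θ in A, pathDensity (fun _ => 1) θ.1 (g θ.2) n y ∂Pi := by
          refine lintegral_mono_ae (ae_restrict_of_ae (hy.mono fun θ h => ?_))
          have hμ := (statDist_isStationary θ.1).1
          rw [ofReal_obsDensity hμ.1 θ.1 h]
          exact pathDensity_mono (fun i => hμ.2 ▸
            Finset.single_le_sum (fun j _ => hμ.1 j) (Finset.mem_univ i)) _ _ _ _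
      _ ≤ _ := by
          refine lintegral_mono_set fun θ hθ => ?_
          rcases hA θ hθ with h | h
          · exact Or.inr (subset_toMeasurable Pi R h)
          · refine Or.inl ?_
            rw [hA', Set.mem_ofPred_eq, hg.setLIntegral_pathDensity θ hn hT]
            exact h
  · rw [lintegral_lintegral_swap (f := fun y (θ : Param k lam) =>
      pathDensity (fun _ => 1) θ.1 (g θ.2) n y) (hm.comp measurable_swap).aemeasurable]
    refine (lintegral_union_le _ _ _).trans (add_le_add ?_ ?_)
    · calc _ ≤ ∫⁻ _ in A', β ∂Pi := setLIntegral_mono' hA'm fun θ hθ => hθ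
        _ = β * Pi A' := by rw [setLIntegral_const]
        _ ≤ β * 1 := by gcongr; exact prob_le_one
        _ = β := mul_one β
    · calc _ ≤ ∫⁻ _ in R', (k : ℝ≥0∞) ∂Pi := lintegral_mono fun θ => by
            rw [hg.setLIntegral_pathDensity θ hn hT]
            exact mixLaw_one_le _ _ _ _
        _ = k * Pi R := by rw [setLIntegral_const, hR', measure_toMeasurable]

/-- The denominator of the posterior is rarely small. -/
theorem IsJointVersion.exists_denominator_bound (hg : IsJointVersion g) (Pi : Measure (Param k lam))
    [IsProbabilityMeasure Pi] {n : ℕ} (hn : n ≠ 0) (ps : (Fin n → Y) → ℝ≥0∞) (hps : Measurable ps)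
    [IsProbabilityMeasure ((Measure.pi fun _ => lam).withDensity ps)]
    {K₀ K : Set (Param k lam)} (hK₀ : MeasurableSet K₀) (hK : K ⊆ K₀) {a : ℝ} (ha : 0 ≤ a)
    (hstat : ∀ θ ∈ K₀, ∀ i, 0 ≤ statDist θ.1 i ∧ a ≤ statDist θ.1 i) {ρ : ℝ} (hρ : 0 < ρ)
    {η : ℝ≥0∞}
    (hη : ∀ θ ∈ K, ((Measure.pi fun _ => lam).withDensity ps)
      {y | ENNReal.ofReal ρ * pathDensity (fun _ => 1) θ.1 (fun j => ⇑(θ.2 j)) n y < ps y} ≤ η) :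
    ∃ Z : Set (Fin n → Y), MeasurableSet Z ∧
      ((Measure.pi fun _ => lam).withDensity ps) Z ≤ 2 * η ∧
      ∀ᵐ y ∂(Measure.pi fun _ => lam), y ∉ Z →
        ENNReal.ofReal (a / ρ) * (Pi K / 2) * ps y ≤
          ∫⁻ θ, ENNReal.ofReal (obsDensity (statDist θ.1) θ.1 (g θ.2) n y) ∂Pi := by
  set ν := (Measure.pi fun _ => lam).withDensity ps with hν
  have hm := hg.measurable_pathDensity n
  set bad : Set (Param k lam × (Fin n → Y)) :=
    {p | ENNReal.ofReal ρ * pathDensity (fun _ => 1) p.1.1 (g p.1.2) n p.2 < ps p.2} with hbad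
  have hbadm : MeasurableSet bad := measurableSet_lt (hm.const_mul _) (hps.comp measurable_snd)
  -- `K` need not be measurable either; `L` is a measurable set containing it on which the same
  -- bound `η` and the lower bound on `statDist` hold.
  set L := K₀ ∩ {θ | ν (Prod.mk θ ⁻¹' bad) ≤ η} with hL
  have hLm : MeasurableSet L := hK₀.inter
    (measurableSet_le (measurable_measure_prodMk_left hbadm) measurable_const)
  have hKL : K ⊆ L := by
    refine fun θ hθ => ⟨hK hθ, ?_⟩
    refine le_trans (le_of_eq (measure_congr ?_)) (hη θ hθ)
    have h1 := (withDensity_absolutelyContinuous (Measure.pi fun _ : Fin n => lam) ps).ae_le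
      (hg.pathDensity_ae_eq (fun _ => 1) θ n)
    filter_upwards [h1] with y hy
    simp only [hbad, Set.preimage, Set.mem_ofPred_eq]
    exact propext (by change _ * _ < _ ↔ _ * _ < _; rw [hy])
  set z : (Fin n → Y) → ℝ≥0∞ := fun y => Pi (L ∩ {θ | (θ, y) ∈ bad}) with hz
  have hzeq : z = fun y => (Pi.restrict L) ((fun θ => (θ, y)) ⁻¹' bad) := by
    ext y
    rw [Measure.restrict_apply (measurable_prodMk_right hbadm), Set.inter_comm]
    rfl
  have hzm : Measurable z := by
    rw [hzeq]
    exact measurable_measure_prodMk_right hbadm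
  have hzint : ∫⁻ y, z y ∂ν ≤ η * Pi L := by
    calc ∫⁻ y, z y ∂ν = ((Pi.restrict L).prod ν) bad := by
          rw [hzeq, Measure.prod_apply_symm hbadm]
      _ = ∫⁻ θ in L, ν (Prod.mk θ ⁻¹' bad) ∂Pi := Measure.prod_apply hbadm
      _ ≤ ∫⁻ _ in L, η ∂Pi := setLIntegral_mono' hLm fun θ hθ => hθ.2
      _ = η * Pi L := by rw [setLIntegral_const]
  rcases eq_or_ne (Pi L) 0 with hL0 | hL0
  · refine ⟨∅, MeasurableSet.empty, by simp, ae_of_all _ fun y _ => ?_⟩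
    rw [measure_mono_null hKL hL0]
    simp
  -- By Markov's inequality the bad parameters fill half of `L` with probability at most `2 * η`;
  -- otherwise the good half alone bounds the denominator from below.
  refine ⟨{y | Pi L / 2 ≤ z y}, measurableSet_le measurable_const hzm, ?_, ?_⟩
  · have h1 := mul_meas_ge_le_lintegral (μ := ν) hzm (Pi L / 2)
    have h2 : Pi L / 2 ≠ 0 := by simp [hL0]
    have h3 : Pi L / 2 ≠ ∞ := ENNReal.div_ne_top (measure_ne_top _ _) two_ne_zero
    have h4 : (Pi L / 2) * ν {y | Pi L / 2 ≤ z y} ≤ (Pi L / 2) * (2 * η) := by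
      refine (h1.trans hzint).trans (le_of_eq ?_)
      rw [← mul_assoc, ENNReal.div_mul_cancel two_ne_zero ENNReal.ofNat_ne_top, mul_comm]
    exact (ENNReal.mul_le_mul_iff_right h2 h3).1 h4
  · filter_upwards [hg.ae_ae_nonneg Pi n] with y hy hyZ
    have hyZ' : z y < Pi L / 2 := not_le.1 hyZ
    set G := L \ {θ | (θ, y) ∈ bad} with hG
    have hsec : MeasurableSet {θ | (θ, y) ∈ bad} := measurable_prodMk_right hbadm
    have hGm : MeasurableSet G := hLm.diff hsec
    have hGbig : Pi L / 2 ≤ Pi G := by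
      have h1 : Pi L = z y + Pi G := (measure_inter_add_sdiff L hsec).symm
      have h2 : Pi L / 2 + Pi L / 2 ≤ Pi L / 2 + Pi G := by
        rw [ENNReal.add_halves]
        exact h1.le.trans (by gcongr)
      exact (ENNReal.add_le_add_iff_left
        (ENNReal.div_ne_top (measure_ne_top _ _) two_ne_zero)).1 h2
    calc ENNReal.ofReal (a / ρ) * (Pi K / 2) * ps y
        ≤ ENNReal.ofReal (a / ρ) * Pi G * ps y := by
          gcongr
          exact le_trans (by gcongr) hGbig
      _ = ∫⁻ _ in G, ENNReal.ofReal (a / ρ) * ps y ∂Pi := by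
          rw [setLIntegral_const]; ring
      _ ≤ ∫⁻ θ in G, ENNReal.ofReal (obsDensity (statDist θ.1) θ.1 (g θ.2) n y) ∂Pi := by
          refine setLIntegral_mono_ae' hGm (hy.mono fun θ h hθ => ?_)
          have hs := hstat θ hθ.1.1
          rw [ofReal_obsDensity (fun i => (hs i).1) θ.1 h]
          refine le_trans ?_ (pathDensity_smul_le ha (fun i => (hs i).2) θ.1 (g θ.2) hn y)
          have h1 : ps y ≤ ENNReal.ofReal ρ * pathDensity (fun _ => 1) θ.1 (g θ.2) n y :=
            not_lt.1 hθ.2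
          calc _ ≤ ENNReal.ofReal (a / ρ) *
                (ENNReal.ofReal ρ * pathDensity (fun _ => 1) θ.1 (g θ.2) n y) := by gcongr
            _ = _ := by
                rw [← mul_assoc, ← ENNReal.ofReal_mul (by positivity), div_mul_cancel₀ _ hρ.ne']
      _ ≤ _ := setLIntegral_le_lintegral _ _

/-- A bound for the probability that the posterior mass of `A` exceeds `δ`. -/
theorem IsJointVersion.measure_posterior_ge_le [NeZero k] (hg : IsJointVersion g)
    (Pi : Measure (Param k lam)) [IsProbabilityMeasure Pi] {n : ℕ} (hn : n ≠ 0)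
    (ps : (Fin n → Y) → ℝ≥0∞) (hps : Measurable ps)
    [IsProbabilityMeasure ((Measure.pi fun _ => lam).withDensity ps)]
    {T : Set (Fin n → Y)} (hT : MeasurableSet T) {A R : Set (Param k lam)} {β : ℝ≥0∞}
    (hA : ∀ θ ∈ A, θ ∈ R ∨ mixLaw (emissionLaw θ.2) θ.1 (fun _ => 1) n T ≤ β)
    {K₀ K : Set (Param k lam)} (hK₀ : MeasurableSet K₀) (hK : K ⊆ K₀) (hKpos : Pi K ≠ 0)
    {a : ℝ} (ha : 0 < a)
    (hstat : ∀ θ ∈ K₀, ∀ i, 0 ≤ statDist θ.1 i ∧ a ≤ statDist θ.1 i) {ρ : ℝ} (hρ : 0 < ρ)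
    {η : ℝ≥0∞}
    (hη : ∀ θ ∈ K, ((Measure.pi fun _ => lam).withDensity ps)
      {y | ENNReal.ofReal ρ * pathDensity (fun _ => 1) θ.1 (fun j => ⇑(θ.2 j)) n y < ps y} ≤ η)
    {δ : ℝ} (hδ : 0 < δ) :
    ((Measure.pi fun _ => lam).withDensity ps) {y | δ ≤ (posterior Pi g y A).toReal} ≤
      ((Measure.pi fun _ => lam).withDensity ps) Tᶜ + 2 * η +
        (ENNReal.ofReal (δ * (a / ρ)) * (Pi K / 2))⁻¹ * (β + k * Pi R) := by
  set ν := (Measure.pi fun _ => lam).withDensity ps with hν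
  obtain ⟨N, hNm, hN, hNint⟩ := hg.exists_numerator_bound Pi hn hT hA
  obtain ⟨Z, hZm, hZ, hD⟩ := hg.exists_denominator_bound Pi hn ps hps hK₀ hK ha.le hstat hρ hη
  set c := ENNReal.ofReal (δ * (a / ρ)) * (Pi K / 2) with hc
  have hc0 : c ≠ 0 := mul_ne_zero (ENNReal.ofReal_pos.2 (by positivity)).ne' (by simp [hKpos])
  have hct : c ≠ ∞ := ENNReal.mul_ne_top ENNReal.ofReal_ne_top
    (ENNReal.div_ne_top (measure_ne_top _ _) two_ne_zero)
  -- Within `T` and outside `Z`, a posterior mass of at least `δ` forces `c * ps ≤ N`. Integrating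
  -- `ps ≤ c⁻¹ * N` over this set turns the true probability into an integral of the numerator.
  set U := {y | y ∈ T ∧ c * ps y ≤ N y} with hU
  have hUm : MeasurableSet U := hT.inter (measurableSet_le (hps.const_mul _) hNm)
  have hUle : ν U ≤ c⁻¹ * (β + k * Pi R) := by
    rw [hν, withDensity_apply _ hUm]
    calc _ ≤ ∫⁻ y in U, c⁻¹ * N y ∂(Measure.pi fun _ => lam) := by
          refine setLIntegral_mono' hUm fun y hy => ?_
          rw [mul_comm, ← div_eq_mul_inv, ENNReal.le_div_iff_mul_le (Or.inl hc0) (Or.inl hct),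
            mul_comm]
          exact hy.2
      _ ≤ ∫⁻ y in T, c⁻¹ * N y ∂(Measure.pi fun _ => lam) :=
          lintegral_mono_set fun y hy => hy.1
      _ = c⁻¹ * ∫⁻ y in T, N y ∂(Measure.pi fun _ => lam) := lintegral_const_mul _ hNm
      _ ≤ _ := by gcongr
  have hsub : ∀ᵐ y ∂ν, δ ≤ (posterior Pi g y A).toReal → y ∈ (Tᶜ ∪ Z) ∪ U := by
    have hac := withDensity_absolutelyContinuous (Measure.pi fun _ : Fin n => lam) ps
    filter_upwards [hac.ae_le hN, hac.ae_le hD] with y hNy hDy hpost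
    by_cases hyT : y ∈ T
    swap
    · exact Or.inl (Or.inl hyT)
    by_cases hyZ : y ∈ Z
    · exact Or.inl (Or.inr hyZ)
    refine Or.inr ⟨hyT, ?_⟩
    have h1 : ENNReal.ofReal δ ≤ posterior Pi g y A :=
      (ENNReal.ofReal_le_ofReal hpost).trans ENNReal.ofReal_toReal_le
    have h2 := ENNReal.mul_le_of_le_div h1
    calc c * ps y = ENNReal.ofReal δ * (ENNReal.ofReal (a / ρ) * (Pi K / 2) * ps y) := by
          rw [hc, ENNReal.ofReal_mul hδ.le]; ring
      _ ≤ _ := by gcongr; exact hDy hyZ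
      _ ≤ _ := h2
      _ ≤ N y := hNy
  calc _ ≤ ν ((Tᶜ ∪ Z) ∪ U) := measure_mono_ae hsub
    _ ≤ ν (Tᶜ ∪ Z) + ν U := measure_union_le _ _
    _ ≤ (ν Tᶜ + ν Z) + ν U := by gcongr; exact measure_union_le _ _
    _ ≤ _ := by gcongr

end Posterior

/-! ### Acceptance regions of tests -/

section Tests

variable {k : ℕ} {Y : Type*} [MeasurableSpace Y] {lam : Measure Y} [SigmaFinite lam]

/-- The bound of `stateLaw_windowSum_ge_le`. -/
noncomputable def testError (l n : ℕ) (q r s : ℝ) : ℝ :=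
  Real.exp (-r * ((n - l : ℕ) * s) + 4 * l * r / q + 8 * n * (l * r / q) ^ 2)

/-- A union bound over net points and their test functions controls the first error; for the second,
one function suited to `θ` is enough. The detected gap in mean is `d / 4`, and the threshold in its
middle leaves a deviation of `d / 8` on either side. Under the alternative the initial vector `1` is
used, hence the factor `k`. -/
theorem exists_acceptanceRegion [NeZero k] (θs : Param k lam) {qs : ℝ} (hqs : 0 < qs)
    (hqs1 : qs ≤ 1) (hQs : θs.1 ∈ TransMat.bounded k qs) (C : Finset (Fin k → Density lam))
    {δ : ℝ} {q : ℝ} (hq : 0 < q) (hq1 : q ≤ 1) {l : ℕ} (hl : l ≠ 0) {d : ℝ} (hd : 0 < d)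
    (hδ : 6 * l * δ ≤ d) (n : ℕ) {r r' : ℝ} (hr : 0 ≤ r) (hr' : 0 ≤ r') :
    ∃ T : Set (Fin n → Y), MeasurableSet T ∧
      mixLaw (emissionLaw θs.2) θs.1 (statDist θs.1) n Tᶜ
        ≤ ENNReal.ofReal (C.card * 5 ^ (k ^ l + 1) * testError l n qs r (d / 8)) ∧
      ∀ θ : Param k lam, θ.1 ∈ TransMat.bounded k q → (∃ c ∈ C, dist θ.2 c ≤ δ) →
        d ≤ marginalDist l θ θs → mixLaw (emissionLaw θ.2) θ.1 (fun _ => 1) n T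
          ≤ ENNReal.ofReal (k * testError l n q r' (d / 8)) := by
  choose H hHcard hH htest using fun c => exists_testFunctions_marginalDist θs c hl
  have hμs := statDist_isStationary θs.1
  set m : ((Fin l → Y) → ℝ) → ℝ := fun h =>
    ∫ y, h y ∂(mixLaw (emissionLaw θs.2) θs.1 (statDist θs.1) l) with hm
  set W : ((Fin l → Y) → ℝ) → Set (Fin n → Y) := fun h =>
    {y | (n - l : ℕ) * (m h + d / 8) ≤ windowSum h n y} with hW
  have hWm : ∀ c, ∀ h ∈ H c, MeasurableSet (W h) := fun c h hh =>
    measurableSet_le measurable_const (measurable_windowSum (hH c h hh).1 n)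
  have hUm : MeasurableSet (⋃ c ∈ C, ⋃ h ∈ H c, W h) :=
    Finset.measurableSet_biUnion _ fun c _ => Finset.measurableSet_biUnion _ fun h hh => hWm c h hh
  refine ⟨(⋃ c ∈ C, ⋃ h ∈ H c, W h)ᶜ, hUm.compl, ?_, ?_⟩
  · rw [compl_compl]
    have h1 : ∀ c, ∀ h ∈ H c, mixLaw (emissionLaw θs.2) θs.1 (statDist θs.1) n (W h) ≤
        ENNReal.ofReal (testError l n qs r (d / 8)) := by
      intro c h hh
      simp only [mixLaw, Measure.finsetSum_apply, Measure.smul_apply, smul_eq_mul]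
      calc _ ≤ ∑ i, ENNReal.ofReal (statDist θs.1 i) *
            ENNReal.ofReal (testError l n qs r (d / 8)) := by
            refine Finset.sum_le_sum fun i _ => ?_
            gcongr
            rw [← ofReal_measureReal]
            exact ENNReal.ofReal_le_ofReal (stateLaw_windowSum_ge_le hqs hqs1 hQs hμs
              (hH c h hh).1 (hH c h hh).2 n i hr (d / 8))
        _ = _ := by
            rw [← Finset.sum_mul, ← ENNReal.ofReal_sum_of_nonneg fun i _ => hμs.1.1 i, hμs.1.2,
              ENNReal.ofReal_one, one_mul]
    calc _ ≤ ∑ c ∈ C, ∑ h ∈ H c, mixLaw (emissionLaw θs.2) θs.1 (statDist θs.1) n (W h) :=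
          (measure_biUnion_finset_le _ _).trans
            (Finset.sum_le_sum fun c _ => measure_biUnion_finset_le _ _)
      _ ≤ ∑ c ∈ C, ∑ h ∈ H c, ENNReal.ofReal (testError l n qs r (d / 8)) :=
          Finset.sum_le_sum fun c _ => Finset.sum_le_sum fun h hh => h1 c h hh
      _ = ∑ c ∈ C, ((H c).card : ℝ≥0∞) * ENNReal.ofReal (testError l n qs r (d / 8)) := by simp
      _ ≤ ∑ c ∈ C, (5 ^ (k ^ l + 1) : ℕ) * ENNReal.ofReal (testError l n qs r (d / 8)) := by
          gcongr with c
          exact hHcard c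
      _ = _ := by
          rw [Finset.sum_const, nsmul_eq_mul, ← mul_assoc, ENNReal.ofReal_mul (by positivity),
            ENNReal.ofReal_mul (by positivity), ENNReal.ofReal_natCast]
          congr 2
          rw [← ENNReal.ofReal_natCast]
          push_cast
          rfl
  · rintro θ hθ ⟨c, hcC, hc⟩ hdθ
    have hl0 : (0 : ℝ) ≤ l := Nat.cast_nonneg l
    obtain ⟨h, hh, hle⟩ := htest c θ (by
      refine le_trans ?_ (hδ.trans hdθ)
      gcongr) (hd.trans_le hdθ)
    have hμ := statDist_isStationary θ.1
    set p := ∫ y, h y ∂(mixLaw (emissionLaw θ.2) θ.1 (statDist θ.1) l) with hp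
    have hsub : (⋃ c ∈ C, ⋃ h ∈ H c, W h)ᶜ ⊆ {y | (n - l : ℕ) *
        (∫ y, -h y ∂(mixLaw (emissionLaw θ.2) θ.1 (statDist θ.1) l) + d / 8) ≤
          windowSum (fun y => -h y) n y} := by
      intro y hy
      have h1 : y ∉ W h := fun hyW => hy (Set.mem_biUnion hcC (Set.mem_biUnion hh hyW))
      have h2 : windowSum h n y < (n - l : ℕ) * (m h + d / 8) := not_le.1 h1
      have h3 : ((n - l : ℕ) : ℝ) * (m h + d / 8) ≤ (n - l : ℕ) * (p - d / 8) := by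
        refine mul_le_mul_of_nonneg_left ?_ (Nat.cast_nonneg _)
        linarith
      rw [Set.mem_ofPred_eq, windowSum_neg, integral_neg]
      linarith
    refine (measure_mono hsub).trans ?_
    simp only [mixLaw, Measure.finsetSum_apply, Measure.smul_apply, smul_eq_mul,
      ENNReal.ofReal_one, one_mul]
    calc _ ≤ ∑ _ : Fin k, ENNReal.ofReal (testError l n q r' (d / 8)) := by
          refine Finset.sum_le_sum fun i _ => ?_
          rw [← ofReal_measureReal]
          exact ENNReal.ofReal_le_ofReal (stateLaw_windowSum_ge_le hq hq1 hθ hμ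
            (hH c h hh).1.neg (fun y => (abs_neg (h y)).trans_le ((hH c h hh).2 y)) n i hr' (d / 8))
      _ = _ := by
          rw [Finset.sum_const, Finset.card_univ, Fintype.card_fin, nsmul_eq_mul,
            ENNReal.ofReal_mul (Nat.cast_nonneg k), ENNReal.ofReal_natCast]

theorem exists_finset_of_externalCoveringNumber_le {E : Type*} [PseudoMetricSpace E] {A : Set E}
    {ε : ℝ} (hε : 0 ≤ ε) {R : ℝ} (hR : 0 ≤ R)
    (h : ((Metric.externalCoveringNumber ε.toNNReal A : ℕ∞) : ℝ≥0∞) ≤ ENNReal.ofReal R) :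
    ∃ C : Finset E, (C.card : ℝ) ≤ R ∧ ∀ a ∈ A, ∃ c ∈ C, dist a c ≤ ε := by
  have hne : Metric.externalCoveringNumber ε.toNNReal A ≠ ⊤ := by
    intro htop
    rw [htop] at h
    exact ENNReal.ofReal_ne_top (top_le_iff.1 h)
  obtain ⟨m, hm⟩ := ENat.ne_top_iff_exists.1 hne
  have hlt : Metric.externalCoveringNumber ε.toNNReal A < (m + 1 : ℕ) := by
    rw [← hm]
    exact_mod_cast Nat.lt_succ_self m
  rw [Metric.externalCoveringNumber] at hlt
  simp only [iInf_lt_iff] at hlt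
  obtain ⟨C, hC, hCm⟩ := hlt
  have hfin : C.Finite := Set.finite_of_encard_le_coe hCm.le
  refine ⟨hfin.toFinset, ?_, fun a ha => ?_⟩
  · rw [hfin.encard_eq_coe_toFinset_card] at hCm
    have h1 : hfin.toFinset.card ≤ m := Nat.lt_succ_iff.1 (by exact_mod_cast hCm)
    rw [← hm] at h
    have h2 : (m : ℝ) ≤ R := by
      rw [← ENNReal.ofReal_le_ofReal_iff hR, ENNReal.ofReal_natCast]
      simpa using h
    exact le_trans (by exact_mod_cast h1) h2
  · obtain ⟨c, hc, hac⟩ := hC ha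
    refine ⟨c, hfin.mem_toFinset.2 hc, ?_⟩
    have h1 : edist a c ≤ (ε.toNNReal : ℝ≥0∞) := hac
    rw [edist_dist] at h1
    exact (ENNReal.ofReal_le_ofReal_iff hε).1 h1

end Tests

/-! ### The law of the observations of a hidden Markov chain -/

section Law

variable {k : ℕ} {Y : Type*} [MeasurableSpace Y] {lam : Measure Y} [SigmaFinite lam]

theorem IsHMM.map_eq {Ω : Type*} [MeasurableSpace Ω] {P : Measure Ω} {X : ℕ → Ω → Fin k}
    {Z : ℕ → Ω → Y} {μ : Fin k → ℝ} {θ : Param k lam} (h : IsHMM P X Z μ θ) (hμ : ∀ i, 0 ≤ μ i)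
    (n : ℕ) :
    P.map (fun ω (t : Fin n) => Z t ω) =
      (Measure.pi fun _ => lam).withDensity (pathDensity μ θ.1 (fun j => ⇑(θ.2 j)) n) := by
  have hZ : Measurable fun ω (t : Fin n) => Z t ω := measurable_pi_iff.2 fun t => h.measurable_obs t
  ext B hB
  rw [Measure.map_apply hZ hB, withDensity_apply _ hB, ← lintegral_indicator hB]
  have h1 := h.law n (Set.univ ×ˢ B) (MeasurableSet.univ.prod hB)
  have h2 : {ω | (fun t : Fin n => X t ω, fun t : Fin n => Z t ω) ∈ Set.univ ×ˢ B} =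
      (fun ω (t : Fin n) => Z t ω) ⁻¹' B := by
    ext ω
    simp
  rw [h2] at h1
  rw [h1]
  refine lintegral_congr_ae ?_
  filter_upwards [ae_pi_density_nonneg θ.2 n] with y hy
  by_cases hyB : y ∈ B
  · rw [Set.indicator_of_mem hyB, pathDensity]
    refine Finset.sum_congr rfl fun x _ => ?_
    rw [Set.indicator_of_mem (by simp [hyB]), ENNReal.ofReal_mul (pathProb_nonneg hμ _ _ _),
      ENNReal.ofReal_prod_of_nonneg fun t _ => hy _ _]
  · rw [Set.indicator_of_notMem hyB]
    exact Finset.sum_eq_zero fun x _ => Set.indicator_of_notMem (by simp [hyB]) _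

end Law

/-! ### Rates -/

/-- The tilt `q * ε` makes the quadratic term `8 * n * (l * ε) ^ 2`, whatever `q` is, while the
linear gain is at least `κ * M / 16 * (n * ε ^ 2)`, because `n - l ≥ n / 2`. Here `q` bounds the
chain under test and `q'` scales the separation. -/
theorem testError_le {l n : ℕ} {q q' ε M κ : ℝ} (hq : 0 < q) (hq' : 0 < q')
    (hM : 0 ≤ M) (hκ : κ * q' ≤ q) (hn : 2 * l ≤ n) :
    testError l n q (q * ε) (M * (ε / q') / 8) ≤
      Real.exp (-(κ * M / 16 - 8 * l ^ 2) * (n * ε ^ 2) + 4 * l * ε) := by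
  rw [testError, Real.exp_le_exp]
  have h1 : ((n - l : ℕ) : ℝ) ≥ n / 2 := by
    rw [Nat.cast_sub (by omega)]
    have : (2 * l : ℝ) ≤ n := by exact_mod_cast hn
    linarith
  have h2 : 4 * l * (q * ε) / q = 4 * l * ε := by field_simp
  have h3 : l * (q * ε) / q = l * ε := by field_simp
  rw [h2, h3]
  have h4 : κ ≤ q / q' := (le_div_iff₀ hq').2 hκ
  have h0 : 0 ≤ q / q' := by positivity
  have h5 : κ * M / 16 * (n * ε ^ 2) ≤ q * ε * ((n - l : ℕ) * (M * (ε / q') / 8)) := by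
    calc κ * M / 16 * (n * ε ^ 2) = κ * (M * ε ^ 2 / 8 * (n / 2)) := by ring
      _ ≤ q / q' * (M * ε ^ 2 / 8 * (n / 2)) := by gcongr
      _ ≤ q / q' * (M * ε ^ 2 / 8 * (n - l : ℕ)) := by gcongr
      _ = _ := by ring
  nlinarith [h5]

theorem le_constK {k : ℕ} (hk : 1 ≤ k) {qs : ℝ} (hqs : 0 < qs) (hqs1 : qs ≤ 1) :
    2 * k / qs + 6 ≤ constK k qs := by
  have hk' : (1 : ℝ) ≤ k := by exact_mod_cast hk
  have h1 : 1 ≤ (k : ℝ) / qs := (one_le_div hqs).2 (hqs1.trans hk')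
  have h2 : 0 ≤ Real.log (2 * k / qs) := Real.log_nonneg (by rw [mul_div_assoc]; linarith)
  have h3 : (k : ℝ) / qs ≤ k ^ 2 / qs ^ 5 := by
    have h5 : qs ^ 5 ≤ qs := pow_le_of_le_one hqs.le hqs1 (by norm_num)
    have h6 : (k : ℝ) ≤ k ^ 2 := le_self_pow₀ hk' two_ne_zero
    gcongr
  rw [constK, mul_div_assoc, mul_div_assoc]
  rw [mul_div_assoc] at h2
  nlinarith

/-- Of the two forms of `uSeq` only this bound matters below: the tolerances `e ^ 2 / u` and `e /
√u` are then at most `e ^ 2` and `e`. -/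
theorem one_le_uSeq (et : ℕ → ℝ) : ∀ᶠ n in atTop, 1 ≤ uSeq et n := by
  have h : ∀ᶠ n : ℕ in atTop, 1 ≤ Real.log n :=
    (Real.tendsto_log_atTop.comp tendsto_natCast_atTop_atTop).eventually_ge_atTop 1
  filter_upwards [h] with n hn
  rw [uSeq]
  split_ifs
  · exact le_rfl
  · exact Real.one_le_rpow hn (by norm_num)

theorem TransMat.le_one_of_mem_bounded {k : ℕ} (hk : 1 ≤ k) {Q : TransMat k} {q : ℝ}
    (hQ : Q ∈ TransMat.bounded k q) : q ≤ 1 := by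
  let i : Fin k := ⟨0, hk⟩
  refine (hQ i i).trans ?_
  rw [← (Q.2 i).2]
  exact Finset.single_le_sum (f := Q.1 i) (fun j _ => (Q.2 i).1 j) (Finset.mem_univ i)

theorem TransMat.bounded_of_norm_sub_le {k : ℕ} {Q Qs : TransMat k} {qs e : ℝ}
    (hQs : Qs ∈ TransMat.bounded k qs) (h : ‖Q.1 - Qs.1‖ ≤ e) (he : e ≤ qs / 2) :
    Q ∈ TransMat.bounded k (qs / 2) := by
  intro i j
  have h1 : |Q.1 i j - Qs.1 i j| ≤ e :=
    (norm_le_pi_norm ((Q.1 - Qs.1) i) j).trans ((norm_le_pi_norm (Q.1 - Qs.1) i).trans h)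
  have h2 := hQs i j
  linarith [(abs_le.1 h1).1]

/-- As both rows sum to one, the sum equals `1 + ∑ (Q - Q*)² / Q`, so the excess is quadratic in the
distance. -/
theorem TransMat.sum_sq_div_le {k : ℕ} {Q Qs : TransMat k} {q e : ℝ} (hq : 0 < q)
    (hQ : Q ∈ TransMat.bounded k q) (h : ‖Q.1 - Qs.1‖ ≤ e) (i : Fin k) :
    ∑ j, Qs.1 i j ^ 2 / Q.1 i j ≤ 1 + k / q * e ^ 2 := by
  have hpos : ∀ j, 0 < Q.1 i j := fun j => hq.trans_le (hQ i j)
  have h1 : ∀ j, Qs.1 i j ^ 2 / Q.1 i j =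
      (Q.1 i j - Qs.1 i j) ^ 2 / Q.1 i j + (2 * Qs.1 i j - Q.1 i j) := by
    intro j
    have := (hpos j).ne'
    field_simp
    ring
  have h2 : ∀ j, (Q.1 i j - Qs.1 i j) ^ 2 / Q.1 i j ≤ e ^ 2 / q := by
    intro j
    have h3 : |Q.1 i j - Qs.1 i j| ≤ e :=
      (norm_le_pi_norm ((Q.1 - Qs.1) i) j).trans ((norm_le_pi_norm (Q.1 - Qs.1) i).trans h)
    have h4 : (Q.1 i j - Qs.1 i j) ^ 2 ≤ e ^ 2 := sq_le_sq' (abs_le.1 h3).1 (abs_le.1 h3).2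
    have := hQ i j
    gcongr
  rw [Finset.sum_congr rfl fun j _ => h1 j, Finset.sum_add_distrib, Finset.sum_sub_distrib,
    ← Finset.mul_sum, (Q.2 i).2, (Qs.2 i).2]
  have h5 := Finset.sum_le_sum fun j (_ : j ∈ Finset.univ) => h2 j
  simp only [Finset.sum_const, Finset.card_univ, Fintype.card_fin, nsmul_eq_mul] at h5
  have h6 : (k : ℝ) * (e ^ 2 / q) = k / q * e ^ 2 := by ring
  linarith

/-! ### Explicit bounds at a fixed sample size and the passage to the limit. -/

section Rates

variable {k : ℕ} {Y : Type*} [MeasurableSpace Y] {lam : Measure Y} [SigmaFinite lam]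

theorem EmissionClose.withDensity_pathDensity_lt_le {fs f : Fin k → Density lam} {e u : ℝ}
    (hu : 1 ≤ u) (he : 0 < e) (h : EmissionClose fs f e u) {Q Qs : TransMat k} {q : ℝ} (hq : 0 < q)
    (hQ : Q ∈ TransMat.bounded k q) (hQs : ‖Q.1 - Qs.1‖ ≤ e) {μ : Fin k → ℝ}
    (hμ : μ ∈ stdSimplex ℝ (Fin k)) {n : ℕ} (hn : n ≠ 0) :
    (Measure.pi fun _ => lam).withDensity (pathDensity μ Qs (fun j => ⇑(fs j)) n)
        {y | ENNReal.ofReal (2 * Real.exp ((k / q + 6) * (n * e ^ 2))) *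
          pathDensity (fun _ => 1) Q (fun j => ⇑(f j)) n y <
            pathDensity μ Qs (fun j => ⇑(fs j)) n y}
      ≤ 2 * (ENNReal.ofReal (Real.exp (-(n * e ^ 2))) + ENNReal.ofReal (n * e ^ 2)⁻¹) := by
  have hn' : (0 : ℝ) < n := by positivity
  have hE : 0 < n * e ^ 2 := by positivity
  have hkq : 0 ≤ k / q * e ^ 2 := by positivity
  have hm := h.moments hu
  -- With `s = n * e ^ 2` the emissions cost the exponent `4 + 1`. The transitions cost `k / q + 1`:
  -- since `(1 + k / q * e ^ 2) ^ n ≤ exp (k / q * (n * e ^ 2))`, the extra 1 makes the mass of bad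
  -- paths at most `exp (-(n * e ^ 2))`.
  have key := BayesHMM.withDensity_pathDensity_lt_le (fun i => (hm i).1) (fun i => (hm i).2.1)
    (fun i => (hm i).2.2.1) (fun i => (hm i).2.2.2) (fun i j => hq.trans_le (hQ i j))
    (by linarith : 1 ≤ 1 + k / q * e ^ 2) (TransMat.sum_sq_div_le hq hQ hQs) hμ hn
    (Real.exp_pos ((k / q + 1) * (n * e ^ 2))) hE
  have h1 : Real.exp ((k / q + 1) * (n * e ^ 2)) * Real.exp (n * (4 * e ^ 2) + n * e ^ 2) =
      Real.exp ((k / q + 6) * (n * e ^ 2)) := by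
    rw [← Real.exp_add]
    congr 1
    ring
  rw [h1] at key
  refine key.trans ?_
  gcongr
  · rw [div_le_iff₀ (Real.exp_pos _), ← Real.exp_add]
    calc (1 + k / q * e ^ 2) ^ n ≤ Real.exp (k / q * e ^ 2) ^ n := by
          gcongr
          linarith [Real.add_one_le_exp (k / q * e ^ 2)]
      _ = _ := by
          rw [← Real.exp_nat_mul]
          congr 1
          ring
  · refine le_of_eq ?_
    field_simp

/-- A bound at a fixed sample size for the probability that the posterior charges the complement
of a neighbourhood of the true parameter. -/
theorem measure_posterior_ge_le_of_sieve [NeZero k] {g : (Fin k → Density lam) → Fin k → Y → ℝ}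
    (hg : IsJointVersion g) (PiQ : Measure (TransMat k)) [IsProbabilityMeasure PiQ]
    (Pif : Measure (Fin k → Density lam)) [IsProbabilityMeasure Pif] (θs : Param k lam) {qs : ℝ}
    (hqs : 0 < qs) (hQs : θs.1 ∈ TransMat.bounded k qs) {n : ℕ} (hn : n ≠ 0)
    {l : ℕ} (hl : l ≠ 0) (hnl : 2 * l ≤ n) {e ε u : ℝ} (he : 0 < e) (heε : e ≤ ε) (hu : 1 ≤ u)
    (heq : e ≤ qs / 2) {B F : Set (Fin k → Density lam)} (hB : ∀ f ∈ B, EmissionClose θs.2 f e u)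
    {N : ℝ} (hN : 0 ≤ N)
    (hF : ((Metric.externalCoveringNumber (ε / 12).toNNReal F : ℕ∞) : ℝ≥0∞) ≤ ENNReal.ofReal N)
    {q : ℝ} (hq : 0 < q) (hq1 : q ≤ 1) {M D : ℝ} (hMl : l ≤ M)
    (hM : D + 8 * l ^ 2 ≤ qs * M / 16) {b : ℝ} (hb : 0 < b)
    (hprior : b ≤ PiQ.real {Q | ‖Q.1 - θs.1.1‖ ≤ e / √u} * Pif.real B) {δ : ℝ} (hδ : 0 < δ) :
    (Measure.pi fun _ => lam).withDensity
        (pathDensity (statDist θs.1) θs.1 (fun j => ⇑(θs.2 j)) n)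
        {y | δ ≤ (posterior (PiQ.prod Pif) g y {θ | M * (ε / q) ≤ marginalDist l θ θs}).toReal} ≤
      ENNReal.ofReal (N * 5 ^ (k ^ l + 1) * Real.exp (-D * (n * ε ^ 2) + 4 * l * ε) +
        4 * (Real.exp (-(n * e ^ 2)) + (n * e ^ 2)⁻¹) +
        8 / (δ * qs) * (Real.exp ((2 * k / qs + 6) * (n * e ^ 2)) / b) *
          (k * Real.exp (-D * (n * ε ^ 2) + 4 * l * ε) +
            k * (PiQ.real (TransMat.bounded k q)ᶜ + Pif.real Fᶜ))) := by
  have hε : 0 < ε := he.trans_le heε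
  have hk : 1 ≤ k := NeZero.one_le
  have hqs1 := TransMat.le_one_of_mem_bounded hk hQs
  have hl' : (1 : ℝ) ≤ l := by exact_mod_cast Nat.one_le_iff_ne_zero.2 hl
  have hM0 : 0 < M := by linarith
  have hμs := statDist_isStationary θs.1
  have hlaw := mixLaw_emissionLaw hμs.1.1 θs.1 θs.2 hn
  have hprob : IsProbabilityMeasure ((Measure.pi fun _ => lam).withDensity
      (pathDensity (statDist θs.1) θs.1 (fun j => ⇑(θs.2 j)) n)) := by
    rw [← hlaw]
    exact isProbabilityMeasure_mixLaw _ _ hμs.1 n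
  obtain ⟨C, hCcard, hC⟩ := exists_finset_of_externalCoveringNumber_le (by positivity) hN hF
  have hd : 0 < M * (ε / q) := by positivity
  -- This is where `l ≤ M` is needed: the covering radius must be small relative to the separation
  -- `M * (ε / q)`.
  have hδd : 6 * l * (ε / 12) ≤ M * (ε / q) := by
    have h1 : ε ≤ ε / q := le_div_self hε.le hq hq1
    calc 6 * l * (ε / 12) = l * (ε / 2) := by ring
      _ ≤ M * (ε / q) := by gcongr; linarith
  obtain ⟨T, hT, hT1, hT2⟩ := exists_acceptanceRegion θs hqs hqs1 hQs C hq hq1 hl hd hδd n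
    (mul_nonneg hqs.le hε.le) (mul_nonneg hq.le hε.le)
  -- One estimate serves both errors: `q' = qs` under the true parameter and `q' = q` under the
  -- alternatives are each at least `qs * q`.
  have herr : ∀ q', qs * q ≤ q' → 0 < q' → testError l n q' (q' * ε) (M * (ε / q) / 8) ≤
      Real.exp (-D * (n * ε ^ 2) + 4 * l * ε) := fun q' h1 h2 => by
    refine (testError_le h2 hq hM0.le h1 hnl).trans (Real.exp_le_exp.2 ?_)
    gcongr
    linarith
  have herr1 := herr qs (mul_le_of_le_one_right hqs.le hq1) hqs
  have herr2 := herr q (mul_le_of_le_one_left hq.le hqs1) hq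
  set KQ : Set (TransMat k) := {Q | ‖Q.1 - θs.1.1‖ ≤ e / √u} with hKQ
  have hsu : 1 ≤ √u := Real.one_le_sqrt.2 hu
  have hKQe : ∀ Q ∈ KQ, ‖Q.1 - θs.1.1‖ ≤ e := fun Q hQ => hQ.trans (div_le_self he.le hsu)
  have hKQb : ∀ Q ∈ KQ, Q ∈ TransMat.bounded k (qs / 2) := fun Q hQ =>
    TransMat.bounded_of_norm_sub_le hQs (hKQe Q hQ) heq
  have hKQm : MeasurableSet KQ :=
    measurableSet_le (measurable_subtype_coe.sub_const _).norm measurable_const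
  have hPiK : ENNReal.ofReal b ≤ (PiQ.prod Pif) (KQ ×ˢ B) := by
    rw [Measure.prod_prod, ← ofReal_measureReal (μ := PiQ), ← ofReal_measureReal (μ := Pif),
      ← ENNReal.ofReal_mul measureReal_nonneg]
    exact ENNReal.ofReal_le_ofReal hprior
  set R : Set (Param k lam) := (TransMat.bounded k q)ᶜ ×ˢ Set.univ ∪ Set.univ ×ˢ Fᶜ with hR
  have hPiR : (PiQ.prod Pif) R ≤
      ENNReal.ofReal (PiQ.real (TransMat.bounded k q)ᶜ + Pif.real Fᶜ) := by
    refine (measure_union_le _ _).trans ?_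
    rw [Measure.prod_prod, Measure.prod_prod, measure_univ, measure_univ, mul_one, one_mul,
      ENNReal.ofReal_add measureReal_nonneg measureReal_nonneg, ofReal_measureReal,
      ofReal_measureReal]
  have hA : ∀ θ ∈ {θ | M * (ε / q) ≤ marginalDist l θ θs}, θ ∈ R ∨
      mixLaw (emissionLaw θ.2) θ.1 (fun _ => 1) n T ≤
        ENNReal.ofReal (k * Real.exp (-D * (n * ε ^ 2) + 4 * l * ε)) := by
    intro θ hθ
    by_cases h1 : θ.1 ∈ TransMat.bounded k q
    · by_cases h2 : θ.2 ∈ F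
      · refine Or.inr ((hT2 θ h1 (hC _ h2) hθ).trans ?_)
        gcongr
      · exact Or.inl (Or.inr ⟨trivial, h2⟩)
    · exact Or.inl (Or.inl ⟨h1, trivial⟩)
  have hkq : (k : ℝ) / (qs / 2) = 2 * k / qs := by
    field_simp
  have key := hg.measure_posterior_ge_le (PiQ.prod Pif) hn _
    (measurable_pathDensity (fun i => (θs.2 i).measurable) n) hT hA
    (hKQm.prod MeasurableSet.univ) (Set.prod_mono_right (Set.subset_univ B))
    ((ENNReal.ofReal_pos.2 hb).trans_le hPiK).ne' (half_pos hqs)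
    (fun θ hθ i => ⟨(statDist_isStationary θ.1).1.1 i,
      (statDist_isStationary θ.1).le_apply (hKQb _ hθ.1) i⟩)
    (by positivity : 0 < 2 * Real.exp ((k / (qs / 2) + 6) * (n * e ^ 2)))
    (fun θ hθ => (hB _ hθ.2).withDensity_pathDensity_lt_le hu he (half_pos hqs) (hKQb _ hθ.1)
      (hKQe _ hθ.1) hμs.1 hn) hδ
  refine key.trans ?_
  have hEinv : 0 ≤ (n * e ^ 2)⁻¹ := by positivity
  rw [ENNReal.ofReal_add (by positivity) (by positivity),
    ENNReal.ofReal_add (by positivity) (by positivity)]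
  refine add_le_add (add_le_add ?_ ?_) ?_
  · rw [← hlaw]
    refine hT1.trans (ENNReal.ofReal_le_ofReal ?_)
    have h0 : 0 ≤ testError l n qs (qs * ε) (M * (ε / q) / 8) := (Real.exp_pos _).le
    gcongr
  · rw [ENNReal.ofReal_mul (by norm_num), ENNReal.ofReal_add (Real.exp_pos _).le hEinv, ← mul_assoc]
    norm_num
  · rw [hkq]
    set E := Real.exp ((2 * k / qs + 6) * (n * e ^ 2)) with hE
    have hE0 : 0 < E := Real.exp_pos _
    have h1 : ENNReal.ofReal (δ * qs * b / (8 * E)) ≤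
        ENNReal.ofReal (δ * (qs / 2 / (2 * E))) * ((PiQ.prod Pif) (KQ ×ˢ B) / 2) := by
      calc ENNReal.ofReal (δ * qs * b / (8 * E)) =
            ENNReal.ofReal (δ * (qs / 2 / (2 * E))) * (ENNReal.ofReal b / 2) := by
            rw [← ENNReal.ofReal_ofNat 2, ← ENNReal.ofReal_div_of_pos two_pos,
              ← ENNReal.ofReal_mul (by positivity)]
            congr 1
            field_simp
            ring
        _ ≤ _ := by gcongr
    calc _ ≤ (ENNReal.ofReal (δ * qs * b / (8 * E)))⁻¹ *
          (ENNReal.ofReal (k * Real.exp (-D * (n * ε ^ 2) + 4 * l * ε)) +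
            k * ENNReal.ofReal (PiQ.real (TransMat.bounded k q)ᶜ + Pif.real Fᶜ)) := by
          gcongr
      _ = _ := by
          rw [← ENNReal.ofReal_natCast, ← ENNReal.ofReal_inv_of_pos (by positivity),
            ← ENNReal.ofReal_mul (by positivity), ← ENNReal.ofReal_add (by positivity)
            (by positivity), ← ENNReal.ofReal_mul (by positivity)]
          congr 1
          field_simp

/-- Posterior concentration for observations in a general space. -/
theorem exists_tendstoInMeasure_posterior [NeZero k] (PiQ : Measure (TransMat k))
    [IsProbabilityMeasure PiQ] (Pif : Measure (Fin k → Density lam)) [IsProbabilityMeasure Pif]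
    {g : (Fin k → Density lam) → Fin k → Y → ℝ} (hg : IsJointVersion g)
    (Qs : TransMat k) (fs : Fin k → Density lam) {qs : ℝ} (hqs : 0 < qs)
    (hQs : Qs ∈ TransMat.bounded k qs)
    {Ω : Type*} [MeasurableSpace Ω] {P : Measure Ω} [IsProbabilityMeasure P]
    {X : ℕ → Ω → Fin k} {Z : ℕ → Ω → Y} (hXZ : IsHMM P X Z (statDist Qs) (Qs, fs))
    {eps et : ℕ → ℝ} (het_pos : ∀ n, 0 < et n) (het_le : ∀ n, et n ≤ eps n)
    (heps : Tendsto eps atTop (𝓝 0)) (het : Tendsto et atTop (𝓝 0))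
    (het_large : Tendsto (fun n : ℕ => n * et n ^ 2) atTop atTop)
    {Cf C C' CQ : ℝ} (hC : 0 < C) (hC' : 0 < C') (hA : AssumptionA Pif fs et Cf)
    (hB : AssumptionB Pif eps et C C') (hconst : CQ + Cf + constK k qs < C)
    (hQ : AssumptionC PiQ Qs et CQ) {q : ℕ → ℝ} (hD : AssumptionD PiQ et q C)
    {l : ℕ} (hl : 1 ≤ l) :
    ∃ M : ℝ, 0 < M ∧
      TendstoInMeasure P
        (fun (n : ℕ) (ω : Ω) =>
          (posterior (PiQ.prod Pif) g (fun t : Fin n => Z t ω)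
            {θ | M * (eps n / q n) ≤ marginalDist l θ (Qs, fs)}).toReal)
        atTop (fun _ => 0) := by
  have hk : 1 ≤ k := NeZero.one_le
  have hk' : (1 : ℝ) ≤ k := by exact_mod_cast hk
  have hqs1 := TransMat.le_one_of_mem_bounded hk hQs
  have hl' : (1 : ℝ) ≤ l := by exact_mod_cast hl
  obtain ⟨B, hBO, hBclose⟩ := hA
  obtain ⟨F, hFo, K, hK⟩ := hB
  obtain ⟨hq, hqo⟩ := hD
  obtain ⟨cf, hcf, hcfb⟩ := hBO.exists_pos
  obtain ⟨cq, hcq, hcqb⟩ := hQ.exists_pos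
  -- In `D`, the summand `C'` absorbs the covering number, `C` the inverse of the denominator, and 1
  -- is left for decay. In `M`, the first summand gives the exponent `D` after the loss `8 * l ^ 2`;
  -- the summand `l` ensures `l ≤ M`.
  set D : ℝ := C' + C + 1 with hDdef
  set M : ℝ := 16 * (D + 8 * l ^ 2) / qs + l with hMdef
  have hD0 : 0 < D := by positivity
  have hMl : l ≤ M := le_add_of_nonneg_left (by positivity)
  have hM : D + 8 * l ^ 2 ≤ qs * M / 16 := by
    have : qs * M / 16 = D + 8 * l ^ 2 + qs * l / 16 := by
      rw [hMdef]
      field_simp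
    rw [this]
    exact le_add_of_nonneg_right (by positivity)
  refine ⟨M, by linarith, ?_⟩
  rw [tendstoInMeasure_iff_norm]
  intro δ hδ
  have hE := het_large
  have hG : Tendsto (fun n : ℕ => n * eps n ^ 2) atTop atTop := by
    refine tendsto_atTop_mono (fun n => ?_) het_large
    have := het_pos n
    have := het_le n
    gcongr
  have hexpE := Real.tendsto_exp_neg_atTop_nhds_zero.comp hE
  have hexpG := Real.tendsto_exp_neg_atTop_nhds_zero.comp hG
  have hexpl : Tendsto (fun n => Real.exp (4 * l * eps n)) atTop (𝓝 1) := by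
    have h1 := (Real.continuous_exp.tendsto (4 * l * 0)).comp (heps.const_mul (4 * (l : ℝ)))
    simpa [Function.comp_def] using h1
  have hprod := hexpG.mul hexpl
  have hbnd := ((hprod.const_mul (|K| * 5 ^ (k ^ l + 1))).add
    ((hexpE.add hE.inv_tendsto_atTop).const_mul 4)).add
    (((hprod.add (hqo.tendsto_div_nhds_zero.add hFo.tendsto_div_nhds_zero)).const_mul
      (8 / (δ * qs) * (cq * cf) * k)))
  simp only [mul_one, mul_zero, add_zero] at hbnd
  have hbnd' := ENNReal.tendsto_ofReal hbnd
  rw [ENNReal.ofReal_zero] at hbnd'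
  refine tendsto_of_tendsto_of_tendsto_of_le_of_le' tendsto_const_nhds hbnd'
    (Eventually.of_forall fun _ => zero_le) ?_
  filter_upwards [hBclose, hK, hcfb.bound, hcqb.bound, one_le_uSeq et,
    eventually_ge_atTop (2 * l), het.eventually_le_const (half_pos hqs)] with
    n hBn hKn hcfn hcqn hun hln hetn
  have hn : n ≠ 0 := by omega
  have hZ : Measurable fun ω (t : Fin n) => Z t ω :=
    measurable_pi_iff.2 fun t => hXZ.measurable_obs t
  have hmap := hXZ.map_eq (statDist_isStationary Qs).1.1 n
  have he := het_pos n
  have hε : 0 < eps n := he.trans_le (het_le n)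
  rw [Real.norm_of_nonneg (Real.exp_pos _).le, Real.norm_of_nonneg measureReal_nonneg]
    at hcfn hcqn
  have hprior : (cq * cf)⁻¹ * (Real.exp (-CQ * n * et n ^ 2) * Real.exp (-Cf * n * et n ^ 2)) ≤
      PiQ.real {Q | ‖Q.1 - Qs.1‖ ≤ et n / √(uSeq et n)} * Pif.real (B n) := by
    rw [inv_mul_le_iff₀ (by positivity)]
    calc _ ≤ _ := mul_le_mul hcqn hcfn (Real.exp_pos _).le (by positivity)
      _ = _ := by ring
  have key := measure_posterior_ge_le_of_sieve hg PiQ Pif (Qs, fs) hqs hQs hn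
    (Nat.one_le_iff_ne_zero.1 hl) hln he (het_le n) hun hetn hBn
    (by positivity : 0 ≤ |K| * Real.exp (C' * n * eps n ^ 2))
    (hKn.trans (ENNReal.ofReal_le_ofReal (by gcongr; exact le_abs_self K)))
    (hq n).1 ((hq n).2.trans (div_le_self zero_le_one hk' |>.trans_eq' (by simp)))
    hMl hM (by positivity) hprior hδ
  calc _ ≤ (P.map fun ω (t : Fin n) => Z t ω) {y | δ ≤ (posterior (PiQ.prod Pif) g y
        {θ | M * (eps n / q n) ≤ marginalDist l θ (Qs, fs)}).toReal} := by
        refine (measure_mono fun ω hω => ?_).trans (Measure.le_map_apply hZ.aemeasurable _)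
        simpa using hω
    _ ≤ _ := by
        rw [hmap]
        exact key
    _ ≤ _ := ENNReal.ofReal_le_ofReal ?_
  have hGE : n * et n ^ 2 ≤ n * eps n ^ 2 := by
    have := het_le n
    gcongr
  have hCE : C * (n * et n ^ 2) ≤ C * (n * eps n ^ 2) := by gcongr
  have hE0 : 0 < n * et n ^ 2 := by positivity
  have hG0 : 0 < n * eps n ^ 2 := hE0.trans_le hGE
  have hcK := le_constK hk hqs hqs1
  have hDG : D * (n * eps n ^ 2) = C' * (n * eps n ^ 2) + C * (n * eps n ^ 2) + n * eps n ^ 2 := by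
    rw [hDdef]
    ring
  simp only [Function.comp_apply, Pi.inv_apply]
  refine add_le_add (add_le_add ?_ le_rfl) ?_
  · calc _ = |K| * 5 ^ (k ^ l + 1) * (Real.exp (C' * n * eps n ^ 2) *
          Real.exp (-D * (n * eps n ^ 2) + 4 * l * eps n)) := by ring
      _ ≤ _ := by
        rw [← Real.exp_add, ← Real.exp_add]
        refine mul_le_mul_of_nonneg_left (Real.exp_le_exp.2 ?_) (by positivity)
        linarith [mul_pos hC hG0]
  · set pQ := PiQ.real (TransMat.bounded k (q n))ᶜ
    set pF := Pif.real (F n)ᶜ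
    have hpQ : 0 ≤ pQ := measureReal_nonneg
    have hpF : 0 ≤ pF := measureReal_nonneg
    -- The likelihood loss and the prior masses of the two neighbourhoods together cost at most `exp
    -- (C * (n * et n ^ 2))`, which is what the condition on the constants provides through
    -- `le_constK`.
    have h1 : Real.exp ((2 * k / qs + 6) * (n * et n ^ 2)) /
        ((cq * cf)⁻¹ * (Real.exp (-CQ * n * et n ^ 2) * Real.exp (-Cf * n * et n ^ 2))) ≤
        cq * cf * Real.exp (C * (n * et n ^ 2)) := by
      rw [div_le_iff₀ (by positivity), ← Real.exp_add]
      calc _ ≤ Real.exp (C * (n * et n ^ 2) +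
            (-CQ * n * et n ^ 2 + -Cf * n * et n ^ 2)) := by
            rw [Real.exp_le_exp]
            have := mul_le_mul_of_nonneg_right
              (by linarith : 2 * k / qs + 6 ≤ C - CQ - Cf) hE0.le
            linarith
        _ = _ := by
            rw [Real.exp_add]
            field_simp
    -- The denominator lives at the scale `et n` and the tests at the scale `eps n`; `et n ≤ eps n`
    -- lets the test exponent absorb the cost of the denominator.
    have h2 : Real.exp (C * (n * et n ^ 2)) *
        Real.exp (-D * (n * eps n ^ 2) + 4 * l * eps n) ≤
          Real.exp (-(n * eps n ^ 2)) * Real.exp (4 * l * eps n) := by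
      rw [← Real.exp_add, ← Real.exp_add, Real.exp_le_exp]
      linarith [mul_pos hC' hG0]
    have h3 : ∀ x : ℝ, x / Real.exp (-C * n * et n ^ 2) = Real.exp (C * (n * et n ^ 2)) * x := by
      intro x
      rw [div_eq_mul_inv, ← Real.exp_neg, mul_comm]
      congr 2
      ring
    rw [h3, h3]
    calc _ ≤ 8 / (δ * qs) * (cq * cf * Real.exp (C * (n * et n ^ 2))) *
          (k * Real.exp (-D * (n * eps n ^ 2) + 4 * l * eps n) + k * (pQ + pF)) := by gcongr
      _ = 8 / (δ * qs) * (cq * cf) * k * (Real.exp (C * (n * et n ^ 2)) *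
          Real.exp (-D * (n * eps n ^ 2) + 4 * l * eps n) +
            (Real.exp (C * (n * et n ^ 2)) * pQ + Real.exp (C * (n * et n ^ 2)) * pF)) := by ring
      _ ≤ _ := by gcongr

end Rates
end BayesHMM

theorem theorem1 {d k : ℕ} (hk : 1 ≤ k)
    (lam : Measure (EuclideanSpace ℝ (Fin d))) [SigmaFinite lam]
    -- the prior `Π = Π_Q ⊗ Π_f` and a jointly measurable version of the densities
    (PiQ : Measure (TransMat k)) [IsProbabilityMeasure PiQ]
    (Pif : Measure (Fin k → Density lam)) [IsProbabilityMeasure Pif]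
    (g : (Fin k → Density lam) → Fin k → EuclideanSpace ℝ (Fin d) → ℝ) (hg : IsJointVersion g)
    -- the true parameter `θ* = (Q*, f*)`
    (Qs : TransMat k) (fs : Fin k → Density lam)
    (qs : ℝ) (hqs : 0 < qs) (hQs : Qs ∈ TransMat.bounded k qs)
    -- the observed process under `θ*`, started from the stationary distribution
    {Ω : Type*} [MeasurableSpace Ω] (P : Measure Ω) [IsProbabilityMeasure P]
    (X : ℕ → Ω → Fin k) (Y : ℕ → Ω → EuclideanSpace ℝ (Fin d))
    (hXY : IsHMM P X Y (statDist Qs) (Qs, fs))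
    -- the rates
    (eps et : ℕ → ℝ) (het_pos : ∀ n, 0 < et n) (het_le : ∀ n, et n ≤ eps n)
    (heps : Tendsto eps atTop (𝓝 0)) (het : Tendsto et atTop (𝓝 0))
    (het_large : Tendsto (fun n : ℕ => n * et n ^ 2) atTop atTop)
    -- the assumptions
    (Cf C C' CQ : ℝ) (hCf : 0 < Cf) (hC : 0 < C) (hC' : 0 < C') (hCQ : 0 < CQ)
    (hA : AssumptionA Pif fs et Cf)
    (hB : AssumptionB Pif eps et C C')
    (hconst : CQ + Cf + constK k qs < C)
    (hQ : AssumptionC PiQ Qs et CQ)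
    (q : ℕ → ℝ) (hD : AssumptionD PiQ et q C)
    (l : ℕ) (hl : 1 ≤ l) :
    ∃ M : ℝ, 0 < M ∧
      TendstoInMeasure P
        (fun (n : ℕ) (ω : Ω) =>
          (posterior (PiQ.prod Pif) g (fun t : Fin n => Y t ω)
            {θ | M * (eps n / q n) ≤ marginalDist l θ (Qs, fs)}).toReal)
        atTop (fun _ => 0) := by
  have : NeZero k := ⟨by omega⟩
  exact exists_tendstoInMeasure_posterior PiQ Pif hg Qs fs hqs hQs hXY het_pos het_le heps het
    het_large hC hC' hA hB hconst hQ hD hl
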